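/- Let $d\ge 1$, $D\ge 1$, $c>0$, $\varepsilon\in(0,1]$. For Borel probability measures $\mu,\nu$ on $\mathbb R^d$ let $\mathcal W_1(\mu,\nu)=\inf \mathbb E|\xi-\zeta|\in[0,\infty]$, the infimum over all couplings $\mathcal L(\xi)=\mu$, $\mathcal L(\zeta)=\nu$, and let $\mathcal P_1(\mathbb R^d)$ be the set of those with finite first moment. Let $\bar w=(\bar w_t)_{t\ge0}$ be a family of Borel probability measures on $[0,1]$ in the class $\mathbf\Pi_2(\varepsilon)$, i.e. $$\limsup_{t\to\infty}\int_0^1 \min(t^{\varepsilon}, s^{-\varepsilon})\,\bar w_t(ds)<\infty,\qquad \limsup_{t\to\infty}\int_0^1\!\!\int_0^1 \min(t^{\varepsilon}, |s_1-s_2|^{-\varepsilon})\,\bar w_t(ds_1)\,\bar w_t(ds_2)<\infty .$$ Then there are constants $C>0$ and $T>0$, depending only on $d,D,c,\bar w,\varepsilon$, such that the following holds. Let $Y=(Y_t)_{t\ge0}$ be a Markov process on $\mathbb R^d$ with time-homogeneous transition semigroup $(P_t)_{t\ge0}$, adapted to a filtered probability space, with $(\omega,t)\mapsto Y_t(\omega)$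 jointly measurable. Assume * $\mathcal W_1(\mu P_t,\nu P_t)\le D e^{-ct}\,\mathcal W_1(\mu,\nu)$ for all $\mu,\nu\in\mathcal P_1(\mathbb R^d)$ and $t\ge0$; * $\limsup_{t\to0^+}\mathcal W_1(\mu P_t,\mu)<\infty$ for all $\mu\in\mathcal P_1(\mathbb R^d)$; * $\sup_{t\ge0}\|Y_t\|_{L^q}\le M_q$ for some $q\in(1,\infty]$ and $M_q\in(0,\infty)$. Then $(P_t)$ has a unique invariant measure $\mu^*$ in $\mathcal P_1(\mathbb R^d)$, and the weighted empirical measures $\mu_t=\int_0^1\delta_{Y_{ts}}\,\bar w_t(ds)$ satisfy, with $\hat t=t^{\varepsilon}$ and for all $t\ge T$, $$\mathbb E[\mathcal W_1(\mu_t,\mu^*)]\le C\,M_q\begin{cases}\Big(\dfrac{(\log\hat t)^{d-2+\frac1d}}{\hat t^{1/d}}\Big)^{1-\frac1q}, & d\ge3,\\[2mm] \Big(\dfrac{\log\hat t}{\sqrt{\hat t}}\Big)^{1-\frac1q}, & d=2,\\[2mm] \Big(\sqrt{\dfrac{\log\hat t}{\hat t}}\Big)^{1-\frac1q}, & d=1,\end{cases}$$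 where $1/q=0$ if $q=\infty$. -/

import Mathlib

open MeasureTheory ProbabilityTheory Filter Topology
open scoped NNReal ENNReal

noncomputable section

namespace MarkovW1

section General

variable {E : Type*} [MetricSpace E] [MeasurableSpace E]

/-- The `1`-Wasserstein distance, as an infimum over couplings, with values in `[0, ∞]`. -/
def W1 (μ ν : Measure E) : ℝ≥0∞ :=
  ⨅ (π : Measure (E × E)) (_ : π.map Prod.fst = μ ∧ π.map Prod.snd = ν),
    ∫⁻ z, edist z.1 z.2 ∂π

/-- `μ` is a probability measure with finite first moment. -/
structure IsP1 (μ : Measure E) : Prop where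
  isProb : IsProbabilityMeasure μ
  moment : ∀ y : E, ∫⁻ x, edist x y ∂μ < ∞

/-- A time-homogeneous Markov transition semigroup. -/
structure IsMarkovSemigroup (P : ℝ≥0 → Kernel E E) : Prop where
  isMarkov : ∀ t, IsMarkovKernel (P t)
  zero : P 0 = Kernel.id
  add : ∀ s t, P (s + t) = P t ∘ₖ P s

/-- Exponential contractivity in `W1`; `μ.bind (P t)` is the measure `μ Pₜ`. -/
def IsExpContractive (P : ℝ≥0 → Kernel E E) (D c : ℝ) : Prop :=
  ∀ μ ν : Measure E, IsP1 μ → IsP1 ν → ∀ t : ℝ≥0,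
    W1 (μ.bind (P t)) (ν.bind (P t)) ≤ ENNReal.ofReal (D * Real.exp (-c * t)) * W1 μ ν

/-- `limsup_{t → 0+} W1 (μ Pₜ, μ) < ∞` for every `μ` with finite first moment. -/
def IsFiniteAtZero (P : ℝ≥0 → Kernel E E) : Prop :=
  ∀ μ : Measure E, IsP1 μ → limsup (fun t : ℝ≥0 => W1 (μ.bind (P t)) μ) (𝓝[>] 0) < ∞

/-- `μ` is an invariant measure of `P` with finite first moment. -/
def IsInvariantP1 (P : ℝ≥0 → Kernel E E) (μ : Measure E) : Prop :=
  IsP1 μ ∧ ∀ t, μ.bind (P t) = μ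

/-- `Y` is a Markov process with transition semigroup `P`, adapted to the filtration `ℱ`. -/
structure IsMarkovProcess {Ω : Type*} {mΩ : MeasurableSpace Ω} (Y : ℝ≥0 → Ω → E)
    (P : ℝ≥0 → Kernel E E) (ℱ : Filtration ℝ≥0 mΩ) (Pr : Measure Ω) : Prop where
  semigroup : IsMarkovSemigroup P
  adapted : ∀ t, Measurable[ℱ t] (Y t)
  markov : ∀ (s t : ℝ≥0) (A : Set E), MeasurableSet A →
    Pr⟦Y (s + t) ⁻¹' A | ℱ s⟧ =ᵐ[Pr] fun ω => (P t (Y s ω)).real A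

/-- A weight family: a probability measure `wₜ` on `[0,1]` for every `t ≥ 0`. -/
abbrev WeightFamily : Type := ℝ≥0 → ProbabilityMeasure unitInterval

/-- The class of weight families written `Π₂(ε)`. -/
structure IsPi2 (ε : ℝ) (w : WeightFamily) : Prop where
  single : limsup (fun t : ℝ≥0 => ∫⁻ s : unitInterval,
      min ((t : ℝ≥0∞) ^ ε) (ENNReal.ofReal (s : ℝ) ^ (-ε)) ∂(w t : Measure unitInterval))
    atTop < ∞
  double : limsup (fun t : ℝ≥0 => ∫⁻ s₁ : unitInterval, ∫⁻ s₂ : unitInterval,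
      min ((t : ℝ≥0∞) ^ ε) (ENNReal.ofReal |(s₁ : ℝ) - (s₂ : ℝ)| ^ (-ε))
        ∂(w t : Measure unitInterval) ∂(w t : Measure unitInterval))
    atTop < ∞

/-- The weighted empirical measure `∫₀¹ δ_{Y_{ts}} wₜ(ds)` of the path `Y · ω`. -/
def weightedEmpirical {Ω : Type*} (Y : ℝ≥0 → Ω → E) (w : WeightFamily) (t : ℝ≥0) (ω : Ω) :
    Measure E :=
  (w t : Measure unitInterval).map fun s => Y (t * unitInterval.toNNReal s) ω

end General

/-- The rate in dimension `d ≥ 1`, as a function of `τ = t ^ ε`. -/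
def rate (d : ℕ) (τ : ℝ) : ℝ :=
  if d = 1 then Real.sqrt (Real.log τ / τ)
  else if d = 2 then Real.log τ / Real.sqrt τ
  else Real.log τ ^ ((d : ℝ) - 2 + 1 / (d : ℝ)) / τ ^ (1 / (d : ℝ))

end MarkovW1

end

/-!
The proof reduces the mean Wasserstein distance to second moments of Fourier modes.

*Deterministic part.* By Kantorovich duality (`W1_le_of_forall_lipschitz`) it suffices to compare
the integrals of a `1`-Lipschitz function `f`. On the ball of radius `2 R`, `f` factors through the
torus `Circle ^ d` (`exists_torus_extension`), where it is approximated up to `O (R / n)` by a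
trigonometric polynomial with frequencies of size at most `2 n` whose coefficients are square
summable with the weight `|k| ^ 2` (`exists_trigPoly_approx`, a Jackson theorem obtained by
averaging over a finite grid, so that only finite sums occur). The Cauchy-Schwarz inequality then
gives `W1_le_fourierDisc`: `W1 μ ν` is at most a constant times the sum of the tails beyond `R`, of
`R / n`, and of `R` times a truncated negative Sobolev norm of `μ - ν`.

*Probabilistic part.* Contraction makes the laws of `Y` a Cauchy family in `W1`; its limit is the
invariant measure (`exists_invariant`). For a character `g` with mean `m` under the invariant
measure, the Markov property and contraction bound `|E (g (Y s) - m) conj (g (Y (s + u)) - m)|` by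
a multiple of `min 1 (A exp (- c u))`, where `A` is proportional to the Lipschitz constant of `g`.
As this function of `u` is `O (log A * min 1 (u ^ (-ε)))`, the condition on the weights shows that
the mean-square deviation of the empirical mean of `g` from `m` is `O (log A / t ^ ε)`
(`lintegral_enorm_sq_weightedEmpirical_le`).

*Choice of parameters.* With `τ = t ^ ε`, take `n` of order `τ ^ (1 / d)`, and
`R = M * rate ^ (-1 / q)`. Summing over the lattice, the Sobolev norm is at most of the order of the
rate (`sum_inv_sq_freqBox_le`, `sum_pow_div_sq_mul_log_le`), and the moment of order `q` bounds the
tail by `M ^ q * R ^ (1 - q) = R * rate` (`lintegral_excess_le`), so that every contribution is at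
most of order `R * rate`.
-/

set_option linter.unusedSectionVars false

namespace MarkovW1

/-! ### Kantorovich duality -/

/-- Finite Kantorovich duality: if every dual-feasible pair of potentials has value at most `s`,
some coupling has cost at most `s`. The set of (marginals, cost) of all joint weights is compact and
convex; were it disjoint from `{a} × {b} × (-∞, s]`, a separating functional would be a pair of
potentials of value larger than `s`. -/
lemma exists_coupling_of_dual_le {ι κ : Type*} [Fintype ι] [Fintype κ] {a : ι → ℝ} {b : κ → ℝ}
    (ha : a ∈ stdSimplex ℝ ι) (hb : b ∈ stdSimplex ℝ κ) (c : ι → κ → ℝ) (s : ℝ)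
    (h : ∀ (F : ι → ℝ) (G : κ → ℝ), (∀ i j, F i + G j ≤ c i j) →
      ∑ i, F i * a i + ∑ j, G j * b j ≤ s) :
    ∃ π : ι → κ → ℝ, (∀ i j, 0 ≤ π i j) ∧ (∀ i, ∑ j, π i j = a i) ∧ (∀ j, ∑ i, π i j = b j) ∧
      ∑ i, ∑ j, π i j * c i j ≤ s := by
  classical
  let Φ : (ι × κ → ℝ) →ₗ[ℝ] (ι → ℝ) × (κ → ℝ) × ℝ :=
    { toFun := fun p => (fun i => ∑ j, p (i, j), fun j => ∑ i, p (i, j),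
        ∑ i, ∑ j, p (i, j) * c i j)
      map_add' := fun p p' => by
        ext <;> simp [Finset.sum_add_distrib, add_mul]
      map_smul' := fun r p => by
        ext <;> simp [Finset.mul_sum, mul_assoc] }
  have hΦ : Continuous Φ := Φ.continuous_of_finiteDimensional
  by_contra hcon
  have hdisj : Disjoint (Φ '' stdSimplex ℝ (ι × κ)) ({a} ×ˢ {b} ×ˢ Set.Iic s) := by
    rw [Set.disjoint_left]
    rintro _ ⟨p, hp, rfl⟩ ⟨h1, h2, h3⟩
    refine hcon ⟨fun i j => p (i, j), fun i j => hp.1 _, fun i => ?_, fun j => ?_, h3⟩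
    · exact congrFun h1 i
    · exact congrFun h2 j
  -- The separating functional is `(x, y, r) ↦ F · x + G · y + m r`.
  obtain ⟨f, u, v, hA, huv, hB⟩ := geometric_hahn_banach_compact_closed
    ((convex_stdSimplex ℝ (ι × κ)).linear_image Φ) ((isCompact_stdSimplex ℝ (ι × κ)).image hΦ)
    ((convex_singleton a).prod ((convex_singleton b).prod (convex_Iic s)))
    (isClosed_singleton.prod (isClosed_singleton.prod isClosed_Iic)) hdisj
  set F : ι → ℝ := fun i => f (Pi.single i 1, 0, 0) with hF
  set G : κ → ℝ := fun j => f (0, Pi.single j 1, 0) with hG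
  set m : ℝ := f (0, 0, 1) with hm
  have hf : ∀ x y r, f (x, y, r) = ∑ i, F i * x i + ∑ j, G j * y j + m * r := by
    intro x y r
    have e : ((x, y, r) : (ι → ℝ) × (κ → ℝ) × ℝ) =
        ∑ i, x i • ((Pi.single i 1, 0, 0) : (ι → ℝ) × (κ → ℝ) × ℝ) +
        ∑ j, y j • ((0, Pi.single j 1, 0) : (ι → ℝ) × (κ → ℝ) × ℝ) +
        r • ((0, 0, 1) : (ι → ℝ) × (κ → ℝ) × ℝ) := by
      ext k
      · simp [Prod.fst_sum, Finset.sum_apply, Pi.single_apply]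
      · simp [Prod.snd_sum, Prod.fst_sum, Finset.sum_apply, Pi.single_apply]
      · simp [Prod.snd_sum]
    rw [e]
    simp only [map_add, map_sum, map_smul, smul_eq_mul, hF, hG, hm]
    simp only [mul_comm]
  have hA' : ∀ i j, F i + G j + m * c i j < u := by
    intro i j
    have := hA _ ⟨Pi.single (i, j) 1, single_mem_stdSimplex ℝ (i, j), rfl⟩
    have e : Φ (Pi.single (i, j) 1) = (Pi.single i 1, Pi.single j 1, c i j) := by
      ext k
      · by_cases hk : k = i
        · subst hk
          simp only [Φ, LinearMap.coe_mk, AddHom.coe_mk, Pi.single_apply, Prod.mk.injEq]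
          simp
        · simp [Φ, Pi.single_apply, hk]
      · by_cases hk : k = j
        · subst hk
          simp only [Φ, LinearMap.coe_mk, AddHom.coe_mk, Pi.single_apply, Prod.mk.injEq]
          simp
        · simp [Φ, Pi.single_apply, hk]
      · simp [Φ, Pi.single_apply, ite_and]
    rw [e, hf] at this
    simpa [Pi.single_apply] using this
  set X := ∑ i, F i * a i + ∑ j, G j * b j with hX
  have hB' : ∀ r ≤ s, v < X + m * r := by
    intro r hr
    have := hB (a, b, r) ⟨rfl, rfl, hr⟩
    rwa [hf] at this
  -- The product law `a ⊗ b` is a joint law with the prescribed marginals.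
  have hsplit : ∑ i, ∑ j, a i * b j * (F i + G j) = X := by
    have h1 : ∀ i, ∑ j, a i * b j * (F i + G j) = F i * a i + a i * ∑ j, G j * b j := by
      intro i
      have : ∀ j, a i * b j * (F i + G j) = F i * a i * b j + a i * (G j * b j) :=
        fun j => by ring
      simp_rw [this, Finset.sum_add_distrib, ← Finset.mul_sum, hb.2, mul_one]
    simp_rw [h1, Finset.sum_add_distrib, ← Finset.sum_mul, ha.2, one_mul]
    rfl
  rcases lt_trichotomy m 0 with hm0 | hm0 | hm0
  -- If `m < 0`, then `((F - u) / (-m), G / (-m))` is a feasible pair of value larger than `s`.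
  · have hn : 0 < -m := by linarith
    have := h (fun i => (F i - u) / (-m)) (fun j => G j / (-m)) (fun i j => by
      rw [← add_div, div_le_iff₀ hn]; have := hA' i j; nlinarith)
    have e : ∑ i, (F i - u) / (-m) * a i + ∑ j, G j / (-m) * b j = (X - u) / (-m) := by
      have h1 : ∀ i, (F i - u) / (-m) * a i = (F i * a i) / (-m) - u / (-m) * a i :=
        fun i => by ring
      have h2 : ∀ j, G j / (-m) * b j = (G j * b j) / (-m) := fun j => by ring
      simp_rw [h1, h2, Finset.sum_sub_distrib, ← Finset.mul_sum, ← Finset.sum_div, ha.2, hX]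
      ring
    rw [e, div_le_iff₀ hn] at this
    have := hB' s le_rfl
    nlinarith
  -- If `m = 0`, then `F + G < u` everywhere, against `u < v < X` by averaging over `a ⊗ b`.
  · have hv := hB' s le_rfl
    have hle : X ≤ u := by
      rw [← hsplit]
      calc ∑ i, ∑ j, a i * b j * (F i + G j) ≤ ∑ i, ∑ j, a i * b j * u := by
            gcongr with i _ j _
            · exact mul_nonneg (ha.1 i) (hb.1 j)
            · have := hA' i j; rw [hm0] at this; linarith
        _ = u := by simp_rw [← Finset.sum_mul, ← Finset.mul_sum, hb.2, mul_one, ha.2, one_mul]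
    rw [hm0] at hv; linarith
  -- If `m > 0`, the functional is unbounded below on the half-line.
  · have h1 := hB' (min s ((v - X) / m)) (min_le_left _ _)
    have h2 : m * min s ((v - X) / m) ≤ m * ((v - X) / m) :=
      mul_le_mul_of_nonneg_left (min_le_right _ _) hm0.le
    rw [mul_div_cancel₀ _ hm0.ne'] at h2
    linarith

lemma sum_restrict_preimage_simpleFunc {E F : Type*} [MeasurableSpace E] (μ : Measure E)
    (T : SimpleFunc E F) : ∑ p : T.range, μ.restrict (T ⁻¹' {(p : F)}) = μ := by
  classical
  ext S hS
  rw [Measure.finsetSum_apply]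
  simp_rw [Measure.restrict_apply hS]
  rw [← tsum_fintype (L := .unconditional _), ← measure_iUnion]
  · congr 1
    ext x
    simp
  · intro p q hpq
    refine Set.disjoint_left.2 fun x hx hx' => hpq (Subtype.ext ?_)
    exact hx.2.symm.trans hx'.2
  · exact fun p => hS.inter (T.measurableSet_preimage _)

lemma integral_comp_simpleFunc {E F : Type*} [MeasurableSpace E] (μ : Measure E)
    [IsFiniteMeasure μ] (T : SimpleFunc E F) (g : F → ℝ) :
    ∫ x, g (T x) ∂μ = ∑ p : T.range, g p * μ.real (T ⁻¹' {(p : F)}) := by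
  have hi : Integrable (fun x => g (T x)) μ := (T.map g).integrable_of_isFiniteMeasure
  conv_lhs => rw [← sum_restrict_preimage_simpleFunc μ T]
  rw [integral_finsetSum_measure fun p _ => hi.restrict]
  refine Finset.sum_congr rfl fun p _ => ?_
  rw [setIntegral_congr_fun (g := fun _ => g p) (T.measurableSet_preimage _)
    fun x hx => by simp only [Set.mem_preimage, Set.mem_singleton_iff] at hx; simp only [hx],
    setIntegral_const, smul_eq_mul, mul_comm]

/-- A joint law `p` of two finite discretizations `T`, `T'` of `(E, μ)`, `(F, ν)` lifts to a
coupling of `μ` and `ν`: pick the pair of cells from `p` and then two independent points of the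
cells. -/
lemma exists_coupling_of_discretization {E F : Type*} [MeasurableSpace E] [MeasurableSpace F]
    {α β : Type*} (μ : Measure E) (ν : Measure F) [IsProbabilityMeasure μ] [IsProbabilityMeasure ν]
    (T : SimpleFunc E α) (T' : SimpleFunc F β) (p : T.range → T'.range → ℝ)
    (hp : ∀ i j, 0 ≤ p i j) (hp1 : ∀ i, ∑ j, p i j = μ.real (T ⁻¹' {(i : α)}))
    (hp2 : ∀ j, ∑ i, p i j = ν.real (T' ⁻¹' {(j : β)})) :
    ∃ π : Measure (E × F), π.map Prod.fst = μ ∧ π.map Prod.snd = ν ∧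
      ∀ c : α → β → ℝ≥0∞, ∫⁻ z, c (T z.1) (T' z.2) ∂π =
        ∑ i : T.range, ∑ j : T'.range, ENNReal.ofReal (p i j) * c i j := by
  classical
  set A : T.range → Set E := fun i => T ⁻¹' {(i : α)} with hA
  set B : T'.range → Set F := fun j => T' ⁻¹' {(j : β)} with hB
  have hAm : ∀ i, MeasurableSet (A i) := fun i => T.measurableSet_preimage _
  have hBm : ∀ j, MeasurableSet (B j) := fun j => T'.measurableSet_preimage _
  -- The conditional law on a null cell is the zero measure, so null cells must have no mass in `p`.
  have hpA : ∀ i j, μ (A i) = 0 → p i j = 0 := fun i j h => by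
    have h0 := hp1 i
    rw [measureReal_def, h, ENNReal.toReal_zero] at h0
    exact (Finset.sum_eq_zero_iff_of_nonneg (fun j _ => hp i j)).1 h0 j (Finset.mem_univ _)
  have hpB : ∀ i j, ν (B j) = 0 → p i j = 0 := fun i j h => by
    have h0 := hp2 j
    rw [measureReal_def, h, ENNReal.toReal_zero] at h0
    exact (Finset.sum_eq_zero_iff_of_nonneg (fun i _ => hp i j)).1 h0 i (Finset.mem_univ _)
  have hs1 : ∀ i, ∑ j, ENNReal.ofReal (p i j) = μ (A i) := fun i => by
    rw [← ENNReal.ofReal_sum_of_nonneg (fun j _ => hp i j), hp1, measureReal_def,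
      ENNReal.ofReal_toReal (measure_ne_top _ _)]
  have hs2 : ∀ j, ∑ i, ENNReal.ofReal (p i j) = ν (B j) := fun j => by
    rw [← ENNReal.ofReal_sum_of_nonneg (fun i _ => hp i j), hp2, measureReal_def,
      ENNReal.ofReal_toReal (measure_ne_top _ _)]
  have hcμ : ∀ i, μ (A i) • μ[|A i] = μ.restrict (A i) := fun i => by
    by_cases h : μ (A i) = 0
    · rw [h, zero_smul, Measure.restrict_eq_zero.2 h]
    · rw [ProbabilityTheory.cond, smul_smul, ENNReal.mul_inv_cancel h (measure_ne_top _ _),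
        one_smul]
  have hcν : ∀ j, ν (B j) • ν[|B j] = ν.restrict (B j) := fun j => by
    by_cases h : ν (B j) = 0
    · rw [h, zero_smul, Measure.restrict_eq_zero.2 h]
    · rw [ProbabilityTheory.cond, smul_smul, ENNReal.mul_inv_cancel h (measure_ne_top _ _),
        one_smul]
  refine ⟨∑ i, ∑ j, ENNReal.ofReal (p i j) • (μ[|A i]).prod (ν[|B j]), ?_, ?_, ?_⟩
  · rw [Measure.map_finset_sum' measurable_fst.aemeasurable]
    simp_rw [Measure.map_finset_sum' (f := Prod.fst) measurable_fst.aemeasurable, Measure.map_smul,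
      Measure.map_fst_prod, smul_smul]
    refine Eq.trans ?_ (sum_restrict_preimage_simpleFunc μ T)
    refine Finset.sum_congr rfl fun i _ => ?_
    refine Eq.trans ?_ (hcμ i)
    rw [← hs1 i, Finset.sum_smul]
    refine Finset.sum_congr rfl fun j _ => ?_
    by_cases h : ν (B j) = 0
    · rw [hpB i j h]; simp
    · have := cond_isProbabilityMeasure h
      rw [measure_univ, mul_one]
  · rw [Measure.map_finset_sum' measurable_snd.aemeasurable]
    simp_rw [Measure.map_finset_sum' (f := Prod.snd) measurable_snd.aemeasurable, Measure.map_smul,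
      Measure.map_snd_prod, smul_smul]
    rw [Finset.sum_comm]
    refine Eq.trans ?_ (sum_restrict_preimage_simpleFunc ν T')
    refine Finset.sum_congr rfl fun j _ => ?_
    refine Eq.trans ?_ (hcν j)
    rw [← hs2 j, Finset.sum_smul]
    refine Finset.sum_congr rfl fun i _ => ?_
    by_cases h : μ (A i) = 0
    · rw [hpA i j h]; simp
    · have := cond_isProbabilityMeasure h
      rw [measure_univ, mul_one]
  · intro c
    rw [lintegral_finsetSum_measure]
    refine Finset.sum_congr rfl fun i _ => ?_
    rw [lintegral_finsetSum_measure]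
    refine Finset.sum_congr rfl fun j _ => ?_
    rw [lintegral_smul_measure, smul_eq_mul]
    by_cases h : μ (A i) = 0
    · rw [hpA i j h]; simp
    by_cases h' : ν (B j) = 0
    · rw [hpB i j h']; simp
    have := cond_isProbabilityMeasure h
    have := cond_isProbabilityMeasure h'
    congr 1
    have hae : ∀ᵐ z ∂(μ[|A i]).prod (ν[|B j]), c (T z.1) (T' z.2) = c i j := by
      have h1 : ∀ᵐ z ∂(μ[|A i]).prod (ν[|B j]), z.1 ∈ A i :=
        Measure.quasiMeasurePreserving_fst.ae (ae_cond_mem (hAm i))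
      have h2 : ∀ᵐ z ∂(μ[|A i]).prod (ν[|B j]), z.2 ∈ B j :=
        Measure.quasiMeasurePreserving_snd.ae (ae_cond_mem (hBm j))
      filter_upwards [h1, h2] with z hz1 hz2
      rw [show T z.1 = i from hz1, show T' z.2 = j from hz2]
    rw [lintegral_congr_ae hae, lintegral_const, measure_univ, mul_one]

section

variable {E : Type*} [MetricSpace E] [MeasurableSpace E] [BorelSpace E]

/-- The integral of a `1`-Lipschitz function moves by at most the transport cost of a
discretization. -/
lemma abs_integral_simpleFunc_sub_le {μ : Measure E} [IsProbabilityMeasure μ] {T : SimpleFunc E E}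
    {f : E → ℝ} (hf : LipschitzWith 1 f) {K : ℝ} (hK : ∀ x, |f x| ≤ K) {δ : ℝ≥0}
    (hT : ∫⁻ x, edist (T x) x ∂μ ≤ δ) : |∫ x, f (T x) ∂μ - ∫ x, f x ∂μ| ≤ δ := by
  have i1 : Integrable (fun x => f x) μ := Integrable.of_bound
    hf.continuous.measurable.aestronglyMeasurable K (ae_of_all _ hK)
  have i2 : Integrable (fun x => f (T x)) μ := Integrable.of_bound
    (hf.continuous.measurable.comp T.measurable).aestronglyMeasurable K (ae_of_all _ fun _ => hK _)
  rw [← integral_sub i2 i1]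
  have : ‖∫ x, (f (T x) - f x) ∂μ‖ₑ ≤ δ := by
    refine (enorm_integral_le_lintegral_enorm _).trans ((lintegral_mono fun x => ?_).trans hT)
    have := hf (T x) x
    rwa [ENNReal.coe_one, one_mul, edist_eq_enorm_sub] at this
  rw [← ofReal_norm, ENNReal.ofReal_le_iff_le_toReal ENNReal.coe_ne_top] at this
  simpa using this

/-- Kantorovich duality, hard direction: the distance is at most the supremum of `∫ f dμ - ∫ f dν`
over bounded `1`-Lipschitz functions `f`. The finite duality is applied to discretizations of `μ`
and `ν`; a feasible pair of potentials is replaced by a single Lipschitz function through an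
inf-convolution. -/
theorem W1_le_of_forall_lipschitz [SecondCountableTopology E] {μ ν : Measure E} (hμ : IsP1 μ)
    (hν : IsP1 ν) {s : ℝ}
    (h : ∀ f : E → ℝ, LipschitzWith 1 f → (∃ K, ∀ x, |f x| ≤ K) →
      ∫ x, f x ∂μ - ∫ x, f x ∂ν ≤ s) :
    W1 μ ν ≤ ENNReal.ofReal s := by
  classical
  have := hμ.isProb
  have := hν.isProb
  obtain ⟨y₀⟩ : Nonempty E := μ.nonempty_of_neZero
  have approx : ∀ (ρ : Measure E), IsP1 ρ → ∀ δ : ℝ≥0, 0 < δ →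
      ∃ T : SimpleFunc E E, ∫⁻ x, edist (T x) x ∂ρ ≤ δ := by
    intro ρ hρ δ hδ
    set A := SimpleFunc.approxOn (id : E → E) measurable_id Set.univ y₀ (Set.mem_univ _) with hA
    have hlim : Tendsto (fun n => ∫⁻ x, edist (A n x) x ∂ρ) atTop (𝓝 (∫⁻ _, 0 ∂ρ)) := by
      refine tendsto_lintegral_of_dominated_convergence (fun x => edist x y₀) (fun n => ?_)
        (fun n => ae_of_all _ fun x => ?_) (hρ.moment y₀).ne (ae_of_all _ fun x => ?_)
      · exact (A n).measurable.edist measurable_id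
      · simp only [edist_comm x y₀]
        exact SimpleFunc.edist_approxOn_le measurable_id _ x n
      · exact (tendsto_iff_edist_tendsto_0.1
          (SimpleFunc.tendsto_approxOn measurable_id (Set.mem_univ y₀) (by simp) : _))
    rw [lintegral_zero] at hlim
    obtain ⟨n, hn⟩ := (hlim.eventually (gt_mem_nhds (ENNReal.coe_pos.2 hδ))).exists
    exact ⟨_, hn.le⟩
  -- Needed since `ENNReal.ofReal s` would otherwise be a truncation.
  have s0 : 0 ≤ s := by simpa using h (fun _ => 0) (LipschitzWith.const' _) ⟨0, by simp⟩
  refine ENNReal.le_of_forall_pos_le_add fun ε hε _ => ?_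
  obtain ⟨T, hT⟩ := approx μ hμ (ε / 4) (by positivity)
  obtain ⟨T', hT'⟩ := approx ν hν (ε / 4) (by positivity)
  set a : T.range → ℝ := fun p => μ.real (T ⁻¹' {(p : E)}) with ha
  set b : T'.range → ℝ := fun p => ν.real (T' ⁻¹' {(p : E)}) with hb
  obtain ⟨p, hp, hp1, hp2, hpc⟩ := exists_coupling_of_dual_le (a := a) (b := b)
    ⟨fun _ => measureReal_nonneg, by
      simpa [ha] using (integral_comp_simpleFunc μ T fun _ => 1).symm⟩
    ⟨fun _ => measureReal_nonneg, by
      simpa [hb] using (integral_comp_simpleFunc ν T' fun _ => 1).symm⟩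
    (fun i j => dist (i : E) j) (s + ε / 2) (fun F G hFG => by
      -- The inf-convolution `f₀ x = min_j (dist x j - G j)` dominates `F` and is dominated by
      -- `-G`; it is then truncated at `± K` to become bounded without losing these bounds.
      have hne : (Finset.univ : Finset T'.range).Nonempty := ⟨⟨T' y₀, by simp⟩, Finset.mem_univ _⟩
      set f₀ : E → ℝ := fun x => Finset.univ.inf' hne fun j => dist x j - G j with hf₀
      have hf₀L : LipschitzWith 1 f₀ := by
        refine LipschitzWith.of_le_add fun x y => ?_
        obtain ⟨j, -, hj⟩ := Finset.exists_mem_eq_inf' hne fun j => dist y j - G j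
        have h1 : f₀ x ≤ dist x j - G j :=
          Finset.inf'_le (fun j : T'.range => dist x j - G j) (Finset.mem_univ j)
        have h2 : f₀ y = dist y j - G j := hj
        have := dist_triangle x y j
        linarith
      set K : ℝ := ∑ i, |F i| + ∑ j, |G j| with hK
      have hKF : ∀ i, F i ≤ K := fun i => by
        have h1 := Finset.single_le_sum (f := fun i => |F i|) (fun i _ => abs_nonneg _)
          (Finset.mem_univ i)
        have h2 : 0 ≤ ∑ j, |G j| := Finset.sum_nonneg fun j _ => abs_nonneg _
        have := le_abs_self (F i)
        linarith
      have hKG : ∀ j, -K ≤ -G j := fun j => by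
        have h1 := Finset.single_le_sum (f := fun i => |G i|) (fun i _ => abs_nonneg _)
          (Finset.mem_univ j)
        have h2 : 0 ≤ ∑ j, |F j| := Finset.sum_nonneg fun j _ => abs_nonneg _
        have := le_abs_self (G j)
        linarith
      have hK0 : 0 ≤ K := by positivity
      set f : E → ℝ := fun x => max (-K) (min K (f₀ x)) with hf
      have hfL : LipschitzWith 1 f := (hf₀L.const_min K).const_max (-K)
      have hfK : ∀ x, |f x| ≤ K := fun x =>
        abs_le.2 ⟨le_max_left _ _, max_le (by linarith) (min_le_left _ _)⟩
      have hF : ∀ i : T.range, F i ≤ f i := fun i =>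
        le_max_of_le_right (le_min (hKF i) (Finset.le_inf' hne _ fun j _ => by
          have := hFG i j; linarith))
      have hG : ∀ j : T'.range, f j ≤ -G j := fun j =>
        max_le (hKG j) (min_le_of_right_le ((Finset.inf'_le _ (Finset.mem_univ j)).trans (by simp)))
      have e1 : ∑ i, F i * a i ≤ ∫ x, f (T x) ∂μ := by
        rw [integral_comp_simpleFunc μ T f]
        exact Finset.sum_le_sum fun i _ => mul_le_mul_of_nonneg_right (hF i) measureReal_nonneg
      have e2 : ∑ i, G i * b i ≤ - ∫ x, f (T' x) ∂ν := by
        rw [integral_comp_simpleFunc ν T' f, ← Finset.sum_neg_distrib]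
        refine Finset.sum_le_sum fun i _ => ?_
        rw [← neg_mul]
        exact mul_le_mul_of_nonneg_right (by have := hG i; linarith) measureReal_nonneg
      have e3 := abs_le.1 (abs_integral_simpleFunc_sub_le hfL hfK hT)
      have e4 := abs_le.1 (abs_integral_simpleFunc_sub_le hfL hfK hT')
      have e5 := h f hfL ⟨K, hfK⟩
      push_cast at e3 e4
      linarith [e3.2, e4.1])
  obtain ⟨π, h1, h2, h3⟩ := exists_coupling_of_discretization μ ν T T' p hp hp1 hp2
  refine (iInf₂_le π ⟨h1, h2⟩).trans ?_
  have m1 : Measurable fun z : E × E => edist z.1 (T z.1) :=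
    measurable_fst.edist (T.measurable.comp measurable_fst)
  have m3 : Measurable fun z : E × E => edist (T' z.2) z.2 :=
    (T'.measurable.comp measurable_snd).edist measurable_snd
  have c1 : ∫⁻ z, edist z.1 (T z.1) ∂π ≤ (ε / 4 : ℝ≥0) := by
    rw [← lintegral_map (f := fun x => edist x (T x)) (measurable_id.edist T.measurable)
      measurable_fst, h1]
    simpa only [edist_comm] using hT
  have c3 : ∫⁻ z, edist (T' z.2) z.2 ∂π ≤ (ε / 4 : ℝ≥0) := by
    rw [← lintegral_map (f := fun x => edist (T' x) x) (T'.measurable.edist measurable_id)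
      measurable_snd, h2]
    exact hT'
  have c2 : ∫⁻ z, edist (T z.1) (T' z.2) ∂π ≤ ENNReal.ofReal (s + ε / 2) := by
    rw [h3 fun x y => edist x y]
    refine le_trans (le_of_eq ?_) (ENNReal.ofReal_le_ofReal hpc)
    rw [ENNReal.ofReal_sum_of_nonneg fun i _ =>
      Finset.sum_nonneg fun j _ => mul_nonneg (hp i j) dist_nonneg]
    refine Finset.sum_congr rfl fun i _ => ?_
    rw [ENNReal.ofReal_sum_of_nonneg fun j _ => mul_nonneg (hp i j) dist_nonneg]
    refine Finset.sum_congr rfl fun j _ => ?_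
    rw [ENNReal.ofReal_mul (hp i j), edist_dist]
  calc ∫⁻ z, edist z.1 z.2 ∂π
      ≤ ∫⁻ z, (edist z.1 (T z.1) + edist (T z.1) (T' z.2) + edist (T' z.2) z.2) ∂π :=
        lintegral_mono fun z => (edist_triangle4 _ _ _ _)
    _ = ∫⁻ z, edist z.1 (T z.1) ∂π + ∫⁻ z, edist (T z.1) (T' z.2) ∂π
          + ∫⁻ z, edist (T' z.2) z.2 ∂π := by
        rw [lintegral_add_right _ m3, lintegral_add_left m1]
    _ ≤ (ε / 4 : ℝ≥0) + ENNReal.ofReal (s + ε / 2) + (ε / 4 : ℝ≥0) := by gcongr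
    _ = ENNReal.ofReal s + ε := by
        rw [← ENNReal.ofReal_coe_nnreal, ← ENNReal.ofReal_coe_nnreal (p := ε),
          ← ENNReal.ofReal_add (by positivity) (by positivity),
          ← ENNReal.ofReal_add (by positivity) (by positivity),
          ← ENNReal.ofReal_add s0 (by positivity)]
        congr 1
        push_cast
        ring

end

/-! ### Elementary properties of the Wasserstein distance -/

section

variable {E : Type*} [MetricSpace E] [MeasurableSpace E] [BorelSpace E]

/-- Kantorovich duality, easy direction. -/
lemma enorm_integral_sub_le [SecondCountableTopology E] {F : Type*} [NormedAddCommGroup F]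
    [NormedSpace ℝ F] {μ ν : Measure E} [IsProbabilityMeasure μ] [IsProbabilityMeasure ν] {L : ℝ≥0}
    {f : E → F} (hf : LipschitzWith L f) (hμ : Integrable f μ) (hν : Integrable f ν) :
    ‖∫ x, f x ∂μ - ∫ x, f x ∂ν‖ₑ ≤ L * W1 μ ν := by
  have key : ∀ π : Measure (E × E), π.map Prod.fst = μ ∧ π.map Prod.snd = ν →
      ‖∫ x, f x ∂μ - ∫ x, f x ∂ν‖ₑ ≤ L * ∫⁻ z, edist z.1 z.2 ∂π := by
    rintro π ⟨rfl, rfl⟩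
    have i1 : Integrable (fun z : E × E => f z.1) π := hμ.comp_measurable measurable_fst
    have i2 : Integrable (fun z : E × E => f z.2) π := hν.comp_measurable measurable_snd
    rw [integral_map measurable_fst.aemeasurable hμ.1,
      integral_map measurable_snd.aemeasurable hν.1,
      ← integral_sub i1 i2, ← lintegral_const_mul' _ _ ENNReal.coe_ne_top]
    refine (enorm_integral_le_lintegral_enorm _).trans (lintegral_mono fun z => ?_)
    rw [← edist_eq_enorm_sub]
    exact hf z.1 z.2
  by_cases hL : L = 0
  · have := key (μ.prod ν) ⟨by simp, by simp⟩
    simpa [hL] using this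
  · have hL' : (L : ℝ≥0∞) ≠ 0 := by simpa using hL
    rw [W1, ENNReal.mul_iInf_of_ne hL' ENNReal.coe_ne_top]
    refine le_iInf fun π => ?_
    rw [ENNReal.mul_iInf_of_ne hL' ENNReal.coe_ne_top]
    exact le_iInf fun hπ => key π hπ

lemma W1_le_lintegral_add (μ ν : Measure E) [IsProbabilityMeasure μ] [IsProbabilityMeasure ν]
    [SecondCountableTopology E] (y : E) :
    W1 μ ν ≤ ∫⁻ x, edist x y ∂μ + ∫⁻ x, edist x y ∂ν := by
  refine (iInf₂_le (μ.prod ν) ⟨by simp, by simp⟩).trans ?_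
  have m2 : Measurable fun x : E => edist x y := measurable_id.edist measurable_const
  calc ∫⁻ z, edist z.1 z.2 ∂(μ.prod ν) ≤ ∫⁻ z, (edist z.1 y + edist z.2 y) ∂(μ.prod ν) :=
        lintegral_mono fun z => by
          simpa only [edist_comm z.2 y] using edist_triangle z.1 y z.2
    _ = _ := by
        rw [lintegral_add_left (f := fun z : E × E => edist z.1 y) (m2.comp measurable_fst)]
        congr 1
        · rw [← lintegral_map (f := fun x => edist x y) m2 measurable_fst]; simp
        · rw [← lintegral_map (f := fun x => edist x y) m2 measurable_snd]; simp

end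

section

variable {E : Type*} [NormedAddCommGroup E] [MeasurableSpace E] [BorelSpace E]

lemma isP1_iff_lintegral_enorm {μ : Measure E} [IsProbabilityMeasure μ] :
    IsP1 μ ↔ ∫⁻ x, ‖x‖ₑ ∂μ < ∞ := by
  refine ⟨fun h => by simpa using h.moment 0, fun h => ⟨inferInstance, fun y => ?_⟩⟩
  calc ∫⁻ x, edist x y ∂μ ≤ ∫⁻ x, (‖x‖ₑ + ‖y‖ₑ) ∂μ := by
        refine lintegral_mono fun x => ?_
        rw [edist_eq_enorm_sub]
        exact enorm_sub_le
    _ < ∞ := by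
        rw [lintegral_add_right _ measurable_const]
        simp [h]

lemma IsP1.integrable_norm [SecondCountableTopology E] {μ : Measure E} (h : IsP1 μ) :
    Integrable (fun x => ‖x‖) μ := by
  have := h.isProb
  refine ⟨measurable_norm.aestronglyMeasurable, ?_⟩
  rw [HasFiniteIntegral]
  simpa using isP1_iff_lintegral_enorm.1 h

lemma IsP1.integrable_lipschitz [SecondCountableTopology E] {F : Type*} [NormedAddCommGroup F]
    {μ : Measure E} (h : IsP1 μ) {L : ℝ≥0} {f : E → F} (hf : LipschitzWith L f) :
    Integrable f μ := by
  have := h.isProb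
  refine ((integrable_const ‖f 0‖).add (h.integrable_norm.const_mul (L : ℝ))).mono'
    hf.continuous.aestronglyMeasurable (ae_of_all _ fun x => ?_)
  have h1 := hf.dist_le_mul x 0
  rw [dist_zero_right, dist_eq_norm] at h1
  have h2 := norm_sub_norm_le (f x) (f 0)
  simp only [Pi.add_apply]
  linarith

end

lemma norm_exp_mul_I_sub_le (a b : ℝ) :
    ‖Complex.exp (a * Complex.I) - Complex.exp (b * Complex.I)‖ ≤ |a - b| := by
  have e : Complex.exp (a * Complex.I) - Complex.exp (b * Complex.I) =
      Complex.exp (b * Complex.I) * (Complex.exp (Complex.I * (a - b : ℝ)) - 1) := by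
    rw [mul_sub, ← Complex.exp_add, mul_one]
    congr 2
    push_cast
    ring
  rw [e, norm_mul, Complex.norm_exp_ofReal_mul_I, one_mul]
  exact Real.norm_exp_I_mul_ofReal_sub_one_le

section

variable {E : Type*} [NormedAddCommGroup E] [InnerProductSpace ℝ E] [MeasurableSpace E]
  [BorelSpace E] [SecondCountableTopology E]

/-- The character `x ↦ exp (i ⟪x, ξ⟫)`. -/
noncomputable def waveChar (ξ x : E) : ℂ := Complex.exp (inner ℝ x ξ * Complex.I)

lemma norm_waveChar (ξ x : E) : ‖waveChar ξ x‖ = 1 := Complex.norm_exp_ofReal_mul_I _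

lemma lipschitzWith_waveChar (ξ : E) : LipschitzWith ‖ξ‖₊ (waveChar ξ) := by
  refine LipschitzWith.of_dist_le_mul fun x y => ?_
  rw [dist_eq_norm, dist_eq_norm, coe_nnnorm, mul_comm]
  refine (norm_exp_mul_I_sub_le _ _).trans ?_
  rw [← inner_sub_left]
  exact abs_real_inner_le_norm _ _

lemma integrable_waveChar (ξ : E) (μ : Measure E) [IsFiniteMeasure μ] :
    Integrable (waveChar ξ) μ :=
  Integrable.of_bound (lipschitzWith_waveChar ξ).continuous.aestronglyMeasurable 1
    (ae_of_all _ fun x => (norm_waveChar ξ x).le)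

/-- Convergence in `W1` of probability measures forces convergence of characteristic functions, and
so determines the limit. -/
lemma tendsto_charFun_of_tendsto_W1 {ι : Type*} {l : Filter ι} {μ : ι → Measure E} {ν : Measure E}
    [∀ i, IsProbabilityMeasure (μ i)] [IsProbabilityMeasure ν]
    (h : Tendsto (fun i => W1 (μ i) ν) l (𝓝 0)) (ξ : E) :
    Tendsto (fun i => charFun (μ i) ξ) l (𝓝 (charFun ν ξ)) := by
  rw [tendsto_iff_edist_tendsto_0]
  have h2 : Tendsto (fun i => (‖ξ‖₊ : ℝ≥0∞) * W1 (μ i) ν) l (𝓝 0) := by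
    have := ENNReal.Tendsto.const_mul (a := (‖ξ‖₊ : ℝ≥0∞)) h (Or.inr ENNReal.coe_ne_top)
    simpa using this
  refine tendsto_of_tendsto_of_tendsto_of_le_of_le tendsto_const_nhds h2 (fun _ => zero_le)
    fun i => ?_
  simp only [edist_eq_enorm_sub, charFun_apply]
  exact enorm_integral_sub_le (lipschitzWith_waveChar ξ) (integrable_waveChar ξ _)
    (integrable_waveChar ξ _)

lemma eq_of_W1_eq_zero [CompleteSpace E] {μ ν : Measure E} [IsProbabilityMeasure μ]
    [IsProbabilityMeasure ν] (h : W1 μ ν = 0) : μ = ν := by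
  refine Measure.ext_of_charFun (funext fun ξ => ?_)
  have := tendsto_charFun_of_tendsto_W1 (l := (pure () : Filter Unit)) (μ := fun _ => μ) (ν := ν)
    (by rw [h]; exact tendsto_const_nhds) ξ
  exact tendsto_nhds_unique tendsto_const_nhds this

end

/-! ### The Markov process and its invariant measure -/

section

variable {E : Type*} [MetricSpace E] [MeasurableSpace E]
  {Ω : Type*} {mΩ : MeasurableSpace Ω} {Pr : Measure Ω} [IsProbabilityMeasure Pr]
  {ℱ : Filtration ℝ≥0 mΩ} {Y : ℝ≥0 → Ω → E} {P : ℝ≥0 → Kernel E E}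

lemma IsMarkovProcess.measurable (h : IsMarkovProcess Y P ℱ Pr) (t : ℝ≥0) : Measurable (Y t) :=
  (h.adapted t).mono (ℱ.le t) le_rfl

/-- The joint law at two times is the composition of the law at the first time with the transition
kernel. -/
lemma IsMarkovProcess.map_prodMk (h : IsMarkovProcess Y P ℱ Pr) (s t : ℝ≥0) :
    Pr.map (fun ω => (Y s ω, Y (s + t) ω)) = (Pr.map (Y s)) ⊗ₘ (P t) := by
  have hs := h.measurable s
  have hst := h.measurable (s + t)
  have hP := h.semigroup.isMarkov t
  have := Measure.isProbabilityMeasure_map (μ := Pr) hs.aemeasurable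
  have := Measure.isProbabilityMeasure_map (μ := Pr) (hs.prodMk hst).aemeasurable
  refine Measure.ext_prod fun {B A} hB hA => ?_
  rw [Measure.map_apply (hs.prodMk hst) (hB.prod hA), Measure.compProd_apply_prod hB hA,
    setLIntegral_map hB ((P t).measurable_coe hA) hs]
  -- The event `Y s ∈ B` belongs to the past, so the Markov property may be integrated over it.
  have e1 := setIntegral_condExp (μ := Pr) (ℱ.le s)
    (f := (Y (s + t) ⁻¹' A).indicator fun _ => (1 : ℝ))
    ((integrable_const 1).indicator (hst hA)) (h.adapted s hB)
  rw [setIntegral_congr_ae (hs hB) ((h.markov s t A hA).mono fun ω hω _ => hω),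
    integral_indicator_const (μ := Pr.restrict (Y s ⁻¹' B)) _ (hst hA)] at e1
  simp only [measureReal_def, smul_eq_mul, mul_one] at e1
  rw [integral_toReal (f := fun ω => P t (Y s ω) A)
    (((P t).measurable_coe hA).comp hs).aemeasurable (ae_of_all _ fun ω => measure_lt_top _ _),
    Measure.restrict_apply (hst hA)] at e1
  have hfin : ∫⁻ ω in Y s ⁻¹' B, (P t (Y s ω)) A ∂Pr ≠ ∞ := by
    refine ne_of_lt ((lintegral_mono fun ω => prob_le_one).trans_lt ?_)
    simp
  rw [ENNReal.toReal_eq_toReal_iff' hfin (measure_ne_top _ _)] at e1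
  rw [e1]
  congr 1
  ext ω
  simp [and_comm]

lemma IsMarkovProcess.map_add (h : IsMarkovProcess Y P ℱ Pr) (s t : ℝ≥0) :
    Pr.map (Y (s + t)) = (Pr.map (Y s)).bind (P t) := by
  have hP := h.semigroup.isMarkov t
  have := Measure.isProbabilityMeasure_map (μ := Pr) (h.measurable s).aemeasurable
  rw [← Measure.snd_compProd, ← h.map_prodMk, Measure.snd,
    Measure.map_map measurable_snd ((h.measurable s).prodMk (h.measurable (s + t)))]
  rfl

end

section

variable {E : Type*} [NormedAddCommGroup E] [MeasurableSpace E] [BorelSpace E]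

lemma W1_le_of_moments {μ ν : Measure E} [IsProbabilityMeasure μ] [IsProbabilityMeasure ν]
    [SecondCountableTopology E] {M : ℝ} (hM : 0 ≤ M)
    (hμ : ∫⁻ x, ‖x‖ₑ ∂μ ≤ ENNReal.ofReal M) (hν : ∫⁻ x, ‖x‖ₑ ∂ν ≤ ENNReal.ofReal M) :
    W1 μ ν ≤ ENNReal.ofReal (2 * M) := by
  refine (W1_le_lintegral_add μ ν 0).trans ?_
  simp only [edist_zero_right]
  rw [two_mul, ENNReal.ofReal_add hM hM]
  gcongr

lemma integral_norm_le_of_lintegral [SecondCountableTopology E] {μ : Measure E} {M : ℝ} (hM : 0 ≤ M)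
    (hμ : ∫⁻ x, ‖x‖ₑ ∂μ ≤ ENNReal.ofReal M) : ∫ x, ‖x‖ ∂μ ≤ M := by
  rw [integral_norm_eq_lintegral_enorm (f := fun x : E => x) measurable_id.aestronglyMeasurable]
  exact ENNReal.toReal_le_of_le_ofReal hM hμ

end

section

variable {E : Type*} [NormedAddCommGroup E] [InnerProductSpace ℝ E] [FiniteDimensional ℝ E]
  [MeasurableSpace E] [BorelSpace E]

/-- A family of laws with uniformly bounded first moment is tight. -/
lemma isTightMeasureSet_of_lintegral_enorm_le {S : Set (Measure E)} {M : ℝ}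
    (h : ∀ μ ∈ S, ∫⁻ x, ‖x‖ₑ ∂μ ≤ ENNReal.ofReal M) : IsTightMeasureSet S := by
  have := FiniteDimensional.proper_real E
  refine isTightMeasureSet_of_tendsto_measure_norm_gt ?_
  have hlim : Tendsto (fun r : ℝ => ENNReal.ofReal M / ENNReal.ofReal r) atTop (𝓝 0) := by
    have h1 : Tendsto (fun r : ℝ => ENNReal.ofReal r) atTop (𝓝 ∞) := ENNReal.tendsto_ofReal_atTop
    have := ENNReal.Tendsto.const_div (a := ENNReal.ofReal M) h1 (Or.inr ENNReal.ofReal_ne_top)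
    simpa using this
  refine tendsto_of_tendsto_of_tendsto_of_le_of_le' tendsto_const_nhds hlim
    (Eventually.of_forall fun _ => zero_le) ?_
  filter_upwards [eventually_gt_atTop 0] with r hr
  refine iSup₂_le fun μ hμ => ?_
  have hr' : ENNReal.ofReal r ≠ 0 := by simpa using hr
  have h2 := meas_ge_le_lintegral_div (μ := μ) (f := fun x : E => ‖x‖ₑ)
    measurable_enorm.aemeasurable hr' ENNReal.ofReal_ne_top
  refine (measure_mono fun x hx => ?_).trans (h2.trans (ENNReal.div_le_div_right (h μ hμ) _))
  simp only [Set.mem_ofPred_eq] at hx ⊢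
  rw [← ofReal_norm]
  exact ENNReal.ofReal_le_ofReal hx.le

variable {P : ℝ≥0 → Kernel E E} {D c M : ℝ} {ρ : ℝ≥0 → Measure E}

/-- The laws of the process form a Cauchy family in `W1`. By tightness they accumulate at a
probability measure, and by duality they converge to it exponentially fast. -/
lemma exists_W1_limit (hcontr : IsExpContractive P D c) (hM : 0 ≤ M)
    (hD : 0 ≤ D) (hρ : ∀ t, IsProbabilityMeasure (ρ t))
    (hρP : ∀ s t, ρ (s + t) = (ρ s).bind (P t))
    (hρM : ∀ t, ∫⁻ x, ‖x‖ₑ ∂(ρ t) ≤ ENNReal.ofReal M) :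
    ∃ μ : Measure E, IsP1 μ ∧ ∫⁻ x, ‖x‖ₑ ∂μ ≤ ENNReal.ofReal M ∧
      ∀ s, W1 (ρ s) μ ≤ ENNReal.ofReal (D * Real.exp (-c * s) * (2 * M)) := by
  have hρ1 : ∀ t, IsP1 (ρ t) := fun t =>
    isP1_iff_lintegral_enorm.2 ((hρM t).trans_lt ENNReal.ofReal_lt_top)
  -- The laws at times `s` and `s + u` are the images after time `s` of those at times `0` and `u`.
  have hcauchy : ∀ s u,
      W1 (ρ s) (ρ (s + u)) ≤ ENNReal.ofReal (D * Real.exp (-c * s) * (2 * M)) := by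
    intro s u
    have h1 := hcontr _ _ (hρ1 0) (hρ1 u) s
    rw [← hρP, ← hρP, zero_add, add_comm u s] at h1
    refine h1.trans (le_of_le_of_eq ?_ (ENNReal.ofReal_mul (by positivity)).symm)
    exact mul_le_mul_right (W1_le_of_moments hM (hρM 0) (hρM u)) _
  let p : ℕ → ProbabilityMeasure E := fun n => ⟨ρ n, hρ n⟩
  have htight : IsTightMeasureSet {((m : ProbabilityMeasure E) : Measure E) | m ∈ Set.range p} :=
    isTightMeasureSet_of_lintegral_enorm_le (M := M) (by
      rintro _ ⟨_, ⟨n, rfl⟩, rfl⟩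
      exact hρM n)
  -- Passing to the limit along an ultrafilter finer than `atTop` avoids extracting a subsequence.
  have hcomp := isCompact_closure_of_isTightMeasureSet htight
  obtain ⟨μ, -, hμ⟩ := hcomp.ultrafilter_le_nhds ((hyperfilter ℕ).map p) (by
    rw [le_principal_iff]
    exact Filter.mem_map.2 (Eventually.of_forall fun n => subset_closure ⟨n, rfl⟩))
  have hlim : Tendsto p (hyperfilter ℕ) (𝓝 μ) := hμ
  have hat : (hyperfilter ℕ : Filter ℕ) ≤ atTop := Nat.hyperfilter_le_atTop
  have hint : ∀ f : E → ℝ, Continuous f → (∃ K, ∀ x, |f x| ≤ K) →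
      Tendsto (fun n : ℕ => ∫ x, f x ∂(ρ n)) (hyperfilter ℕ) (𝓝 (∫ x, f x ∂(μ : Measure E))) := by
    rintro f hf ⟨K, hK⟩
    exact ProbabilityMeasure.tendsto_iff_forall_integral_tendsto.1 hlim
      (BoundedContinuousFunction.ofNormedAddCommGroup f hf K hK)
  have hmom : ∫⁻ x, ‖x‖ₑ ∂(μ : Measure E) ≤ ENNReal.ofReal M := by
    have hK : ∀ K : ℕ, ∫⁻ x, ENNReal.ofReal (min ‖x‖ K) ∂(μ : Measure E) ≤ ENNReal.ofReal M := by
      intro K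
      have hb : ∀ x : E, |min ‖x‖ K| ≤ K := fun x => by
        rw [abs_of_nonneg (le_min (norm_nonneg _) (Nat.cast_nonneg _))]; exact min_le_right _ _
      have hc : Continuous fun x : E => min ‖x‖ (K : ℝ) := by fun_prop
      have hi : ∀ (m : Measure E) [IsProbabilityMeasure m],
          Integrable (fun x => min ‖x‖ (K : ℝ)) m :=
        fun m _ => Integrable.of_bound hc.aestronglyMeasurable K (ae_of_all _ hb)
      rw [← ofReal_integral_eq_lintegral_ofReal (hi μ)
        (ae_of_all _ fun x => le_min (norm_nonneg _) (Nat.cast_nonneg _))]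
      refine ENNReal.ofReal_le_ofReal (le_of_tendsto (hint _ hc ⟨K, hb⟩)
        (Eventually.of_forall fun n => ?_))
      have := hρ n
      refine (integral_mono (hi _) (hρ1 n).integrable_norm fun x => min_le_left _ _).trans ?_
      exact integral_norm_le_of_lintegral hM (hρM n)
    have hsup : ∀ x : E, ‖x‖ₑ ≤ liminf (fun K : ℕ => ENNReal.ofReal (min ‖x‖ K)) atTop := by
      intro x
      have : Tendsto (fun K : ℕ => ENNReal.ofReal (min ‖x‖ K)) atTop (𝓝 ‖x‖ₑ) := by
        refine tendsto_const_nhds.congr' ?_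
        filter_upwards [eventually_ge_atTop ⌈‖x‖⌉₊] with K hK
        rw [min_eq_left ((Nat.le_ceil _).trans (by exact_mod_cast hK)), ofReal_norm]
      exact this.liminf_eq.ge
    calc ∫⁻ x, ‖x‖ₑ ∂(μ : Measure E)
        ≤ ∫⁻ x, liminf (fun K : ℕ => ENNReal.ofReal (min ‖x‖ K)) atTop ∂(μ : Measure E) :=
          lintegral_mono hsup
      _ ≤ liminf (fun K : ℕ => ∫⁻ x, ENNReal.ofReal (min ‖x‖ K) ∂(μ : Measure E)) atTop :=
          lintegral_liminf_le fun K => by fun_prop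
      _ ≤ ENNReal.ofReal M := by
          refine liminf_le_of_frequently_le' (Frequently.of_forall hK)
  have hμ1 : IsP1 (μ : Measure E) :=
    isP1_iff_lintegral_enorm.2 (hmom.trans_lt ENNReal.ofReal_lt_top)
  refine ⟨μ, hμ1, hmom, fun s => W1_le_of_forall_lipschitz (hρ1 s) hμ1 fun f hf hK => ?_⟩
  have := hρ s
  have hl := (tendsto_const_nhds (x := ∫ x, f x ∂(ρ s))).sub (hint f hf.continuous hK)
  refine le_of_tendsto hl (hat ?_)
  filter_upwards [eventually_ge_atTop ⌈s⌉₊] with n hn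
  have hsn : s ≤ n := (Nat.le_ceil s).trans (by exact_mod_cast hn)
  have := hρ n
  have h1 := enorm_integral_sub_le hf ((hρ1 s).integrable_lipschitz hf)
    ((hρ1 n).integrable_lipschitz hf)
  have h2 := hcauchy s (n - s)
  rw [add_tsub_cancel_of_le hsn] at h2
  rw [ENNReal.coe_one, one_mul, ← ofReal_norm] at h1
  exact (Real.le_norm_self _).trans
    ((ENNReal.ofReal_le_ofReal_iff (by positivity)).1 (h1.trans h2))

lemma tendsto_ofReal_exp_mul (hc : 0 < c) (D K : ℝ) :
    Tendsto (fun n : ℕ => ENNReal.ofReal (D * Real.exp (-c * n) * K)) atTop (𝓝 0) := by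
  have h1 : Tendsto (fun n : ℕ => Real.exp (-c * n)) atTop (𝓝 0) := by
    refine Real.tendsto_exp_atBot.comp ?_
    simp_rw [neg_mul]
    exact tendsto_neg_atTop_atBot.comp (tendsto_natCast_atTop_atTop.const_mul_atTop hc)
  have h2 := ENNReal.tendsto_ofReal ((h1.const_mul D).mul_const K)
  simpa using h2

/-- Two invariant measures with finite first moment agree, by contraction. -/
lemma IsInvariantP1.eq (hc : 0 < c) (hcontr : IsExpContractive P D c) {μ ν : Measure E}
    (hμ : IsInvariantP1 P μ) (hν : IsInvariantP1 P ν) : μ = ν := by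
  have := hμ.1.isProb
  have := hν.1.isProb
  refine eq_of_W1_eq_zero (le_antisymm ?_ zero_le)
  have hfin : W1 μ ν ≠ ∞ := ne_of_lt ((W1_le_lintegral_add μ ν 0).trans_lt
    (ENNReal.add_lt_top.2 ⟨hμ.1.moment 0, hν.1.moment 0⟩))
  have hlim : Tendsto (fun n : ℕ => ENNReal.ofReal (D * Real.exp (-c * n) * 1) * W1 μ ν) atTop
      (𝓝 0) := by
    have := ENNReal.Tendsto.mul_const (tendsto_ofReal_exp_mul hc D 1) (Or.inr hfin)
    simpa using this
  refine ge_of_tendsto' hlim fun n => ?_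
  have := hcontr μ ν hμ.1 hν.1 n
  rw [hμ.2, hν.2] at this
  simpa using this

/-- The limit of the laws of the process is an invariant measure. -/
lemma exists_invariant (hP : IsMarkovSemigroup P) (hcontr : IsExpContractive P D c) (hM : 0 ≤ M)
    (hc : 0 < c) (hD : 0 ≤ D) (hρ : ∀ t, IsProbabilityMeasure (ρ t))
    (hρP : ∀ s t, ρ (s + t) = (ρ s).bind (P t))
    (hρM : ∀ t, ∫⁻ x, ‖x‖ₑ ∂(ρ t) ≤ ENNReal.ofReal M) :
    ∃ μ : Measure E, IsInvariantP1 P μ ∧ ∫⁻ x, ‖x‖ₑ ∂μ ≤ ENNReal.ofReal M ∧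
      Tendsto (fun n : ℕ => W1 (ρ n) μ) atTop (𝓝 0) := by
  obtain ⟨μ, hμ1, hmom, hW⟩ := exists_W1_limit hcontr hM hD hρ hρP hρM
  have hρ1 : ∀ t, IsP1 (ρ t) := fun t =>
    isP1_iff_lintegral_enorm.2 ((hρM t).trans_lt ENNReal.ofReal_lt_top)
  have hlim0 : Tendsto (fun n : ℕ => W1 (ρ n) μ) atTop (𝓝 0) :=
    tendsto_of_tendsto_of_tendsto_of_le_of_le tendsto_const_nhds
      (tendsto_ofReal_exp_mul hc D (2 * M)) (fun _ => zero_le) fun n => by simpa using hW n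
  refine ⟨μ, ⟨hμ1, fun t => ?_⟩, hmom, hlim0⟩
  have := hμ1.isProb
  have := hP.isMarkov t
  have h1 : Tendsto (fun n : ℕ => W1 (ρ (n + t)) μ) atTop (𝓝 0) := by
    refine tendsto_of_tendsto_of_tendsto_of_le_of_le tendsto_const_nhds
      (tendsto_ofReal_exp_mul hc D (2 * M)) (fun _ => zero_le) fun n => ?_
    refine (hW _).trans (ENNReal.ofReal_le_ofReal ?_)
    have h0 : 0 ≤ c * (t : ℝ) := by positivity
    have h1 : Real.exp (-c * ((n + t : ℝ≥0) : ℝ)) ≤ Real.exp (-c * n) :=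
      Real.exp_le_exp.2 (by push_cast; linarith)
    exact mul_le_mul_of_nonneg_right (mul_le_mul_of_nonneg_left h1 hD) (by linarith)
  -- By contraction the laws at times `n + t` converge to `μ Pₜ` as well; no continuity of the
  -- kernels is needed.
  have h2 : Tendsto (fun n : ℕ => W1 (ρ (n + t)) (μ.bind (P t))) atTop (𝓝 0) := by
    have hl := ENNReal.Tendsto.const_mul (a := ENNReal.ofReal (D * Real.exp (-c * t))) hlim0
      (Or.inr ENNReal.ofReal_ne_top)
    rw [mul_zero] at hl
    refine tendsto_of_tendsto_of_tendsto_of_le_of_le tendsto_const_nhds hl (fun _ => zero_le)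
      fun n => ?_
    simp only [hρP]
    exact hcontr _ _ (hρ1 _) hμ1 t
  refine Measure.ext_of_charFun (funext fun ξ => ?_)
  exact tendsto_nhds_unique (tendsto_charFun_of_tendsto_W1 h2 ξ)
    (tendsto_charFun_of_tendsto_W1 h1 ξ)

/-- Bounds on integrals of Lipschitz functions pass to the limit in `W1`. -/
lemma integral_le_of_tendsto_W1 {ρ : ℕ → Measure E} {μ : Measure E} (hρ : ∀ n, IsP1 (ρ n))
    (hμ : IsP1 μ) (h : Tendsto (fun n => W1 (ρ n) μ) atTop (𝓝 0)) {L : ℝ≥0} {f : E → ℝ}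
    (hf : LipschitzWith L f) {K : ℝ} (hK : ∀ n, ∫ x, f x ∂(ρ n) ≤ K) : ∫ x, f x ∂μ ≤ K := by
  have := hμ.isProb
  have hlim : Tendsto (fun n => ∫ x, f x ∂(ρ n)) atTop (𝓝 (∫ x, f x ∂μ)) := by
    rw [tendsto_iff_edist_tendsto_0]
    have hl := ENNReal.Tendsto.const_mul (a := (L : ℝ≥0∞)) h (Or.inr ENNReal.coe_ne_top)
    rw [mul_zero] at hl
    refine tendsto_of_tendsto_of_tendsto_of_le_of_le tendsto_const_nhds hl (fun _ => zero_le)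
      fun n => ?_
    have := (hρ n).isProb
    rw [edist_eq_enorm_sub]
    exact enorm_integral_sub_le hf ((hρ n).integrable_lipschitz hf) (hμ.integrable_lipschitz hf)
  exact le_of_tendsto' hlim hK

variable {Ω : Type*} {mΩ : MeasurableSpace Ω} {Pr : Measure Ω} [IsProbabilityMeasure Pr]
  {ℱ : Filtration ℝ≥0 mΩ} {Y : ℝ≥0 → Ω → E}

/-- Starting the semigroup at a point, the mean of a Lipschitz function approaches its invariant
mean exponentially fast. -/
lemma norm_integral_kernel_sub_le (hP : IsMarkovSemigroup P) (hcontr : IsExpContractive P D c)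
    (hD : 0 ≤ D) (hM : 0 ≤ M) {μ : Measure E} (hμ : IsInvariantP1 P μ)
    (hμM : ∫⁻ x, ‖x‖ₑ ∂μ ≤ ENNReal.ofReal M) {g : E → ℂ} {L : ℝ≥0} (hg : LipschitzWith L g)
    (hg1 : ∀ x, ‖g x‖ ≤ 1) (u : ℝ≥0) (x : E) :
    ‖∫ y, g y ∂(P u x) - ∫ y, g y ∂μ‖ ≤ L * (D * Real.exp (-c * u)) * (‖x‖ + M) := by
  have := hμ.1.isProb
  have := hP.isMarkov u
  have hi : ∀ (m : Measure E) [IsProbabilityMeasure m], Integrable g m := fun m _ =>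
    Integrable.of_bound hg.continuous.aestronglyMeasurable 1 (ae_of_all _ hg1)
  have hdirac : IsP1 (Measure.dirac x) := isP1_iff_lintegral_enorm.2 (by simp)
  have h1 := hcontr _ _ hdirac hμ.1 u
  rw [hμ.2, Measure.dirac_bind (P u).measurable] at h1
  have h2 := enorm_integral_sub_le hg (hi (P u x)) (hi μ)
  have h3 : W1 (Measure.dirac x) μ ≤ ENNReal.ofReal (‖x‖ + M) := by
    refine (W1_le_lintegral_add _ _ 0).trans ?_
    simp only [edist_zero_right]
    rw [lintegral_dirac' _ measurable_enorm, ENNReal.ofReal_add (norm_nonneg _) hM, ofReal_norm]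
    gcongr
  have h4 : ‖∫ y, g y ∂(P u x) - ∫ y, g y ∂μ‖ₑ ≤
      ENNReal.ofReal (L * (D * Real.exp (-c * u)) * (‖x‖ + M)) := by
    rw [mul_assoc, ENNReal.ofReal_mul (by positivity), ENNReal.ofReal_mul (by positivity),
      ENNReal.ofReal_coe_nnreal]
    refine h2.trans ?_
    gcongr
    exact h1.trans (by gcongr)
  rw [← ofReal_norm] at h4
  exact (ENNReal.ofReal_le_ofReal_iff (by positivity)).1 h4

/-- Exponential decay of correlations for centred bounded Lipschitz observables, together with the
trivial bound. -/
lemma norm_integral_mul_conj_le (h : IsMarkovProcess Y P ℱ Pr) (hcontr : IsExpContractive P D c)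
    (hD : 0 ≤ D) (hM : 0 ≤ M) (hYM : ∀ t, ∫⁻ ω, ‖Y t ω‖ₑ ∂Pr ≤ ENNReal.ofReal M)
    {μ : Measure E} (hμ : IsInvariantP1 P μ)
    (hμM : ∫⁻ x, ‖x‖ₑ ∂μ ≤ ENNReal.ofReal M) {g : E → ℂ} {L : ℝ≥0} (hg : LipschitzWith L g)
    (hg1 : ∀ x, ‖g x‖ ≤ 1) (s u : ℝ≥0) :
    ‖∫ ω, (g (Y s ω) - ∫ y, g y ∂μ) * (starRingEnd ℂ) (g (Y (s + u) ω) - ∫ y, g y ∂μ) ∂Pr‖ ≤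
      4 * min 1 (L * D * M * Real.exp (-c * u)) := by
  have := hμ.1.isProb
  have := h.semigroup.isMarkov u
  have hs := h.measurable s
  have hsu := h.measurable (s + u)
  have := Measure.isProbabilityMeasure_map (μ := Pr) hs.aemeasurable
  set m := ∫ y, g y ∂μ with hm
  have hm1 : ‖m‖ ≤ 1 := by
    refine (norm_integral_le_of_norm_le_const (ae_of_all _ hg1)).trans ?_
    simp
  have hgm : ∀ x, ‖g x - m‖ ≤ 2 := fun x =>
    (norm_sub_le _ _).trans (by have := hg1 x; linarith)
  have hgc : Continuous g := hg.continuous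
  rw [mul_min_of_nonneg _ _ (by norm_num : (0 : ℝ) ≤ 4), mul_one]
  refine le_min ?_ ?_
  · refine (norm_integral_le_of_norm_le_const (C := 4) (ae_of_all _ fun ω => ?_)).trans (by simp)
    rw [norm_mul, RCLike.norm_conj]
    have h1 := hgm (Y s ω)
    have h2 := hgm (Y (s + u) ω)
    nlinarith [norm_nonneg (g (Y s ω) - m), norm_nonneg (g (Y (s + u) ω) - m)]
  have hcont : Continuous fun z : E × E => (g z.1 - m) * (starRingEnd ℂ) (g z.2 - m) :=
    ((hgc.comp continuous_fst).sub continuous_const).mul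
      (Complex.continuous_conj.comp ((hgc.comp continuous_snd).sub continuous_const))
  have e1 : ∫ ω, (g (Y s ω) - m) * (starRingEnd ℂ) (g (Y (s + u) ω) - m) ∂Pr =
      ∫ x, (g x - m) * (starRingEnd ℂ) (∫ y, g y ∂(P u x) - m) ∂(Pr.map (Y s)) := by
    have h1 := integral_map (μ := Pr) (hs.prodMk hsu).aemeasurable
      (f := fun z : E × E => (g z.1 - m) * (starRingEnd ℂ) (g z.2 - m))
      hcont.aestronglyMeasurable
    rw [← h1, h.map_prodMk, Measure.integral_compProd]
    · refine integral_congr_ae (ae_of_all _ fun x => ?_)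
      simp only
      rw [integral_const_mul, integral_conj, integral_sub, integral_const]
      · simp
      · exact Integrable.of_bound hgc.aestronglyMeasurable 1 (ae_of_all _ hg1)
      · exact integrable_const _
    · refine Integrable.of_bound hcont.aestronglyMeasurable (2 * 2) (ae_of_all _ fun z => ?_)
      rw [norm_mul, RCLike.norm_conj]
      exact mul_le_mul (hgm _) (hgm _) (norm_nonneg _) (by norm_num)
  rw [e1]
  have hYs : ∫⁻ x, ‖x‖ₑ ∂(Pr.map (Y s)) ≤ ENNReal.ofReal M := by
    rw [lintegral_map measurable_enorm hs]
    exact hYM s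
  have hP1 : IsP1 (Pr.map (Y s)) :=
    isP1_iff_lintegral_enorm.2 (hYs.trans_lt ENNReal.ofReal_lt_top)
  have hi : Integrable (fun x : E => 2 * (L * (D * Real.exp (-c * u)) * (‖x‖ + M)))
      (Pr.map (Y s)) := (((hP1.integrable_norm).add (integrable_const M)).const_mul _).const_mul _
  refine (norm_integral_le_of_norm_le hi (ae_of_all _ fun x => ?_)).trans ?_
  · rw [norm_mul, RCLike.norm_conj]
    exact mul_le_mul (hgm x)
      (norm_integral_kernel_sub_le h.semigroup hcontr hD hM hμ hμM hg hg1 u x) (norm_nonneg _)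
      (by norm_num)
  · rw [integral_const_mul, integral_const_mul, integral_add hP1.integrable_norm
      (integrable_const M), integral_const]
    simp only [probReal_univ, one_smul]
    have := integral_norm_le_of_lintegral hM hYs
    have h0 : 0 ≤ L * (D * Real.exp (-c * u)) := by positivity
    nlinarith [mul_le_mul_of_nonneg_left this h0]

end

/-! ### Second moments of weighted time averages -/

/-- The second moment of an average of random variables is the average of the correlations. -/
lemma lintegral_enorm_integral_sq_le {Ω S : Type*} [MeasurableSpace Ω] [MeasurableSpace S]
    {Pr : Measure Ω} [IsProbabilityMeasure Pr] {w : Measure S} [IsProbabilityMeasure w]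
    {Z : Ω → S → ℂ} (hZ : Measurable (Function.uncurry Z)) {K : ℝ} (hK : ∀ ω s, ‖Z ω s‖ ≤ K)
    {b : S → S → ℝ≥0∞}
    (hb : ∀ s₁ s₂, ‖∫ ω, Z ω s₁ * (starRingEnd ℂ) (Z ω s₂) ∂Pr‖ₑ ≤ b s₁ s₂) :
    ∫⁻ ω, ‖∫ s, Z ω s ∂w‖ₑ ^ 2 ∂Pr ≤ ∫⁻ s₁, ∫⁻ s₂, b s₁ s₂ ∂w ∂w := by
  set F : Ω → ℂ := fun ω => ∫ s, Z ω s ∂w with hF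
  have hFm : Measurable F := hZ.stronglyMeasurable.integral_prod_right.measurable
  have hFK : ∀ ω, ‖F ω‖ ≤ K := fun ω => by
    simpa using norm_integral_le_of_norm_le_const (μ := w) (ae_of_all _ (hK ω))
  set H : Ω → S × S → ℂ := fun ω z => Z ω z.1 * (starRingEnd ℂ) (Z ω z.2) with hH
  have hHm : Measurable (Function.uncurry H) := by
    have h1 : Measurable fun p : Ω × (S × S) => Z p.1 p.2.1 :=
      hZ.comp (measurable_fst.prodMk (measurable_fst.comp measurable_snd))
    have h2 : Measurable fun p : Ω × (S × S) => Z p.1 p.2.2 :=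
      hZ.comp (measurable_fst.prodMk (measurable_snd.comp measurable_snd))
    exact h1.mul (Complex.continuous_conj.measurable.comp h2)
  have hHi : Integrable (Function.uncurry H) (Pr.prod (w.prod w)) := by
    refine Integrable.of_bound hHm.aestronglyMeasurable (K * K) (ae_of_all _ fun p => ?_)
    simp only [Function.uncurry, hH, norm_mul, RCLike.norm_conj]
    exact mul_le_mul (hK _ _) (hK _ _) (norm_nonneg _) ((norm_nonneg _).trans (hK p.1 p.2.1))
  -- The square of an integral is a double integral.
  have e1 : ∀ ω, F ω * (starRingEnd ℂ) (F ω) = ∫ z, H ω z ∂(w.prod w) := fun ω => by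
    simp only [hH, hF]
    rw [← integral_conj, integral_prod_mul (fun s => Z ω s) (fun s => (starRingEnd ℂ) (Z ω s))]
  have hi2 : Integrable (fun ω => ‖F ω‖ ^ 2) Pr := by
    refine Integrable.of_bound (hFm.norm.pow_const 2).aestronglyMeasurable (K ^ 2)
      (ae_of_all _ fun ω => ?_)
    rw [norm_pow, norm_norm]
    exact pow_le_pow_left₀ (norm_nonneg _) (hFK ω) 2
  have e2 : ∫⁻ ω, ‖F ω‖ₑ ^ 2 ∂Pr = ‖∫ ω, F ω * (starRingEnd ℂ) (F ω) ∂Pr‖ₑ := by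
    have e3 : ∀ ω, F ω * (starRingEnd ℂ) (F ω) = ((‖F ω‖ ^ 2 : ℝ) : ℂ) := fun ω => by
      rw [Complex.mul_conj, Complex.normSq_eq_norm_sq]
    simp_rw [e3]
    rw [integral_complex_ofReal, ← ofReal_norm, Complex.norm_real, Real.norm_of_nonneg
      (integral_nonneg fun ω => sq_nonneg _), ofReal_integral_eq_lintegral_ofReal hi2
      (ae_of_all _ fun ω => sq_nonneg _)]
    refine lintegral_congr fun ω => ?_
    rw [ENNReal.ofReal_pow (norm_nonneg _), ofReal_norm]
  rw [e2]
  simp_rw [e1]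
  rw [integral_integral_swap hHi]
  have hmeas : AEMeasurable (fun z => ‖∫ ω, H ω z ∂Pr‖ₑ) (w.prod w) :=
    hHi.integral_prod_right.aestronglyMeasurable.enorm
  calc ‖∫ z, ∫ ω, H ω z ∂Pr ∂(w.prod w)‖ₑ ≤ ∫⁻ z, ‖∫ ω, H ω z ∂Pr‖ₑ ∂(w.prod w) :=
        enorm_integral_le_lintegral_enorm _
    _ = ∫⁻ s₁, ∫⁻ s₂, ‖∫ ω, H ω (s₁, s₂) ∂Pr‖ₑ ∂w ∂w := lintegral_prod _ hmeas
    _ ≤ _ := lintegral_mono fun s₁ => lintegral_mono fun s₂ => hb s₁ s₂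

/-- Exponential decay with prefactor `A` is effective only after a time of order `log A`; compared
with polynomial decay it therefore costs a factor of that order. -/
lemma min_one_mul_exp_le {A c ε ℓ v : ℝ} (hc : 0 < c) (hε : 0 < ε) (hε1 : ε ≤ 1) (hℓ : 1 ≤ ℓ)
    (hA : A ≤ Real.exp ℓ) (hv : 0 < v) :
    min 1 (A * Real.exp (-c * v)) ≤ (1 + 2 / c) * ℓ * v ^ (-ε) := by
  have h2c : 0 < 2 / c := by positivity
  rcases lt_or_ge v 1 with hv1 | hv1
  · have h1 : 1 ≤ v ^ (-ε) := Real.one_le_rpow_of_pos_of_le_one_of_nonpos hv hv1.le (by linarith)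
    refine (min_le_left _ _).trans ?_
    have : 1 ≤ (1 + 2 / c) * ℓ := by nlinarith
    nlinarith
  · have h1 : v⁻¹ ≤ v ^ (-ε) := by
      rw [← Real.rpow_neg_one]
      exact Real.rpow_le_rpow_of_exponent_le hv1 (by linarith)
    have key : min 1 (A * Real.exp (-c * v)) ≤ (2 / c) * ℓ * v⁻¹ := by
      -- After time `2 ℓ / c` half of the exponential decay beats the prefactor.
      rcases le_or_gt (c * v) (2 * ℓ) with h | h
      · refine (min_le_left _ _).trans ?_
        rw [← div_eq_mul_inv, le_div_iff₀ hv, div_mul_eq_mul_div, le_div_iff₀ hc]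
        linarith
      · refine (min_le_right _ _).trans ?_
        have h2 : A * Real.exp (-c * v) ≤ Real.exp (-(c * v / 2)) := by
          refine (mul_le_mul_of_nonneg_right hA (Real.exp_nonneg _)).trans ?_
          rw [← Real.exp_add]
          exact Real.exp_le_exp.2 (by linarith)
        have h3 : Real.exp (-(c * v / 2)) ≤ (c * v / 2)⁻¹ := by
          rw [Real.exp_neg]
          exact inv_anti₀ (by positivity) (by linarith [Real.add_one_le_exp (c * v / 2)])
        have h4 : (c * v / 2)⁻¹ = 2 / c * v⁻¹ := by field_simp
        rw [h4] at h3
        have h5 : 2 / c * v⁻¹ ≤ 2 / c * ℓ * v⁻¹ := by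
          refine mul_le_mul_of_nonneg_right ?_ (by positivity)
          nlinarith
        linarith
    refine key.trans ?_
    have h6 : 2 / c * ℓ * v⁻¹ ≤ 2 / c * ℓ * v ^ (-ε) :=
      mul_le_mul_of_nonneg_left h1 (by positivity)
    have h7 : 0 ≤ ℓ * v ^ (-ε) := by positivity
    nlinarith

lemma ofReal_min_one_mul_exp_le {A c ε ℓ : ℝ} (hc : 0 < c) (hε : 0 < ε) (hε1 : ε ≤ 1)
    (hℓ : 1 ≤ ℓ) (hA : A ≤ Real.exp ℓ) {t : ℝ≥0} (ht : 0 < t) {u : ℝ} (hu : 0 ≤ u) :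
    ENNReal.ofReal (min 1 (A * Real.exp (-c * (t * u)))) ≤
      ENNReal.ofReal ((1 + 2 / c) * ℓ / (t : ℝ) ^ ε) *
        min ((t : ℝ≥0∞) ^ ε) (ENNReal.ofReal u ^ (-ε)) := by
  have ht' : (0 : ℝ) < t := by exact_mod_cast ht
  have hpos : 0 < (1 + 2 / c) * ℓ / (t : ℝ) ^ ε := by positivity
  rcases min_choice ((t : ℝ≥0∞) ^ ε) (ENNReal.ofReal u ^ (-ε)) with h | h <;> rw [h]
  · rw [← ENNReal.ofReal_coe_nnreal, ENNReal.ofReal_rpow_of_pos ht', ← ENNReal.ofReal_mul hpos.le]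
    refine ENNReal.ofReal_le_ofReal ((min_le_left _ _).trans ?_)
    rw [div_mul_cancel₀ _ (by positivity)]
    have : 0 < 2 / c := by positivity
    nlinarith
  · rcases hu.eq_or_lt with rfl | hu
    -- At `u = 0` the right-hand side is infinite.
    · rw [ENNReal.ofReal_zero, ENNReal.zero_rpow_of_neg (by linarith), ENNReal.mul_top]
      · exact le_top
      · simpa using hpos
    · rw [ENNReal.ofReal_rpow_of_pos hu, ← ENNReal.ofReal_mul hpos.le]
      refine ENNReal.ofReal_le_ofReal ?_
      have := min_one_mul_exp_le hc hε hε1 hℓ hA (mul_pos ht' hu)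
      rw [Real.mul_rpow ht'.le hu.le, Real.rpow_neg ht'.le] at this
      rw [div_eq_mul_inv]
      linarith

section

variable {E : Type*} [NormedAddCommGroup E] [InnerProductSpace ℝ E] [FiniteDimensional ℝ E]
  [MeasurableSpace E] [BorelSpace E] {P : ℝ≥0 → Kernel E E} {D c M : ℝ}
  {Ω : Type*} {mΩ : MeasurableSpace Ω} {Pr : Measure Ω} [IsProbabilityMeasure Pr]
  {ℱ : Filtration ℝ≥0 mΩ} {Y : ℝ≥0 → Ω → E}

lemma measurable_timeChange : ∀ t : ℝ≥0, Measurable fun s : unitInterval =>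
    t * unitInterval.toNNReal s := fun _ => by
  have : Continuous unitInterval.toNNReal := by fun_prop
  fun_prop

lemma measurable_path (hY : Measurable (Function.uncurry Y)) (t : ℝ≥0) :
    Measurable fun p : Ω × unitInterval => Y (t * unitInterval.toNNReal p.2) p.1 :=
  hY.comp (((measurable_timeChange t).comp measurable_snd).prodMk measurable_fst)

lemma measurable_path_right (hY : Measurable (Function.uncurry Y)) (t : ℝ≥0) (ω : Ω) :
    Measurable fun s : unitInterval => Y (t * unitInterval.toNNReal s) ω :=
  (measurable_path hY t).comp (measurable_const.prodMk measurable_id)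

lemma integral_weightedEmpirical {F : Type*} [NormedAddCommGroup F] [NormedSpace ℝ F]
    (hY : Measurable (Function.uncurry Y)) (w : WeightFamily) (t : ℝ≥0) (ω : Ω) {g : E → F}
    (hg : Continuous g) :
    ∫ x, g x ∂(weightedEmpirical Y w t ω) =
      ∫ s, g (Y (t * unitInterval.toNNReal s) ω) ∂(w t : Measure unitInterval) :=
  integral_map (measurable_path_right hY t ω).aemeasurable
    (hg.stronglyMeasurable.aestronglyMeasurable)

/-- Mean-square deviation of the empirical mean of a bounded Lipschitz observable from its invariant
mean: of order `log A / t ^ ε`, where `A` is the Lipschitz constant times the constants of the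
process. -/
lemma lintegral_enorm_sq_weightedEmpirical_le (h : IsMarkovProcess Y P ℱ Pr)
    (hY : Measurable (Function.uncurry Y)) (hcontr : IsExpContractive P D c) (hc : 0 < c)
    (hD : 0 ≤ D) (hM : 0 ≤ M) (hYM : ∀ t, ∫⁻ ω, ‖Y t ω‖ₑ ∂Pr ≤ ENNReal.ofReal M)
    {μ : Measure E} (hμ : IsInvariantP1 P μ) (hμM : ∫⁻ x, ‖x‖ₑ ∂μ ≤ ENNReal.ofReal M)
    {g : E → ℂ} {L : ℝ≥0} (hg : LipschitzWith L g) (hg1 : ∀ x, ‖g x‖ ≤ 1)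
    {ε : ℝ} (hε : 0 < ε) (hε1 : ε ≤ 1) {w : WeightFamily} {t : ℝ≥0} (ht : 0 < t) {K : ℝ}
    (hK : ∫⁻ s₁ : unitInterval, ∫⁻ s₂ : unitInterval,
      min ((t : ℝ≥0∞) ^ ε) (ENNReal.ofReal |(s₁ : ℝ) - (s₂ : ℝ)| ^ (-ε))
        ∂(w t : Measure unitInterval) ∂(w t : Measure unitInterval) ≤ ENNReal.ofReal K)
    {ℓ : ℝ} (hℓ : 1 ≤ ℓ) (hA : L * D * M ≤ Real.exp ℓ) :
    ∫⁻ ω, ‖∫ x, g x ∂(weightedEmpirical Y w t ω) - ∫ x, g x ∂μ‖ₑ ^ 2 ∂Pr ≤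
      ENNReal.ofReal (4 * ((1 + 2 / c) * ℓ / (t : ℝ) ^ ε) * K) := by
  have := hμ.1.isProb
  have hgc := hg.continuous
  set m := ∫ x, g x ∂μ with hm
  set Z : Ω → unitInterval → ℂ := fun ω s => g (Y (t * unitInterval.toNNReal s) ω) - m with hZ
  have hm1 : ‖m‖ ≤ 1 := by
    refine (norm_integral_le_of_norm_le_const (ae_of_all _ hg1)).trans ?_
    simp
  have hZm : Measurable (Function.uncurry Z) :=
    (hgc.measurable.comp (measurable_path hY t)).sub_const m
  have hZK : ∀ ω s, ‖Z ω s‖ ≤ 2 := fun ω s =>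
    (norm_sub_le _ _).trans (by have := hg1 (Y (t * unitInterval.toNNReal s) ω); linarith)
  have e1 : ∀ ω, ∫ x, g x ∂(weightedEmpirical Y w t ω) - m =
      ∫ s, Z ω s ∂(w t : Measure unitInterval) := fun ω => by
    rw [integral_weightedEmpirical hY w t ω hgc, integral_sub _ (integrable_const m),
      integral_const]
    · simp
    · exact Integrable.of_bound
        (hgc.measurable.comp (measurable_path_right hY t ω)).aestronglyMeasurable 1
        (ae_of_all _ fun s => hg1 _)
  simp_rw [e1]
  have ht0 : (0 : ℝ) < t := by exact_mod_cast ht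
  have hcorr : ∀ s₁ s₂ : unitInterval, s₁ ≤ s₂ →
      ‖∫ ω, Z ω s₁ * (starRingEnd ℂ) (Z ω s₂) ∂Pr‖ ≤
        4 * min 1 (L * D * M * Real.exp (-c * (t * |(s₁ : ℝ) - s₂|))) := by
    intro s₁ s₂ h12
    have h12' : (s₁ : ℝ) ≤ s₂ := h12
    have e : t * unitInterval.toNNReal s₂ =
        t * unitInterval.toNNReal s₁ +
          t * (unitInterval.toNNReal s₂ - unitInterval.toNNReal s₁) := by
      rw [← mul_add, add_tsub_cancel_of_le]
      exact h12
    have h1 := norm_integral_mul_conj_le h hcontr hD hM hYM hμ hμM hg hg1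
      (t * unitInterval.toNNReal s₁) (t * (unitInterval.toNNReal s₂ - unitInterval.toNNReal s₁))
    rw [← e] at h1
    refine h1.trans (le_of_eq ?_)
    congr 5
    rw [NNReal.coe_mul, NNReal.coe_sub (by exact h12), abs_sub_comm,
      abs_of_nonneg (sub_nonneg.2 h12')]
    rfl
  have hcorr' : ∀ s₁ s₂ : unitInterval,
      ‖∫ ω, Z ω s₁ * (starRingEnd ℂ) (Z ω s₂) ∂Pr‖ ≤
        4 * min 1 (L * D * M * Real.exp (-c * (t * |(s₁ : ℝ) - s₂|))) := by
    intro s₁ s₂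
    rcases le_total s₁ s₂ with h12 | h12
    · exact hcorr s₁ s₂ h12
    · have := hcorr s₂ s₁ h12
      rw [abs_sub_comm]
      refine le_trans (le_of_eq ?_) this
      rw [← RCLike.norm_conj, ← integral_conj]
      simp only [map_mul, Complex.conj_conj, mul_comm]
  refine (lintegral_enorm_integral_sq_le hZm hZK (b := fun s₁ s₂ =>
    ENNReal.ofReal (4 * ((1 + 2 / c) * ℓ / (t : ℝ) ^ ε)) *
      min ((t : ℝ≥0∞) ^ ε) (ENNReal.ofReal |(s₁ : ℝ) - (s₂ : ℝ)| ^ (-ε)))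
    fun s₁ s₂ => ?_).trans ?_
  · rw [← ofReal_norm]
    refine (ENNReal.ofReal_le_ofReal (hcorr' s₁ s₂)).trans ?_
    rw [ENNReal.ofReal_mul (by norm_num), ENNReal.ofReal_mul (by norm_num),
      mul_assoc (ENNReal.ofReal 4)]
    exact mul_le_mul_right (ofReal_min_one_mul_exp_le hc hε hε1 hℓ hA ht (abs_nonneg _)) _
  · simp_rw [lintegral_const_mul' _ _ ENNReal.ofReal_ne_top]
    exact le_of_le_of_eq (mul_le_mul_right hK _) (ENNReal.ofReal_mul (by positivity)).symm

end

/-! ### The discrete Jackson kernel -/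

section

variable (n : ℕ)

/-- The geometric (Dirichlet) sum `1 + u + ⋯ + u ^ (n - 1)` on the unit circle. -/
noncomputable def geomSum (u : Circle) : ℂ := ∑ a ∈ Finset.range n, (u : ℂ) ^ a

/-- The quadruples indexing the expansion of the fourth power of the Dirichlet kernel. -/
def quad : Finset ((ℕ × ℕ) × ℕ × ℕ) :=
  (Finset.range n ×ˢ Finset.range n) ×ˢ Finset.range n ×ˢ Finset.range n

/-- The frequency of the term of the expansion indexed by a quadruple. -/
def freq (p : (ℕ × ℕ) × ℕ × ℕ) : ℤ := (p.1.1 : ℤ) + p.2.1 - p.1.2 - p.2.2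

/-- The coefficients of the fourth power of the Dirichlet kernel. -/
def jcoef (k : ℤ) : ℕ := ((quad n).filter fun p => freq p = k).card

lemma norm_sub_one_mul_geomSum_le (u : Circle) : ‖(u : ℂ) - 1‖ * ‖geomSum n u‖ ≤ 2 := by
  rw [← norm_mul, geomSum, mul_geom_sum]
  refine (norm_sub_le _ _).trans ?_
  rw [norm_pow, Circle.norm_coe]
  norm_num

lemma norm_sq_geomSum (u : Circle) : ((‖geomSum n u‖ ^ 2 : ℝ) : ℂ) =
    ∑ p ∈ Finset.range n ×ˢ Finset.range n, (u : ℂ) ^ ((p.1 : ℤ) - p.2) := by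
  rw [← Complex.normSq_eq_norm_sq, ← Complex.mul_conj, geomSum, map_sum, Finset.sum_mul_sum,
    Finset.sum_product]
  refine Finset.sum_congr rfl fun a _ => Finset.sum_congr rfl fun b _ => ?_
  rw [map_pow, ← Circle.coe_inv_eq_conj, zpow_sub₀ (Circle.coe_ne_zero u), zpow_natCast,
    zpow_natCast, Circle.coe_inv, inv_pow, div_eq_mul_inv]

lemma norm_fourth_geomSum (u : Circle) : ((‖geomSum n u‖ ^ 4 : ℝ) : ℂ) =
    ∑ p ∈ quad n, (u : ℂ) ^ freq p := by
  have : ‖geomSum n u‖ ^ 4 = ‖geomSum n u‖ ^ 2 * ‖geomSum n u‖ ^ 2 := by ring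
  rw [this, Complex.ofReal_mul, norm_sq_geomSum, Finset.sum_mul_sum, quad]
  conv_rhs => rw [Finset.sum_product]
  refine Finset.sum_congr rfl fun a _ => Finset.sum_congr rfl fun b _ => ?_
  rw [← zpow_add₀ (Circle.coe_ne_zero u)]
  congr 1
  simp only [freq]
  ring

lemma freq_mem_Icc {p : (ℕ × ℕ) × ℕ × ℕ} (hp : p ∈ quad n) :
    freq p ∈ Finset.Icc (-(2 * n : ℤ)) (2 * n) := by
  simp only [quad, Finset.mem_product, Finset.mem_range] at hp
  simp only [freq, Finset.mem_Icc]
  omega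

lemma norm_fourth_geomSum_eq_sum_jcoef (u : Circle) : ((‖geomSum n u‖ ^ 4 : ℝ) : ℂ) =
    ∑ k ∈ Finset.Icc (-(2 * n : ℤ)) (2 * n), (jcoef n k : ℂ) * (u : ℂ) ^ k := by
  rw [norm_fourth_geomSum, ← Finset.sum_fiberwise_of_maps_to fun p hp => freq_mem_Icc n hp]
  refine Finset.sum_congr rfl fun k _ => ?_
  rw [Finset.sum_congr rfl fun p hp => by rw [(Finset.mem_filter.1 hp).2], Finset.sum_const,
    nsmul_eq_mul, jcoef]

/-- The normalizing constant is an additive energy, bounded below by Cauchy-Schwarz. -/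
lemma pow_three_le_jcoef_zero : (n : ℝ) ^ 3 ≤ 2 * jcoef n 0 := by
  classical
  rcases Nat.eq_zero_or_pos n with rfl | hn
  · simp
  have h := Finset.card_sq_le_card_mul_addEnergy (Finset.range n) (Finset.range n)
    (Finset.range (2 * n))
  have e1 : (Finset.range n ×ˢ Finset.range n).filter
      (fun xy : ℕ × ℕ => xy.1 + xy.2 ∈ Finset.range (2 * n)) =
      Finset.range n ×ˢ Finset.range n := by
    refine Finset.filter_true_of_mem fun p hp => ?_
    simp only [Finset.mem_product, Finset.mem_range] at hp ⊢
    omega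
  have e2 : Finset.addEnergy (Finset.range n) (Finset.range n) = jcoef n 0 := by
    rw [Finset.addEnergy, jcoef, quad]
    congr 1
    refine Finset.filter_congr fun p _ => ?_
    simp only [freq]
    omega
  rw [e1, e2] at h
  simp only [Finset.card_product, Finset.card_range] at h
  have h' : ((n : ℝ) * n) ^ 2 ≤ 2 * n * jcoef n 0 := by exact_mod_cast h
  have hn' : (0 : ℝ) < n := by exact_mod_cast hn
  have : (n : ℝ) * (n : ℝ) ^ 3 ≤ n * (2 * jcoef n 0) := by nlinarith
  exact le_of_mul_le_mul_left this hn'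

lemma jcoef_zero_pos (hn : 1 ≤ n) : (0 : ℝ) < jcoef n 0 := by
  have := pow_three_le_jcoef_zero n
  have h1 : (1 : ℝ) ≤ n := by exact_mod_cast hn
  have : (0 : ℝ) < (n : ℝ) ^ 3 := by positivity
  linarith

end

section

variable {N : ℕ} [NeZero N]

/-- Orthogonality of characters on the `N`-th roots of unity. -/
lemma sum_zpow_mul_inv_toCircle (z : Circle) {k : ℤ} (hk : |k| < N) :
    ∑ j : ZMod N, ((z * (ZMod.toCircle j)⁻¹ : Circle) : ℂ) ^ k = if k = 0 then (N : ℂ) else 0 := by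
  have h1 : ∀ j : ZMod N, ((z * (ZMod.toCircle j)⁻¹ : Circle) : ℂ) ^ k =
      (z : ℂ) ^ k * ZMod.stdAddChar (j * (((-k : ℤ)) : ZMod N)) := by
    intro j
    have : j * (((-k : ℤ)) : ZMod N) = (-k) • j := by
      rw [zsmul_eq_mul, mul_comm]
    rw [this, AddChar.map_zsmul_eq_zpow, Circle.coe_mul, mul_zpow, Circle.coe_inv, zpow_neg,
      inv_zpow]
    rfl
  simp_rw [h1, ← Finset.mul_sum, AddChar.sum_mulShift _ (ZMod.isPrimitive_stdAddChar N)]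
  have h2 : (((-k : ℤ)) : ZMod N) = 0 ↔ k = 0 := by
    rw [ZMod.intCast_zmod_eq_zero_iff_dvd, dvd_neg]
    exact ⟨fun h => Int.eq_zero_of_abs_lt_dvd h hk, fun h => h ▸ dvd_zero _⟩
  by_cases h : k = 0
  · subst h; simp
  · rw [if_neg h, if_neg (fun h' => h (h2.1 h'))]; simp

lemma sum_norm_sq_geomSum {n : ℕ} (hN : 2 * n ≤ N) (z : Circle) :
    ∑ j : ZMod N, ‖geomSum n (z * (ZMod.toCircle j)⁻¹)‖ ^ 2 = N * n := by
  -- The frequencies `a - b` are smaller than `N`, so the sum over the roots of unity is exact.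
  have : ((∑ j : ZMod N, ‖geomSum n (z * (ZMod.toCircle j)⁻¹)‖ ^ 2 : ℝ) : ℂ) =
      ((N * n : ℝ) : ℂ) := by
    rw [Complex.ofReal_sum]
    simp_rw [norm_sq_geomSum]
    rw [Finset.sum_comm]
    rw [Finset.sum_congr rfl fun p hp => sum_zpow_mul_inv_toCircle z (by
      simp only [Finset.mem_product, Finset.mem_range] at hp
      rw [abs_lt]; omega), Finset.sum_product]
    have : ∀ a ∈ Finset.range n, ∑ b ∈ Finset.range n,
        (if ((a : ℤ) - (b : ℤ)) = 0 then (N : ℂ) else 0) = N := fun a ha => by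
      simp only [sub_eq_zero, Nat.cast_inj]
      rw [Finset.sum_ite_eq, if_pos ha]
    rw [Finset.sum_congr rfl this]
    simp [mul_comm]
  exact_mod_cast this

lemma sum_norm_fourth_geomSum {n : ℕ} (hN : 4 * n < N) (z : Circle) :
    ∑ j : ZMod N, ‖geomSum n (z * (ZMod.toCircle j)⁻¹)‖ ^ 4 = N * jcoef n 0 := by
  have : ((∑ j : ZMod N, ‖geomSum n (z * (ZMod.toCircle j)⁻¹)‖ ^ 4 : ℝ) : ℂ) =
      ((N * jcoef n 0 : ℝ) : ℂ) := by
    rw [Complex.ofReal_sum]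
    simp_rw [norm_fourth_geomSum]
    rw [Finset.sum_comm]
    rw [Finset.sum_congr rfl fun p hp => sum_zpow_mul_inv_toCircle z (by
      have := freq_mem_Icc n hp
      rw [Finset.mem_Icc] at this
      rw [abs_lt]; omega), ← Finset.sum_filter, Finset.sum_const, nsmul_eq_mul]
    push_cast
    rw [jcoef, mul_comm]
  exact_mod_cast this

/-- The weights of the discrete Jackson kernel centred at `z`. -/
noncomputable def jweight (n : ℕ) (z : Circle) (j : ZMod N) : ℝ :=
  ‖geomSum n (z * (ZMod.toCircle j)⁻¹)‖ ^ 4 / (N * jcoef n 0)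

lemma jweight_nonneg (n : ℕ) (z : Circle) (j : ZMod N) : 0 ≤ jweight n z j := by
  unfold jweight; positivity

lemma sum_jweight {n : ℕ} (hn : 1 ≤ n) (hN : 4 * n < N) (z : Circle) :
    ∑ j : ZMod N, jweight n z j = 1 := by
  have h1 : (0 : ℝ) < N := by exact_mod_cast (by omega : 0 < N)
  have h2 := jcoef_zero_pos n hn
  unfold jweight
  rw [← Finset.sum_div, sum_norm_fourth_geomSum hN, div_self (by positivity)]

/-- The Jackson kernel of order `n` is concentrated at scale `1 / n`: one factor of the Dirichlet
kernel absorbs the distance, the others are summed by Cauchy-Schwarz. -/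
lemma sum_jweight_mul_norm_sub_le {n : ℕ} (hn : 1 ≤ n) (hN : 4 * n < N) (z : Circle) :
    ∑ j : ZMod N, jweight n z j * ‖(z : ℂ) - ZMod.toCircle j‖ ≤ 3 / n := by
  have h1 : (0 : ℝ) < N := by exact_mod_cast (by omega : 0 < N)
  have h2 := jcoef_zero_pos n hn
  have hn' : (0 : ℝ) < n := by exact_mod_cast hn
  set g : ZMod N → ℝ := fun j => ‖geomSum n (z * (ZMod.toCircle j)⁻¹)‖ with hg
  have hdist : ∀ j : ZMod N, ‖(z : ℂ) - ZMod.toCircle j‖ =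
      ‖((z * (ZMod.toCircle j)⁻¹ : Circle) : ℂ) - 1‖ := fun j => by
    have : ((z * (ZMod.toCircle j)⁻¹ : Circle) : ℂ) - 1 =
        ((z : ℂ) - ZMod.toCircle j) * (((ZMod.toCircle j)⁻¹ : Circle) : ℂ) := by
      rw [sub_mul, ← Circle.coe_mul, ← Circle.coe_mul, mul_inv_cancel, Circle.coe_one]
    rw [this, norm_mul, Circle.norm_coe, mul_one]
  have hterm : ∀ j : ZMod N, jweight n z j * ‖(z : ℂ) - ZMod.toCircle j‖ ≤
      2 / (N * jcoef n 0) * (g j * g j ^ 2) := fun j => by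
    have h3 := norm_sub_one_mul_geomSum_le n (z * (ZMod.toCircle j)⁻¹)
    rw [hdist, jweight, div_mul_eq_mul_div, div_mul_eq_mul_div]
    refine div_le_div_of_nonneg_right ?_ (by positivity)
    have h4 : 0 ≤ g j ^ 3 := by positivity
    calc g j ^ 4 * ‖((z * (ZMod.toCircle j)⁻¹ : Circle) : ℂ) - 1‖
        = g j ^ 3 * (‖((z * (ZMod.toCircle j)⁻¹ : Circle) : ℂ) - 1‖ * g j) := by ring
      _ ≤ g j ^ 3 * 2 := mul_le_mul_of_nonneg_left h3 h4
      _ = 2 * (g j * g j ^ 2) := by ring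
  have hcs : (∑ j, g j * g j ^ 2) ^ 2 ≤ (N * n) * (N * jcoef n 0) := by
    have := Finset.sum_mul_sq_le_sq_mul_sq Finset.univ g fun j => g j ^ 2
    rw [sum_norm_sq_geomSum (by omega) z] at this
    have e : ∑ j, (g j ^ 2) ^ 2 = N * jcoef n 0 := by
      rw [← sum_norm_fourth_geomSum hN z]
      exact Finset.sum_congr rfl fun j _ => by rw [← pow_mul]
    rwa [e] at this
  refine (Finset.sum_le_sum fun j _ => hterm j).trans ?_
  rw [← Finset.mul_sum]
  have hS0 : 0 ≤ ∑ j, g j * g j ^ 2 := Finset.sum_nonneg fun j _ => by positivity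
  refine le_of_sq_le_sq ?_ (by positivity)
  rw [mul_pow, div_pow, div_pow]
  have h5 := pow_three_le_jcoef_zero n
  calc (2 : ℝ) ^ 2 / ((N : ℝ) * jcoef n 0) ^ 2 * (∑ j, g j * g j ^ 2) ^ 2
      ≤ (2 : ℝ) ^ 2 / ((N : ℝ) * jcoef n 0) ^ 2 * ((N * n) * (N * jcoef n 0)) := by gcongr
    _ = 4 * (n : ℝ) / jcoef n 0 := by field_simp; norm_num
    _ ≤ (3 : ℝ) ^ 2 / (n : ℝ) ^ 2 := by
        rw [div_le_div_iff₀ h2 (by positivity)]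
        nlinarith

/-- The Fourier coefficients of a nonnegative function are largest at frequency zero. -/
lemma jcoef_le (n : ℕ) {k : ℤ} (hk : k ∈ Finset.Icc (-(2 * n : ℤ)) (2 * n)) :
    (jcoef n k : ℝ) ≤ jcoef n 0 := by
  have hN : 4 * n < 4 * n + 1 := by omega
  set u : ZMod (4 * n + 1) → Circle := fun j => 1 * (ZMod.toCircle j)⁻¹ with hu
  have h1 : (((4 * n + 1 : ℕ) * jcoef n k : ℝ) : ℂ) =
      ∑ j, ((‖geomSum n (u j)‖ ^ 4 : ℝ) : ℂ) * (u j : ℂ) ^ (-k) := by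
    simp_rw [norm_fourth_geomSum, Finset.sum_mul]
    rw [Finset.sum_comm]
    simp_rw [← zpow_add₀ (Circle.coe_ne_zero _)]
    rw [Finset.sum_congr rfl fun p hp => sum_zpow_mul_inv_toCircle 1 (by
      have := freq_mem_Icc n hp
      rw [Finset.mem_Icc] at this hk
      rw [abs_lt]; push_cast; omega), ← Finset.sum_filter, Finset.sum_const, nsmul_eq_mul]
    simp_rw [← sub_eq_add_neg, sub_eq_zero]
    rw [← jcoef]
    push_cast
    ring
  have h2 : ((4 * n + 1 : ℕ) * jcoef n k : ℝ) ≤ (4 * n + 1 : ℕ) * jcoef n 0 := by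
    rw [← sum_norm_fourth_geomSum hN 1]
    have h3 : ‖(((4 * n + 1 : ℕ) * jcoef n k : ℝ) : ℂ)‖ = ((4 * n + 1 : ℕ) * jcoef n k : ℝ) := by
      rw [Complex.norm_real, Real.norm_of_nonneg (by positivity)]
    rw [← h3, h1]
    refine (norm_sum_le _ _).trans (Finset.sum_le_sum fun j _ => ?_)
    rw [norm_mul, norm_zpow, Circle.norm_coe, one_zpow, mul_one, Complex.norm_real,
      Real.norm_of_nonneg (by positivity)]
  exact le_of_mul_le_mul_left h2 (by positivity)

/-- The Jackson weights as a trigonometric polynomial in the centre. -/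
lemma ofReal_jweight (n : ℕ) (z : Circle) (j : ZMod N) : (jweight n z j : ℂ) =
    ∑ k ∈ Finset.Icc (-(2 * n : ℤ)) (2 * n), ((jcoef n k : ℂ) / jcoef n 0) *
      ((N : ℂ)⁻¹ * ZMod.stdAddChar (-(j * (k : ZMod N)))) * (z : ℂ) ^ k := by
  rw [jweight, Complex.ofReal_div, norm_fourth_geomSum_eq_sum_jcoef, Finset.sum_div]
  refine Finset.sum_congr rfl fun k _ => ?_
  have : (ZMod.stdAddChar (-(j * (k : ZMod N))) : ℂ) = ((ZMod.toCircle j : ℂ) ^ k)⁻¹ := by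
    rw [← mul_neg, mul_comm, ← Int.cast_neg, ← zsmul_eq_mul, AddChar.map_zsmul_eq_zpow, zpow_neg]
    rfl
  rw [this, Circle.coe_mul, mul_zpow, Circle.coe_inv, inv_zpow]
  push_cast
  rw [div_eq_mul_inv, mul_inv]
  ring

end

/-! ### Trigonometric approximation of Lipschitz functions on the torus -/

section

variable {d N : ℕ} [NeZero N]

/-- The frequencies of the trigonometric approximation. -/
noncomputable def freqBox (d n : ℕ) : Finset (Fin d → ℤ) :=
  Fintype.piFinset fun _ => Finset.Icc (-(2 * n : ℤ)) (2 * n)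

lemma abs_le_of_mem_freqBox {n : ℕ} {k : Fin d → ℤ} (hk : k ∈ freqBox d n) (i : Fin d) :
    |k i| ≤ 2 * n := by
  have := Finset.mem_Icc.1 (Fintype.mem_piFinset.1 hk i)
  exact abs_le.2 this

/-- Discrete Fourier coefficient on the grid of `N`-th roots of unity. -/
noncomputable def dcoef (G : (Fin d → ZMod N) → ℂ) (k : Fin d → ℤ) : ℂ :=
  ((N : ℂ) ^ d)⁻¹ * ∑ y, G y * ∏ i, ZMod.stdAddChar (-(y i * (k i : ZMod N)))

lemma dcoef_shift (G : (Fin d → ZMod N) → ℂ) (k i) :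
    dcoef (fun y => G (y + Pi.single i 1)) k =
      ZMod.stdAddChar ((k i : ℤ) : ZMod N) * dcoef G k := by
  classical
  rw [dcoef, dcoef, mul_left_comm]
  congr 1
  rw [Finset.mul_sum, ← Equiv.sum_comp (Equiv.addRight (Pi.single i (1 : ZMod N)))
    fun y => ZMod.stdAddChar ((k i : ℤ) : ZMod N) *
      (G y * ∏ l, ZMod.stdAddChar (-(y l * (k l : ZMod N))))]
  refine Finset.sum_congr rfl fun y _ => ?_
  simp only [Equiv.coe_addRight]
  rw [mul_left_comm]
  congr 1
  have : ∀ l, ZMod.stdAddChar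
        (-((y + Pi.single i (1 : ZMod N) : Fin d → ZMod N) l * (k l : ZMod N))) =
      ZMod.stdAddChar (-(y l * (k l : ZMod N))) *
        (if l = i then (ZMod.stdAddChar (-((k i : ℤ) : ZMod N)) : ℂ) else 1) := by
    intro l
    by_cases h : l = i
    · subst h
      simp only [Pi.add_apply, Pi.single_eq_same, if_true]
      rw [← AddChar.map_add_eq_mul]
      congr 1
      ring
    · simp [h]
  simp_rw [this, Finset.prod_mul_distrib, Finset.prod_ite_eq', Finset.mem_univ, if_true]
  rw [mul_left_comm, ← AddChar.map_add_eq_mul, add_neg_cancel, AddChar.map_zero_eq_one, mul_one]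

/-- Bessel's inequality on the grid. -/
lemma sum_norm_sq_dcoef_le {n : ℕ} (hN : 4 * n < N) (G : (Fin d → ZMod N) → ℂ) :
    ∑ k ∈ freqBox d n, ‖dcoef G k‖ ^ 2 ≤ ((N : ℝ) ^ d)⁻¹ * ∑ y, ‖G y‖ ^ 2 := by
  classical
  have hN0 : (0 : ℝ) < N := by exact_mod_cast (by omega : 0 < N)
  set r : ℝ := (Real.sqrt ((N : ℝ) ^ d))⁻¹ with hr
  have hr0 : 0 ≤ r := by positivity
  have hr2 : r * r = ((N : ℝ) ^ d)⁻¹ := by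
    rw [hr, ← mul_inv, Real.mul_self_sqrt (by positivity)]
  let v : (Fin d → ZMod N) → EuclideanSpace ℂ (Fin d → ZMod N) := fun κ =>
    WithLp.toLp 2 fun y => (r : ℂ) * ∏ i, ZMod.stdAddChar (y i * κ i)
  have hconj : ∀ x : ZMod N, (starRingEnd ℂ) (ZMod.stdAddChar x) = ZMod.stdAddChar (-x) := by
    intro x
    rw [AddChar.map_neg_eq_inv]
    exact (Circle.coe_inv_eq_conj _).symm
  have hinner : ∀ κ (x : EuclideanSpace ℂ (Fin d → ZMod N)), inner ℂ (v κ) x =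
      (r : ℂ) * ∑ y, x y * ∏ i, ZMod.stdAddChar (-(y i * κ i)) := by
    intro κ x
    rw [PiLp.inner_apply, Finset.mul_sum]
    refine Finset.sum_congr rfl fun y _ => ?_
    simp only [v, RCLike.inner_apply, map_mul, map_prod, hconj, Complex.conj_ofReal]
    ring
  have hv : Orthonormal ℂ v := by
    rw [orthonormal_iff_ite]
    intro κ κ'
    rw [hinner]
    have h1 : ∀ y : Fin d → ZMod N, (v κ') y * ∏ i, ZMod.stdAddChar (-(y i * κ i)) =
        (r : ℂ) * ∏ i, ZMod.stdAddChar (y i * (κ' i - κ i)) := by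
      intro y
      simp only [v]
      rw [mul_assoc, ← Finset.prod_mul_distrib]
      congr 1
      refine Finset.prod_congr rfl fun i _ => ?_
      rw [← AddChar.map_add_eq_mul]
      congr 1
      ring
    simp_rw [h1]
    rw [← Finset.mul_sum, ← mul_assoc, ← Complex.ofReal_mul, hr2]
    have h2 : ∑ y : Fin d → ZMod N, ∏ i, (ZMod.stdAddChar (y i * (κ' i - κ i)) : ℂ) =
        ∏ i, ∑ j : ZMod N, (ZMod.stdAddChar (j * (κ' i - κ i)) : ℂ) := by
      rw [Finset.prod_univ_sum, Fintype.piFinset_univ]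
    rw [h2]
    simp_rw [AddChar.sum_mulShift _ (ZMod.isPrimitive_stdAddChar N), ZMod.card]
    by_cases h : κ = κ'
    · subst h
      have : (N : ℂ) ≠ 0 := by exact_mod_cast hN0.ne'
      simp [this]
    · obtain ⟨i, hi⟩ := Function.ne_iff.1 h
      rw [if_neg h, Finset.prod_eq_zero (Finset.mem_univ i), mul_zero]
      rw [if_neg]
      · simp
      · exact fun h' => hi (sub_eq_zero.1 h').symm
  have hdc : ∀ k : Fin d → ℤ, dcoef G k =
      (r : ℂ) * inner ℂ (v fun i => (k i : ZMod N)) (WithLp.toLp 2 G) := by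
    intro k
    rw [hinner, dcoef, ← mul_assoc, ← Complex.ofReal_mul, hr2]
    push_cast
    rfl
  -- Distinct frequencies of the box stay distinct modulo `N`, as they differ by at most `4 n < N`.
  have hinj : Set.InjOn (fun (k : Fin d → ℤ) (i : Fin d) => (k i : ZMod N)) (freqBox d n) := by
    intro k hk l hl hkl
    funext i
    have h1 := abs_le_of_mem_freqBox hk i
    have h2 := abs_le_of_mem_freqBox hl i
    have h3 : ((k i : ℤ) : ZMod N) = (l i : ℤ) := congrFun hkl i
    rw [← sub_eq_zero, ← Int.cast_sub, ZMod.intCast_zmod_eq_zero_iff_dvd] at h3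
    have := Int.eq_zero_of_abs_lt_dvd h3 (by rw [abs_lt]; rw [abs_le] at h1 h2; omega)
    omega
  have hB := hv.sum_inner_products_le (x := WithLp.toLp 2 G)
    (s := (freqBox d n).image fun (k : Fin d → ℤ) (i : Fin d) => (k i : ZMod N))
  rw [Finset.sum_image hinj, EuclideanSpace.norm_sq_eq] at hB
  have h3 : ∀ k, ‖dcoef G k‖ ^ 2 = ((N : ℝ) ^ d)⁻¹ *
      ‖(inner ℂ (v fun i => (k i : ZMod N)) (WithLp.toLp 2 G) : ℂ)‖ ^ 2 := fun k => by
    rw [hdc, norm_mul, mul_pow, Complex.norm_real, Real.norm_of_nonneg hr0, sq, hr2]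
  simp_rw [h3]
  rw [← Finset.mul_sum]
  exact mul_le_mul_of_nonneg_left hB (by positivity)

lemma norm_stdAddChar_sub_one_ge (hN : 0 < N) {k : ℤ} (hk : 2 * |k| ≤ N) :
    4 * |(k : ℝ)| / N ≤ ‖(ZMod.stdAddChar (k : ZMod N) : ℂ) - 1‖ := by
  have hN' : (0 : ℝ) < N := by exact_mod_cast hN
  have e : (ZMod.stdAddChar (k : ZMod N) : ℂ) =
      Complex.exp (Complex.I * ((2 * Real.pi * k / N : ℝ) : ℂ)) := by
    rw [ZMod.stdAddChar_coe]
    congr 1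
    push_cast
    ring
  rw [e, Complex.norm_exp_I_mul_ofReal_sub_one, norm_mul, Real.norm_two, Real.norm_eq_abs]
  have hk' : 2 * |(k : ℝ)| ≤ N := by exact_mod_cast hk
  have habs : |2 * Real.pi * k / N / 2| = Real.pi * |(k : ℝ)| / N := by
    rw [show 2 * Real.pi * k / N / 2 = Real.pi * k / N by ring, abs_div, abs_mul,
      abs_of_pos Real.pi_pos, abs_of_pos hN']
  have h1 := Real.mul_abs_le_abs_sin (x := 2 * Real.pi * k / N / 2) (by
    rw [habs, div_le_div_iff₀ hN' two_pos]
    nlinarith [Real.pi_pos])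
  rw [habs] at h1
  have h2 : 2 / Real.pi * (Real.pi * |(k : ℝ)| / N) = 2 * |(k : ℝ)| / N := by
    field_simp
  rw [h2] at h1
  calc 4 * |(k : ℝ)| / N = 2 * (2 * |(k : ℝ)| / N) := by ring
    _ ≤ _ := by linarith

lemma norm_toCircle_one_sub_one_le : ‖(ZMod.toCircle (1 : ZMod N) : ℂ) - 1‖ ≤ 2 * Real.pi / N := by
  have e : (ZMod.toCircle (1 : ZMod N) : ℂ) =
      Complex.exp (Complex.I * ((2 * Real.pi / N : ℝ) : ℂ)) := by
    have := ZMod.toCircle_intCast (N := N) 1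
    rw [Int.cast_one] at this
    rw [this]
    congr 1
    push_cast
    ring
  rw [e]
  refine Real.norm_exp_I_mul_ofReal_sub_one_le.trans (le_of_eq ?_)
  rw [Real.norm_of_nonneg (by positivity)]

/-- The grid point with given angular indices. -/
noncomputable def gridPoint (y : Fin d → ZMod N) : Fin d → Circle := fun i => ZMod.toCircle (y i)

/-- The Fourier coefficients of a Lipschitz function lie in the Sobolev space of order one: Bessel's
inequality is applied to increments over one grid step. -/
lemma sum_sq_mul_norm_sq_dcoef_le {n : ℕ} (hN : 4 * n < N) {L : ℝ} (hL : 0 ≤ L)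
    {F : (Fin d → Circle) → ℝ} (hF : ∀ z z', |F z - F z'| ≤ L * ∑ i, ‖(z i : ℂ) - z' i‖)
    (i : Fin d) :
    ∑ k ∈ freqBox d n, (k i : ℝ) ^ 2 * ‖dcoef (fun y => (F (gridPoint (N := N) y) : ℂ)) k‖ ^ 2 ≤
      3 * L ^ 2 := by
  classical
  have hN0 : (0 : ℝ) < N := by exact_mod_cast (by omega : 0 < N)
  set G : (Fin d → ZMod N) → ℂ := fun y => (F (gridPoint y) : ℂ) with hG
  set H : (Fin d → ZMod N) → ℂ := fun y => G (y + Pi.single i 1) - G y with hH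
  have hHc : ∀ k, dcoef H k = (ZMod.stdAddChar ((k i : ℤ) : ZMod N) - 1) * dcoef G k := by
    intro k
    rw [sub_mul, one_mul, ← dcoef_shift]
    simp only [dcoef, hH, sub_mul, Finset.sum_sub_distrib, mul_sub]
  have hHb : ∀ y, ‖H y‖ ≤ L * (2 * Real.pi / N) := by
    intro y
    simp only [hH, hG]
    rw [← Complex.ofReal_sub, Complex.norm_real, Real.norm_eq_abs]
    refine (hF _ _).trans (mul_le_mul_of_nonneg_left ?_ hL)
    rw [Finset.sum_eq_single i]
    · have : (gridPoint (y + Pi.single i 1) i : ℂ) - gridPoint y i =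
          (ZMod.toCircle (y i) : ℂ) * ((ZMod.toCircle (1 : ZMod N) : ℂ) - 1) := by
        simp only [gridPoint, Pi.add_apply, Pi.single_eq_same]
        rw [AddChar.map_add_eq_mul, Circle.coe_mul]
        ring
      rw [this, norm_mul, Circle.norm_coe, one_mul]
      exact norm_toCircle_one_sub_one_le
    · intro l _ hl
      simp [gridPoint, hl]
    · simp
  have h1 := sum_norm_sq_dcoef_le hN H
  have h2 : ((N : ℝ) ^ d)⁻¹ * ∑ y, ‖H y‖ ^ 2 ≤ (L * (2 * Real.pi / N)) ^ 2 := by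
    calc ((N : ℝ) ^ d)⁻¹ * ∑ y, ‖H y‖ ^ 2
        ≤ ((N : ℝ) ^ d)⁻¹ * ∑ y : Fin d → ZMod N, (L * (2 * Real.pi / N)) ^ 2 := by
          gcongr with y _
          exact hHb y
      _ = (L * (2 * Real.pi / N)) ^ 2 := by
          rw [Finset.sum_const, Finset.card_univ, Fintype.card_fun, ZMod.card, Fintype.card_fin,
            nsmul_eq_mul]
          push_cast
          field_simp
  have h3 : ∑ k ∈ freqBox d n, (4 / (N : ℝ)) ^ 2 * ((k i : ℝ) ^ 2 * ‖dcoef G k‖ ^ 2) ≤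
      ∑ k ∈ freqBox d n, ‖dcoef H k‖ ^ 2 := by
    refine Finset.sum_le_sum fun k hk => ?_
    rw [hHc, norm_mul, mul_pow, ← mul_assoc]
    refine mul_le_mul_of_nonneg_right ?_ (by positivity)
    have hb := abs_le_of_mem_freqBox hk i
    have := norm_stdAddChar_sub_one_ge (N := N) (by omega) (k := k i) (by omega)
    calc (4 / (N : ℝ)) ^ 2 * (k i : ℝ) ^ 2 = (4 * |(k i : ℝ)| / N) ^ 2 := by
          rw [div_pow, div_pow, mul_pow, sq_abs]; ring
      _ ≤ _ := pow_le_pow_left₀ (by positivity) this 2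
  rw [← Finset.mul_sum] at h3
  have h4 := h3.trans (h1.trans h2)
  have h5 : (L * (2 * Real.pi / N)) ^ 2 = (4 / (N : ℝ)) ^ 2 * (Real.pi ^ 2 / 4 * L ^ 2) := by
    field_simp; norm_num
  rw [h5] at h4
  refine (le_of_mul_le_mul_left h4 (by positivity)).trans ?_
  have : Real.pi ^ 2 / 4 ≤ 3 := by nlinarith [Real.pi_lt_d2, Real.pi_pos]
  exact mul_le_mul_of_nonneg_right this (sq_nonneg L)

/-- Jackson's theorem on the torus, with a Sobolev bound on the coefficients. -/
theorem exists_trigPoly_approx {n : ℕ} (hn : 1 ≤ n) {L : ℝ} (hL : 0 ≤ L)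
    {F : (Fin d → Circle) → ℝ} (hF : ∀ z z', |F z - F z'| ≤ L * ∑ i, ‖(z i : ℂ) - z' i‖) :
    ∃ a : (Fin d → ℤ) → ℂ,
      (∀ z, ‖(F z : ℂ) - ∑ k ∈ freqBox d n, a k * ∏ i, (z i : ℂ) ^ (k i)‖ ≤ L * (d * (3 / n))) ∧
      ∑ k ∈ freqBox d n, (∑ i, (k i : ℝ) ^ 2) * ‖a k‖ ^ 2 ≤ d * (3 * L ^ 2) := by
  classical
  have hN : 4 * n < 4 * n + 1 := by omega
  -- The smallest grid on which all the frequencies up to `2 n` are resolved.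
  set N := 4 * n + 1 with hNdef
  set G : (Fin d → ZMod N) → ℂ := fun y => (F (gridPoint y) : ℂ) with hG
  refine ⟨fun k => (∏ i, ((jcoef n (k i) : ℂ) / jcoef n 0)) * dcoef G k, fun z => ?_, ?_⟩
  · have hexp : ∑ k ∈ freqBox d n, (∏ i, ((jcoef n (k i) : ℂ) / jcoef n 0)) * dcoef G k *
        ∏ i, (z i : ℂ) ^ (k i) =
        ((∑ y, F (gridPoint y) * ∏ i, jweight n (z i) (y i : ZMod N) : ℝ) : ℂ) := by
      push_cast
      simp_rw [ofReal_jweight, Finset.prod_univ_sum, Finset.mul_sum]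
      rw [Finset.sum_comm]
      refine Finset.sum_congr rfl fun k _ => ?_
      rw [dcoef, ← mul_assoc, Finset.mul_sum, Finset.sum_mul]
      refine Finset.sum_congr rfl fun y _ => ?_
      simp only [Finset.prod_mul_distrib, Finset.prod_const, Finset.card_univ, Fintype.card_fin,
        hG, inv_pow]
      ring
    rw [hexp, ← Complex.ofReal_sub, Complex.norm_real, Real.norm_eq_abs]
    have hone : ∑ y : Fin d → ZMod N, ∏ i, jweight n (z i) (y i) = 1 := by
      rw [← Fintype.piFinset_univ, ← Finset.prod_univ_sum]
      simp [sum_jweight hn hN]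
    have hdiff : F z - ∑ y, F (gridPoint y) * ∏ i, jweight n (z i) (y i : ZMod N) =
        ∑ y, (F z - F (gridPoint y)) * ∏ i, jweight n (z i) (y i : ZMod N) := by
      simp_rw [sub_mul, Finset.sum_sub_distrib, ← Finset.mul_sum, hone, mul_one]
    rw [hdiff]
    -- The weights of the other coordinates sum to one.
    have hcoord : ∀ l : Fin d, ∑ y : Fin d → ZMod N,
        ‖(z l : ℂ) - gridPoint y l‖ * ∏ i, jweight n (z i) (y i) ≤ 3 / n := by
      intro l
      have e1 : ∀ y : Fin d → ZMod N, ‖(z l : ℂ) - gridPoint y l‖ * ∏ i, jweight n (z i) (y i) =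
          ∏ i, (jweight n (z i) (y i) *
            if i = l then ‖(z i : ℂ) - ZMod.toCircle (y i)‖ else 1) := by
        intro y
        rw [Finset.prod_mul_distrib, Finset.prod_ite_eq' Finset.univ l, if_pos (Finset.mem_univ _),
          mul_comm]
        rfl
      simp_rw [e1]
      rw [← Fintype.piFinset_univ, ← Finset.prod_univ_sum (fun _ => Finset.univ) fun i j =>
        jweight n (z i) j * if i = l then ‖(z i : ℂ) - ZMod.toCircle j‖ else 1]
      rw [Fintype.prod_eq_single l]
      · simpa using sum_jweight_mul_norm_sub_le hn hN (z l)
      · intro i hi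
        simp [hi, sum_jweight hn hN]
    calc |∑ y, (F z - F (gridPoint y)) * ∏ i, jweight n (z i) (y i : ZMod N)|
        ≤ ∑ y, (L * ∑ l, ‖(z l : ℂ) - gridPoint y l‖) * ∏ i, jweight n (z i) (y i : ZMod N) := by
          refine (Finset.abs_sum_le_sum_abs _ _).trans (Finset.sum_le_sum fun y _ => ?_)
          have h0 : 0 ≤ ∏ i, jweight n (z i) (y i : ZMod N) :=
            Finset.prod_nonneg fun i _ => jweight_nonneg _ _ _
          rw [abs_mul, abs_of_nonneg h0]
          exact mul_le_mul_of_nonneg_right (hF _ _) h0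
      _ = L * ∑ l, ∑ y : Fin d → ZMod N,
            ‖(z l : ℂ) - gridPoint y l‖ * ∏ i, jweight n (z i) (y i) := by
          rw [Finset.sum_comm, Finset.mul_sum]
          refine Finset.sum_congr rfl fun y _ => ?_
          rw [mul_assoc, Finset.sum_mul]
      _ ≤ L * ∑ l : Fin d, (3 / n : ℝ) := by
          gcongr with l _
          exact hcoord l
      _ = L * (d * (3 / n)) := by simp
  -- Smoothing by the Jackson kernel multiplies the coefficients by numbers in `[0, 1]`.
  · have hj : ∀ k ∈ freqBox d n, ‖∏ i, ((jcoef n (k i) : ℂ) / jcoef n 0)‖ ≤ 1 := by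
      intro k hk
      rw [norm_prod]
      refine Finset.prod_le_one (fun i _ => norm_nonneg _) fun i _ => ?_
      rw [norm_div, Complex.norm_natCast, Complex.norm_natCast]
      exact div_le_one_of_le₀ (jcoef_le n (Fintype.mem_piFinset.1 hk i)) (Nat.cast_nonneg _)
    calc ∑ k ∈ freqBox d n, (∑ i, (k i : ℝ) ^ 2) *
          ‖(∏ i, ((jcoef n (k i) : ℂ) / jcoef n 0)) * dcoef G k‖ ^ 2
        ≤ ∑ k ∈ freqBox d n, (∑ i, (k i : ℝ) ^ 2) * ‖dcoef G k‖ ^ 2 := by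
          refine Finset.sum_le_sum fun k hk => ?_
          refine mul_le_mul_of_nonneg_left ?_ (Finset.sum_nonneg fun i _ => sq_nonneg _)
          refine pow_le_pow_left₀ (norm_nonneg _) ?_ 2
          rw [norm_mul]
          exact mul_le_of_le_one_left (norm_nonneg _) (hj k hk)
      _ = ∑ i, ∑ k ∈ freqBox d n, (k i : ℝ) ^ 2 * ‖dcoef G k‖ ^ 2 := by
          simp_rw [Finset.sum_mul]
          rw [Finset.sum_comm]
      _ ≤ ∑ i : Fin d, 3 * L ^ 2 :=
          Finset.sum_le_sum fun i _ => sum_sq_mul_norm_sq_dcoef_le hN hL hF i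
      _ = d * (3 * L ^ 2) := by simp

end

/-! ### A deterministic bound for the Wasserstein distance -/

section

variable {d : ℕ}

/-- The inverse-square lattice sum is controlled by a sum over spheres of the sup norm. -/
lemma sum_inv_sq_freqBox_le (n : ℕ) :
    ∑ k ∈ (freqBox d n).erase 0, (∑ i, (k i : ℝ) ^ 2)⁻¹ ≤
      2 * d * 3 ^ (d - 1) * ∑ j ∈ Finset.Icc 1 (2 * n), (j : ℝ) ^ (d - 1) / (j : ℝ) ^ 2 := by
  classical
  -- `B i j` is the pair of faces of the sup-norm sphere of radius `j` orthogonal to the axis `i`.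
  let B : Fin d → ℕ → Finset (Fin d → ℤ) := fun i j =>
    Fintype.piFinset fun l => if l = i then {(j : ℤ), -(j : ℤ)} else Finset.Icc (-(j : ℤ)) j
  have hBcard : ∀ i, ∀ j ∈ Finset.Icc 1 (2 * n),
      ((B i j).card : ℝ) ≤ 2 * (3 * (j : ℝ)) ^ (d - 1) := by
    intro i j hj
    have hj1 : 1 ≤ j := (Finset.mem_Icc.1 hj).1
    have h1 : (B i j).card = 2 * (2 * j + 1) ^ (d - 1) := by
      rw [Fintype.card_piFinset, ← Finset.mul_prod_erase Finset.univ _ (Finset.mem_univ i)]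
      congr 1
      · rw [if_pos rfl, Finset.card_pair]
        omega
      · rw [Finset.prod_congr rfl (g := fun _ => 2 * j + 1), Finset.prod_const,
          Finset.card_erase_of_mem (Finset.mem_univ i), Finset.card_univ, Fintype.card_fin]
        intro l hl
        rw [if_neg (Finset.ne_of_mem_erase hl), Int.card_Icc]
        omega
    rw [h1]
    push_cast
    have hj' : (1 : ℝ) ≤ j := by exact_mod_cast hj1
    gcongr
    linarith
  have hpt : ∀ k ∈ (freqBox d n).erase 0, (∑ i, (k i : ℝ) ^ 2)⁻¹ ≤
      ∑ i, ∑ j ∈ Finset.Icc 1 (2 * n), if k ∈ B i j then ((j : ℝ) ^ 2)⁻¹ else 0 := by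
    intro k hk
    obtain ⟨hk0, hk⟩ := Finset.mem_erase.1 hk
    obtain ⟨i₀, hi₀⟩ := Function.ne_iff.1 hk0
    obtain ⟨i, -, hi⟩ := Finset.exists_max_image Finset.univ (fun i => (k i).natAbs)
      ⟨i₀, Finset.mem_univ _⟩
    have hi0 : 1 ≤ (k i).natAbs :=
      (Nat.one_le_iff_ne_zero.2 (Int.natAbs_ne_zero.2 hi₀)).trans (hi i₀ (Finset.mem_univ _))
    have hbd := abs_le_of_mem_freqBox hk i
    rw [Int.abs_eq_natAbs] at hbd
    have hmem : (k i).natAbs ∈ Finset.Icc 1 (2 * n) := Finset.mem_Icc.2 ⟨hi0, by omega⟩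
    have hkB : k ∈ B i (k i).natAbs := by
      refine Fintype.mem_piFinset.2 fun l => ?_
      by_cases hl : l = i
      · subst hl
        rw [if_pos rfl, Finset.mem_insert, Finset.mem_singleton]
        omega
      · rw [if_neg hl, Finset.mem_Icc]
        have := hi l (Finset.mem_univ _)
        omega
    have hterm : (∑ i, (k i : ℝ) ^ 2)⁻¹ ≤ (((k i).natAbs : ℝ) ^ 2)⁻¹ := by
      have hpos : (0 : ℝ) < ((k i).natAbs : ℝ) ^ 2 := by
        have : (0 : ℝ) < ((k i).natAbs : ℝ) := by exact_mod_cast hi0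
        positivity
      refine inv_anti₀ hpos ?_
      have e : ((k i).natAbs : ℝ) ^ 2 = (k i : ℝ) ^ 2 := by
        rw [Nat.cast_natAbs, Int.cast_abs, sq_abs]
      rw [e]
      exact Finset.single_le_sum (f := fun i => (k i : ℝ) ^ 2) (fun i _ => sq_nonneg _)
        (Finset.mem_univ i)
    refine hterm.trans ?_
    refine le_trans ?_ (Finset.single_le_sum (f := fun i => ∑ j ∈ Finset.Icc 1 (2 * n),
      if k ∈ B i j then ((j : ℝ) ^ 2)⁻¹ else 0) (fun i _ => Finset.sum_nonneg fun j _ => by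
        split_ifs <;> positivity) (Finset.mem_univ i))
    refine le_trans ?_ (Finset.single_le_sum (f := fun j : ℕ =>
      if k ∈ B i j then ((j : ℝ) ^ 2)⁻¹ else 0) (fun j _ => by split_ifs <;> positivity) hmem)
    simp only [if_pos hkB, le_refl]
  calc ∑ k ∈ (freqBox d n).erase 0, (∑ i, (k i : ℝ) ^ 2)⁻¹
      ≤ ∑ k ∈ (freqBox d n).erase 0, ∑ i, ∑ j ∈ Finset.Icc 1 (2 * n),
          (if k ∈ B i j then ((j : ℝ) ^ 2)⁻¹ else 0) := Finset.sum_le_sum hpt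
    _ = ∑ i, ∑ j ∈ Finset.Icc 1 (2 * n), ∑ k ∈ (freqBox d n).erase 0,
          (if k ∈ B i j then ((j : ℝ) ^ 2)⁻¹ else 0) := by
        rw [Finset.sum_comm]
        exact Finset.sum_congr rfl fun i _ => Finset.sum_comm
    _ ≤ ∑ i : Fin d, ∑ j ∈ Finset.Icc 1 (2 * n),
          2 * 3 ^ (d - 1) * ((j : ℝ) ^ (d - 1) / (j : ℝ) ^ 2) := by
        refine Finset.sum_le_sum fun i _ => Finset.sum_le_sum fun j hj => ?_
        rw [← Finset.sum_filter, Finset.sum_const, nsmul_eq_mul]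
        have h1 : ((((freqBox d n).erase 0).filter (· ∈ B i j)).card : ℝ) ≤ (B i j).card := by
          exact_mod_cast Finset.card_le_card fun k hk => (Finset.mem_filter.1 hk).2
        calc _ ≤ (2 * (3 * (j : ℝ)) ^ (d - 1)) * ((j : ℝ) ^ 2)⁻¹ :=
              mul_le_mul_of_nonneg_right (h1.trans (hBcard i j hj)) (by positivity)
          _ = _ := by rw [mul_pow]; ring
    _ = _ := by
        rw [Finset.sum_const, Finset.card_univ, Fintype.card_fin, nsmul_eq_mul, ← Finset.mul_sum]
        ring

/-- The point of the torus with angles `x i / (2 R)`. -/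
noncomputable def torusPoint (R : ℝ) (x : EuclideanSpace ℝ (Fin d)) : Fin d → Circle :=
  fun i => Circle.exp (x i / (2 * R))

/-- The frequency vector of the character of the torus with exponents `k`. -/
noncomputable def waveFreq (R : ℝ) (k : Fin d → ℤ) : EuclideanSpace ℝ (Fin d) :=
  WithLp.toLp 2 fun i => (k i : ℝ) / (2 * R)

lemma prod_torusPoint_zpow (R : ℝ) (x : EuclideanSpace ℝ (Fin d)) (k : Fin d → ℤ) :
    ∏ i, (torusPoint R x i : ℂ) ^ (k i) = waveChar (waveFreq R k) x := by
  rw [waveChar, PiLp.inner_apply]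
  simp only [torusPoint, Circle.coe_exp, waveFreq]
  simp_rw [← Complex.exp_int_mul]
  rw [← Complex.exp_sum]
  congr 1
  push_cast
  rw [Finset.sum_mul]
  refine Finset.sum_congr rfl fun i _ => ?_
  simp only [RCLike.inner_apply, conj_trivial]
  push_cast
  ring

lemma continuous_torusPoint (R : ℝ) : Continuous (torusPoint R : EuclideanSpace ℝ (Fin d) → _) := by
  refine continuous_pi fun i => Circle.exp.continuous.comp ?_
  fun_prop

lemma abs_sub_le_norm_circleExp_sub {a b : ℝ} (h : |a - b| ≤ Real.pi) :
    |a - b| ≤ Real.pi / 2 * ‖(Circle.exp a : ℂ) - Circle.exp b‖ := by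
  have e : (Circle.exp a : ℂ) - Circle.exp b =
      Complex.exp (b * Complex.I) * (Complex.exp (Complex.I * (a - b : ℝ)) - 1) := by
    rw [mul_sub, ← Complex.exp_add, mul_one, Circle.coe_exp, Circle.coe_exp]
    congr 2
    push_cast
    ring
  rw [e, norm_mul, Complex.norm_exp_ofReal_mul_I, one_mul, Complex.norm_exp_I_mul_ofReal_sub_one,
    norm_mul, Real.norm_two, Real.norm_eq_abs]
  have h1 := Real.mul_abs_le_abs_sin (x := (a - b) / 2) (by
    rw [abs_div, abs_two]; linarith)
  rw [abs_div, abs_two] at h1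
  have hpi := Real.pi_pos
  have h2 : Real.pi * (2 / Real.pi * (|a - b| / 2)) = |a - b| := by field_simp
  calc |a - b| = Real.pi * (2 / Real.pi * (|a - b| / 2)) := h2.symm
    _ ≤ Real.pi * |Real.sin ((a - b) / 2)| := mul_le_mul_of_nonneg_left h1 hpi.le
    _ = _ := by ring

lemma norm_le_sum_abs (x : EuclideanSpace ℝ (Fin d)) : ‖x‖ ≤ ∑ i, |x i| := by
  rw [EuclideanSpace.norm_eq]
  refine Real.sqrt_le_iff.2 ⟨Finset.sum_nonneg fun i _ => abs_nonneg _, ?_⟩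
  simp only [Real.norm_eq_abs]
  exact Finset.sum_sq_le_sq_sum_of_nonneg fun i _ => abs_nonneg _

/-- On the ball of radius `2 R` the map to the torus is injective with Lipschitz inverse. -/
lemma norm_sub_le_torusPoint {R : ℝ} (hR : 0 < R) {x y : EuclideanSpace ℝ (Fin d)}
    (hx : ‖x‖ ≤ 2 * R) (hy : ‖y‖ ≤ 2 * R) :
    ‖x - y‖ ≤ 4 * R * ∑ i, ‖(torusPoint R x i : ℂ) - torusPoint R y i‖ := by
  refine (norm_le_sum_abs _).trans ?_
  rw [Finset.mul_sum]
  refine Finset.sum_le_sum fun i _ => ?_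
  have hc : ∀ v : EuclideanSpace ℝ (Fin d), ‖v‖ ≤ 2 * R → |v i / (2 * R)| ≤ 1 := by
    intro v hv
    have h1 : |v i| ≤ ‖v‖ := by simpa using PiLp.norm_apply_le v i
    rw [abs_div, abs_of_pos (by positivity : 0 < 2 * R)]
    exact div_le_one_of_le₀ (h1.trans hv) (by positivity)
  have h1 : |x i / (2 * R) - y i / (2 * R)| ≤ 2 := by
    have := abs_sub (x i / (2 * R)) (y i / (2 * R))
    linarith [hc x hx, hc y hy]
  have h2 := abs_sub_le_norm_circleExp_sub (h1.trans (by linarith [Real.pi_gt_three]))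
  have e : |(x - y) i| = 2 * R * |x i / (2 * R) - y i / (2 * R)| := by
    rw [← sub_div, abs_div, abs_of_pos (by positivity : 0 < 2 * R)]
    field_simp
    simp
  rw [e]
  have h0 := norm_nonneg ((Circle.exp (x i / (2 * R)) : ℂ) - Circle.exp (y i / (2 * R)))
  calc 2 * R * |x i / (2 * R) - y i / (2 * R)|
      ≤ 2 * R * (Real.pi / 2 * ‖(Circle.exp (x i / (2 * R)) : ℂ) - Circle.exp (y i / (2 * R))‖) :=
        mul_le_mul_of_nonneg_left h2 (by positivity)
    _ ≤ 2 * R * (2 * ‖(Circle.exp (x i / (2 * R)) : ℂ) - Circle.exp (y i / (2 * R))‖) := by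
        gcongr
        linarith [Real.pi_le_four]
    _ = _ := by simp only [torusPoint]; ring

/-- A Lipschitz function on Euclidean space agrees on a ball with a Lipschitz function of the
torus. -/
lemma exists_torus_extension {R : ℝ} (hR : 0 < R) {f : EuclideanSpace ℝ (Fin d) → ℝ}
    (hf : LipschitzWith 1 f) :
    ∃ F : (Fin d → Circle) → ℝ,
      (∀ z z', |F z - F z'| ≤ 4 * R * d * ∑ i, ‖(z i : ℂ) - z' i‖) ∧
      ∀ x, ‖x‖ ≤ 2 * R → F (torusPoint R x) = f x := by
  classical
  set S : Set (EuclideanSpace ℝ (Fin d)) := {x | ‖x‖ ≤ 2 * R} with hS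
  have hS0 : (0 : EuclideanSpace ℝ (Fin d)) ∈ S := by simp [hS]; positivity
  have hK : ((Real.toNNReal (4 * R * d) : ℝ≥0) : ℝ) = 4 * R * d :=
    Real.coe_toNNReal _ (by positivity)
  have hsum : ∀ z z' : Fin d → Circle, ∑ i, ‖(z i : ℂ) - z' i‖ ≤ d * dist z z' := by
    intro z z'
    calc ∑ i, ‖(z i : ℂ) - z' i‖ ≤ ∑ i : Fin d, dist z z' := by
          refine Finset.sum_le_sum fun i _ => ?_
          rw [← dist_eq_norm]
          exact dist_le_pi_dist z z' i
      _ = d * dist z z' := by simp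
  have hfd : ∀ x y, |f x - f y| ≤ ‖x - y‖ := fun x y => by
    simpa [Real.dist_eq, dist_eq_norm] using hf.dist_le_mul x y
  have hinv : ∀ z ∈ torusPoint R '' S, Function.invFunOn (torusPoint R) S z ∈ S ∧
      torusPoint R (Function.invFunOn (torusPoint R) S z) = z := fun z hz =>
    ⟨Function.invFunOn_mem hz, Function.invFunOn_eq hz⟩
  have hlip : LipschitzOnWith (Real.toNNReal (4 * R * d))
      (fun z => f (Function.invFunOn (torusPoint R) S z)) (torusPoint R '' S) := by
    refine LipschitzOnWith.of_dist_le_mul fun z hz z' hz' => ?_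
    rw [Real.dist_eq]
    refine (hfd _ _).trans ((norm_sub_le_torusPoint hR (hinv z hz).1 (hinv z' hz').1).trans ?_)
    rw [(hinv z hz).2, (hinv z' hz').2]
    calc 4 * R * ∑ i, ‖(z i : ℂ) - z' i‖ ≤ 4 * R * (d * dist z z') :=
          mul_le_mul_of_nonneg_left (hsum z z') (by positivity)
      _ = _ := by rw [hK]; ring
  obtain ⟨F, hF, hFe⟩ := hlip.extend_real
  refine ⟨F, fun z z' => ?_, fun x hx => ?_⟩
  · have h1 := hF.dist_le_mul z z'
    rw [Real.dist_eq, hK] at h1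
    refine h1.trans (mul_le_mul_of_nonneg_left ?_ (by positivity))
    refine (dist_pi_le_iff (Finset.sum_nonneg fun i _ => norm_nonneg _)).2 fun i => ?_
    have : dist (z i) (z' i) = ‖(z i : ℂ) - z' i‖ := by rw [← dist_eq_norm]; rfl
    rw [this]
    exact Finset.single_le_sum (f := fun i => ‖(z i : ℂ) - z' i‖) (fun i _ => norm_nonneg _)
      (Finset.mem_univ i)
  · have hz : torusPoint R x ∈ torusPoint R '' S := ⟨x, hx, rfl⟩
    rw [← hFe hz]
    have h1 := norm_sub_le_torusPoint hR (hinv _ hz).1 hx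
    rw [(hinv _ hz).2] at h1
    simp only [sub_self, norm_zero, Finset.sum_const_zero, mul_zero] at h1
    show f (Function.invFunOn (torusPoint R) S (torusPoint R x)) = f x
    rw [sub_eq_zero.1 (norm_le_zero_iff.1 h1)]

/-- The part of the norm exceeding `R`. -/
noncomputable def excess {E : Type*} [Norm E] (R : ℝ) (x : E) : ℝ := max (‖x‖ - R) 0

lemma lipschitzWith_excess {E : Type*} [SeminormedAddCommGroup E] (R : ℝ) :
    LipschitzWith 1 (excess R : E → ℝ) := by
  have h1 : LipschitzWith 1 fun x : E => ‖x‖ - R := by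
    refine LipschitzWith.of_dist_le_mul fun x y => ?_
    rw [Real.dist_eq, NNReal.coe_one, one_mul, sub_sub_sub_cancel_right, dist_eq_norm]
    exact abs_norm_sub_norm_le x y
  exact h1.max_const 0

lemma excess_nonneg {E : Type*} [Norm E] (R : ℝ) (x : E) : 0 ≤ excess R x := le_max_right _ _

/-- The square of the distance of two measures in the homogeneous negative Sobolev norm of order one
of the torus, truncated to the frequencies at most `2 n`. -/
noncomputable def fourierDisc (R : ℝ) (n : ℕ) (μ ν : Measure (EuclideanSpace ℝ (Fin d))) : ℝ :=
  ∑ k ∈ (freqBox d n).erase 0, (∑ i, (k i : ℝ) ^ 2)⁻¹ *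
    ‖∫ x, waveChar (waveFreq R k) x ∂μ - ∫ x, waveChar (waveFreq R k) x ∂ν‖ ^ 2

lemma fourierDisc_nonneg (R : ℝ) (n : ℕ) (μ ν : Measure (EuclideanSpace ℝ (Fin d))) :
    0 ≤ fourierDisc R n μ ν :=
  Finset.sum_nonneg fun _ _ => mul_nonneg (inv_nonneg.2 (Finset.sum_nonneg fun _ _ => sq_nonneg _))
    (sq_nonneg _)

/-- Deterministic estimate of the Wasserstein distance: a tail, a smoothing error and a negative
Sobolev norm. -/
theorem W1_le_fourierDisc (hd : 1 ≤ d) {μ ν : Measure (EuclideanSpace ℝ (Fin d))} (hμ : IsP1 μ)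
    (hν : IsP1 ν) {R : ℝ} (hR : 0 < R) {n : ℕ} (hn : 1 ≤ n) :
    W1 μ ν ≤ ENNReal.ofReal (24 * d ^ 2 * (∫ x, excess R x ∂μ + ∫ x, excess R x ∂ν + R / n +
      R * Real.sqrt (fourierDisc R n μ ν))) := by
  classical
  have := hμ.isProb
  have := hν.isProb
  have hd' : (1 : ℝ) ≤ d := by exact_mod_cast hd
  refine W1_le_of_forall_lipschitz hμ hν fun f hf ⟨Kf, hKf⟩ => ?_
  obtain ⟨F, hF, hFf⟩ := exists_torus_extension hR hf
  set L : ℝ := 4 * R * d with hL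
  have hL0 : 0 ≤ L := by positivity
  obtain ⟨a, ha1, ha2⟩ := exists_trigPoly_approx hn hL0 hF
  set e : ℝ := L * (d * (3 / n)) with he
  have hfd : ∀ x y, |f x - f y| ≤ ‖x - y‖ := fun x y => by
    simpa [Real.dist_eq, dist_eq_norm] using hf.dist_le_mul x y
  have hFc : Continuous F := by
    have : LipschitzWith (Real.toNNReal (L * d)) F := by
      refine LipschitzWith.of_dist_le_mul fun z z' => ?_
      rw [Real.dist_eq, Real.coe_toNNReal _ (by positivity)]
      refine (hF z z').trans ?_
      calc L * ∑ i, ‖(z i : ℂ) - z' i‖ ≤ L * ∑ i : Fin d, dist z z' := by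
            refine mul_le_mul_of_nonneg_left (Finset.sum_le_sum fun i _ => ?_) hL0
            rw [← dist_eq_norm]
            exact dist_le_pi_dist z z' i
        _ = _ := by simp [mul_assoc]
    exact this.continuous
  set φ : EuclideanSpace ℝ (Fin d) → ℝ := fun x => F (torusPoint R x) with hφ
  have hφc : Continuous φ := hFc.comp (continuous_torusPoint R)
  have hosc : ∀ z z', |F z - F z'| ≤ L * (d * 2) := fun z z' => by
    refine (hF z z').trans (mul_le_mul_of_nonneg_left ?_ hL0)
    calc ∑ i, ‖(z i : ℂ) - z' i‖ ≤ ∑ i : Fin d, (2 : ℝ) := by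
          refine Finset.sum_le_sum fun i _ => (norm_sub_le _ _).trans ?_
          rw [Circle.norm_coe, Circle.norm_coe]
          norm_num
      _ = d * 2 := by simp
  -- `f` and `φ` agree on the ball of radius `2 R`; outside it, `‖x‖ ≤ 2 excess R x`.
  have htail : ∀ x, |f x - φ x| ≤ 24 * d ^ 2 * excess R x := by
    intro x
    rcases le_or_gt ‖x‖ (2 * R) with hx | hx
    · rw [hφ]
      simp only [hFf x hx, sub_self, abs_zero]
      exact mul_nonneg (by positivity) (excess_nonneg _ _)
    · have h1 : ‖x‖ ≤ 2 * excess R x := by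
        have := le_max_left (‖x‖ - R) 0
        rw [excess]
        linarith
      have h2 : φ 0 = f 0 := hFf 0 (by simp; positivity)
      have h3 := hfd x 0
      rw [sub_zero] at h3
      have h4 := hosc (torusPoint R 0) (torusPoint R x)
      have h5 : |f x - φ x| ≤ |f x - f 0| + |φ 0 - φ x| := by
        rw [h2]; exact abs_sub_le _ _ _
      have h6 : L * (d * 2) ≤ 4 * d ^ 2 * ‖x‖ := by
        rw [hL]
        have : (d : ℝ) ^ 2 * (2 * R) ≤ d ^ 2 * ‖x‖ :=
          mul_le_mul_of_nonneg_left hx.le (by positivity)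
        linarith
      have h7 : ‖x‖ ≤ d ^ 2 * ‖x‖ := le_mul_of_one_le_left (norm_nonneg _) (by nlinarith)
      calc |f x - φ x| ≤ ‖x‖ + 4 * d ^ 2 * ‖x‖ := by
            refine h5.trans (add_le_add h3 (h4.trans h6))
        _ ≤ 12 * d ^ 2 * ‖x‖ := by nlinarith
        _ ≤ 12 * d ^ 2 * (2 * excess R x) := mul_le_mul_of_nonneg_left h1 (by positivity)
        _ = _ := by ring
  have hfi : ∀ (ρ : Measure (EuclideanSpace ℝ (Fin d))) [IsProbabilityMeasure ρ], Integrable f ρ :=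
    fun ρ _ => Integrable.of_bound hf.continuous.aestronglyMeasurable Kf (ae_of_all _ hKf)
  have hφi : ∀ (ρ : Measure (EuclideanSpace ℝ (Fin d))) [IsProbabilityMeasure ρ],
      Integrable φ ρ := by
    intro ρ _
    refine Integrable.of_bound hφc.aestronglyMeasurable (|φ 0| + L * (d * 2))
      (ae_of_all _ fun x => ?_)
    have := hosc (torusPoint R x) (torusPoint R 0)
    have h2 := abs_sub_abs_le_abs_sub (φ x) (φ 0)
    rw [Real.norm_eq_abs]
    linarith
  have hcut : ∀ ρ : Measure (EuclideanSpace ℝ (Fin d)), IsP1 ρ →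
      |∫ x, f x ∂ρ - ∫ x, φ x ∂ρ| ≤ 24 * d ^ 2 * ∫ x, excess R x ∂ρ := by
    intro ρ hρ
    have := hρ.isProb
    rw [← integral_sub (hfi ρ) (hφi ρ), ← integral_const_mul, ← Real.norm_eq_abs]
    exact norm_integral_le_of_norm_le
      ((hρ.integrable_lipschitz (lipschitzWith_excess R)).const_mul _)
      (ae_of_all _ fun x => (Real.norm_eq_abs _).trans_le (htail x))
  set I : (Fin d → ℤ) → Measure (EuclideanSpace ℝ (Fin d)) → ℂ := fun k ρ =>
    ∫ x, waveChar (waveFreq R k) x ∂ρ with hI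
  have happrox : ∀ (ρ : Measure (EuclideanSpace ℝ (Fin d))) [IsProbabilityMeasure ρ],
      ‖((∫ x, φ x ∂ρ : ℝ) : ℂ) - ∑ k ∈ freqBox d n, a k * I k ρ‖ ≤ e := by
    intro ρ _
    have hi : ∀ k ∈ freqBox d n, Integrable (fun x => a k * waveChar (waveFreq R k) x) ρ :=
      fun k _ => (integrable_waveChar _ _).const_mul _
    have e1 : ∑ k ∈ freqBox d n, a k * I k ρ =
        ∫ x, ∑ k ∈ freqBox d n, a k * waveChar (waveFreq R k) x ∂ρ := by
      rw [integral_finsetSum _ hi]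
      exact Finset.sum_congr rfl fun k _ => (integral_const_mul _ _).symm
    have hφC : Integrable (fun x => ((φ x : ℝ) : ℂ)) ρ := (hφi ρ).ofReal
    rw [e1, ← integral_complex_ofReal, ← integral_sub hφC (integrable_finsetSum _ hi)]
    refine (norm_integral_le_of_norm_le_const (C := e) (ae_of_all _ fun x => ?_)).trans (by simp)
    have := ha1 (torusPoint R x)
    simp_rw [prod_torusPoint_zpow] at this
    exact this
  -- Both measures have mass one, so the zero frequency does not contribute.
  have hzero : ∀ (ρ : Measure (EuclideanSpace ℝ (Fin d))) [IsProbabilityMeasure ρ], I 0 ρ = 1 := by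
    intro ρ _
    have : ∀ x : EuclideanSpace ℝ (Fin d), waveChar (waveFreq R 0) x = 1 := fun x => by
      rw [← prod_torusPoint_zpow]; simp
    simp [hI, this]
  have hsob : ‖∑ k ∈ freqBox d n, a k * (I k μ - I k ν)‖ ≤
      3 * d * L * Real.sqrt (fourierDisc R n μ ν) := by
    have e1 : ∑ k ∈ freqBox d n, a k * (I k μ - I k ν) =
        ∑ k ∈ (freqBox d n).erase 0, a k * (I k μ - I k ν) := by
      rw [Finset.sum_erase]
      rw [hzero μ, hzero ν, sub_self, mul_zero]
    rw [e1]
    refine (norm_sum_le _ _).trans ?_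
    have hq : ∀ k ∈ (freqBox d n).erase 0, 0 < ∑ i, (k i : ℝ) ^ 2 := by
      intro k hk
      obtain ⟨i, hi⟩ := Function.ne_iff.1 (Finset.ne_of_mem_erase hk)
      refine Finset.sum_pos' (fun i _ => sq_nonneg _) ⟨i, Finset.mem_univ _, ?_⟩
      have : (k i : ℝ) ≠ 0 := by exact_mod_cast hi
      positivity
    -- Cauchy-Schwarz with the weights `|k|` and `|k|⁻¹`.
    have e2 : ∑ k ∈ (freqBox d n).erase 0, ‖a k * (I k μ - I k ν)‖ =
        ∑ k ∈ (freqBox d n).erase 0, (Real.sqrt (∑ i, (k i : ℝ) ^ 2) * ‖a k‖) *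
          ((Real.sqrt (∑ i, (k i : ℝ) ^ 2))⁻¹ * ‖I k μ - I k ν‖) := by
      refine Finset.sum_congr rfl fun k hk => ?_
      have := (Real.sqrt_pos.2 (hq k hk)).ne'
      rw [norm_mul]
      field_simp
    rw [e2]
    have hcs := Finset.sum_mul_sq_le_sq_mul_sq ((freqBox d n).erase 0)
      (fun k => Real.sqrt (∑ i, (k i : ℝ) ^ 2) * ‖a k‖)
      (fun k => (Real.sqrt (∑ i, (k i : ℝ) ^ 2))⁻¹ * ‖I k μ - I k ν‖)
    have e3 : ∑ k ∈ (freqBox d n).erase 0, (Real.sqrt (∑ i, (k i : ℝ) ^ 2) * ‖a k‖) ^ 2 ≤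
        d * (3 * L ^ 2) := by
      refine le_trans ?_ ha2
      refine le_trans (le_of_eq (Finset.sum_congr rfl fun k hk => ?_))
        (Finset.sum_le_sum_of_subset_of_nonneg (Finset.erase_subset _ _) fun k _ _ => by positivity)
      rw [mul_pow, Real.sq_sqrt (hq k hk).le]
    have e4 : ∑ k ∈ (freqBox d n).erase 0,
        ((Real.sqrt (∑ i, (k i : ℝ) ^ 2))⁻¹ * ‖I k μ - I k ν‖) ^ 2 = fourierDisc R n μ ν := by
      refine Finset.sum_congr rfl fun k hk => ?_
      rw [mul_pow, inv_pow, Real.sq_sqrt (hq k hk).le]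
    rw [e4] at hcs
    refine le_of_sq_le_sq ?_ (by positivity)
    refine hcs.trans ?_
    rw [mul_pow, Real.sq_sqrt (fourierDisc_nonneg _ _ _ _)]
    refine mul_le_mul_of_nonneg_right (e3.trans ?_) (fourierDisc_nonneg _ _ _ _)
    have : (d : ℝ) * (3 * L ^ 2) ≤ (3 * d * d) * (3 * L ^ 2) :=
      mul_le_mul_of_nonneg_right (by nlinarith) (by positivity)
    nlinarith
  have hmid : |∫ x, φ x ∂μ - ∫ x, φ x ∂ν| ≤
      2 * e + 3 * d * L * Real.sqrt (fourierDisc R n μ ν) := by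
    have h1 := happrox μ
    have h2 := happrox ν
    have e5 : ((∫ x, φ x ∂μ - ∫ x, φ x ∂ν : ℝ) : ℂ) =
        (((∫ x, φ x ∂μ : ℝ) : ℂ) - ∑ k ∈ freqBox d n, a k * I k μ) -
        (((∫ x, φ x ∂ν : ℝ) : ℂ) - ∑ k ∈ freqBox d n, a k * I k ν) +
        ∑ k ∈ freqBox d n, a k * (I k μ - I k ν) := by
      simp_rw [mul_sub, Finset.sum_sub_distrib]
      push_cast
      ring
    rw [← Real.norm_eq_abs, ← Complex.norm_real, e5]
    refine (norm_add_le _ _).trans (add_le_add ((norm_sub_le _ _).trans ?_) hsob)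
    linarith
  have c1 := abs_le.1 (hcut μ hμ)
  have c2 := abs_le.1 (hcut ν hν)
  have c3 := (abs_le.1 hmid).2
  have e6 : 2 * e = 24 * d ^ 2 * (R / n) := by rw [he, hL]; ring
  have e7 : 3 * d * L * Real.sqrt (fourierDisc R n μ ν) ≤
      24 * d ^ 2 * (R * Real.sqrt (fourierDisc R n μ ν)) := by
    rw [hL]
    have : 0 ≤ (d : ℝ) ^ 2 * (R * Real.sqrt (fourierDisc R n μ ν)) := by positivity
    nlinarith
  have e8 : ∀ A B C D' : ℝ, 24 * (d : ℝ) ^ 2 * (A + B + C + D') =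
      24 * d ^ 2 * A + 24 * d ^ 2 * B + 24 * d ^ 2 * C + 24 * d ^ 2 * D' := fun A B C D' => by ring
  rw [e8]
  linarith [c1.2, c2.1]

end

/-! ### Asymptotics of the rate -/

section

lemma eventually_rate_le_one {d : ℕ} (hd : 1 ≤ d) : ∀ᶠ τ in atTop, rate d τ ≤ 1 := by
  have key : ∀ r s : ℝ, 0 < s → ∀ᶠ τ : ℝ in atTop, Real.log τ ^ r / τ ^ s ≤ 1 := by
    intro r s hs
    filter_upwards [(isLittleO_log_rpow_rpow_atTop r hs).bound one_pos, eventually_gt_atTop 0]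
      with τ h1 h0
    rw [one_mul, Real.norm_eq_abs, Real.norm_of_nonneg (Real.rpow_nonneg h0.le _)] at h1
    exact div_le_one_of_le₀ ((le_abs_self _).trans h1) (Real.rpow_nonneg h0.le _)
  unfold rate
  split_ifs with h1 h2
  · filter_upwards [key 1 1 one_pos] with τ h
    rw [Real.rpow_one, Real.rpow_one] at h
    exact Real.sqrt_le_one.2 h
  · filter_upwards [key 1 (1 / 2) (by norm_num)] with τ h
    rwa [Real.rpow_one, ← Real.sqrt_eq_rpow] at h
  · exact key _ _ (by have : (0 : ℝ) < d := by exact_mod_cast hd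
                      positivity)

lemma rpow_neg_inv_le_rate {d : ℕ} (hd : 1 ≤ d) {τ : ℝ} (hτ : Real.exp 1 ≤ τ) :
    τ ^ (-(1 / (d : ℝ))) ≤ rate d τ := by
  have h1 : 1 ≤ τ := (Real.one_le_exp zero_le_one).trans hτ
  have h0 : 0 < τ := one_pos.trans_le h1
  have hl : 1 ≤ Real.log τ := (Real.le_log_iff_exp_le h0).2 hτ
  rw [Real.rpow_neg h0.le, ← one_div]
  unfold rate
  split_ifs with hd1 hd2
  · subst hd1
    refine Real.le_sqrt_of_sq_le ?_
    rw [Nat.cast_one, div_one, Real.rpow_one, div_pow, one_pow]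
    refine div_le_div₀ (by linarith) hl h0 ?_
    nlinarith
  · subst hd2
    rw [Nat.cast_ofNat, ← Real.sqrt_eq_rpow]
    gcongr
  · have hd3 : (3 : ℝ) ≤ d := by exact_mod_cast (by omega : 3 ≤ d)
    have := Real.one_le_rpow hl (z := (d : ℝ) - 2 + 1 / d) (by
      have : (0 : ℝ) < 1 / d := by positivity
      linarith)
    gcongr

/-- The truncated negative Sobolev weights, at the frequency of order `τ ^ (1 / d)`, are compatible
with the rate. -/
lemma sum_pow_div_sq_mul_log_le {d : ℕ} (hd : 1 ≤ d) {τ : ℝ} (hτ : Real.exp 1 ≤ τ) {n : ℕ}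
    (hn1 : 1 ≤ n) (hn : (n : ℝ) ≤ 2 * τ ^ (1 / (d : ℝ))) :
    (∑ j ∈ Finset.Icc 1 (2 * n), (j : ℝ) ^ (d - 1) / (j : ℝ) ^ 2) * (Real.log τ / τ) ≤
      4 ^ d * rate d τ ^ 2 := by
  have h1 : 1 ≤ τ := (Real.one_le_exp zero_le_one).trans hτ
  have h0 : 0 < τ := one_pos.trans_le h1
  have hl : 1 ≤ Real.log τ := (Real.le_log_iff_exp_le h0).2 hτ
  have hlτ : 0 ≤ Real.log τ / τ := by positivity
  unfold rate
  split_ifs with hd1 hd2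
  · subst hd1
    rw [Real.sq_sqrt hlτ]
    refine mul_le_mul_of_nonneg_right ?_ hlτ
    have h := sum_Ioo_inv_sq_le (α := ℝ) 0 (2 * n + 1)
    have e : Finset.Ioo 0 (2 * n + 1) = Finset.Icc 1 (2 * n) := by
      ext j; simp only [Finset.mem_Ioo, Finset.mem_Icc]; omega
    rw [e] at h
    simp only [tsub_self, pow_zero, one_div]
    refine h.trans ?_
    norm_num
  · subst hd2
    have hsum : ∑ j ∈ Finset.Icc 1 (2 * n), (j : ℝ) ^ (2 - 1) / (j : ℝ) ^ 2 ≤ 4 * Real.log τ := by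
      have h := harmonic_le_one_add_log (2 * n)
      rw [harmonic_eq_sum_Icc] at h
      push_cast at h
      have e : ∑ j ∈ Finset.Icc 1 (2 * n), (j : ℝ) ^ (2 - 1) / (j : ℝ) ^ 2 =
          ∑ j ∈ Finset.Icc 1 (2 * n), (j : ℝ)⁻¹ := by
        refine Finset.sum_congr rfl fun j hj => ?_
        have : (j : ℝ) ≠ 0 := by
          have := (Finset.mem_Icc.1 hj).1
          exact_mod_cast (by omega : j ≠ 0)
        rw [show 2 - 1 = 1 from rfl]
        field_simp
      rw [e]
      refine h.trans ?_
      have hn' : (n : ℝ) ≤ 2 * τ := by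
        refine hn.trans (mul_le_mul_of_nonneg_left ?_ zero_le_two)
        calc τ ^ (1 / ((2 : ℕ) : ℝ)) ≤ τ ^ (1 : ℝ) :=
              Real.rpow_le_rpow_of_exponent_le h1 (by norm_num)
          _ = τ := Real.rpow_one τ
      have hnpos : (0 : ℝ) < n := by exact_mod_cast hn1
      have hlog : Real.log (2 * n) ≤ Real.log (2 * 2) + Real.log τ := by
        rw [← Real.log_mul (by norm_num) h0.ne']
        exact Real.log_le_log (by positivity) (by linarith)
      rw [Real.log_mul two_ne_zero two_ne_zero] at hlog
      linarith [Real.log_two_lt_d9]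
    rw [div_pow, Real.sq_sqrt h0.le]
    calc _ ≤ 4 * Real.log τ * (Real.log τ / τ) := mul_le_mul_of_nonneg_right hsum hlτ
      _ = 4 * (Real.log τ ^ 2 / τ) := by ring
      _ ≤ 4 ^ 2 * (Real.log τ ^ 2 / τ) := by
        refine mul_le_mul_of_nonneg_right (by norm_num) (by positivity)
  -- The sum is of order `n ^ (d - 2)`, which is `τ / (τ ^ (1 / d)) ^ 2`; the exponent of the
  -- logarithm in the rate is at least one, so that the remaining factor `log τ` is absorbed.
  · have hd3 : 3 ≤ d := by omega
    have hd3' : (3 : ℝ) ≤ d := by exact_mod_cast hd3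
    obtain ⟨m, rfl⟩ : ∃ m, d = m + 3 := ⟨d - 3, by omega⟩
    have hsum : ∑ j ∈ Finset.Icc 1 (2 * n), (j : ℝ) ^ (m + 3 - 1) / (j : ℝ) ^ 2 ≤
        (2 * n : ℝ) ^ (m + 1) := by
      calc ∑ j ∈ Finset.Icc 1 (2 * n), (j : ℝ) ^ (m + 3 - 1) / (j : ℝ) ^ 2
          ≤ ∑ j ∈ Finset.Icc 1 (2 * n), (2 * n : ℝ) ^ m := by
            refine Finset.sum_le_sum fun j hj => ?_
            obtain ⟨hj1, hj2⟩ := Finset.mem_Icc.1 hj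
            have hj0 : (j : ℝ) ≠ 0 := by exact_mod_cast (by omega : j ≠ 0)
            have hj3 : (j : ℝ) ≤ 2 * n := by exact_mod_cast hj2
            rw [show m + 3 - 1 = m + 2 from rfl, pow_add, mul_div_assoc,
              div_self (pow_ne_zero _ hj0), mul_one]
            gcongr
        _ = _ := by
            rw [Finset.sum_const, Nat.card_Icc, nsmul_eq_mul, Nat.add_sub_cancel]
            push_cast
            ring
    set x := τ ^ (1 / ((m + 3 : ℕ) : ℝ)) with hx
    have hx0 : 0 < x := Real.rpow_pos_of_pos h0 _
    have hxd : x ^ (m + 3) = τ := by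
      rw [hx, ← Real.rpow_natCast, ← Real.rpow_mul h0.le, one_div,
        inv_mul_cancel₀ (by positivity), Real.rpow_one]
    have hpow : (2 * n : ℝ) ^ (m + 1) ≤ 4 ^ (m + 3) * x ^ (m + 1) := by
      calc (2 * n : ℝ) ^ (m + 1) ≤ (4 * x) ^ (m + 1) := by
            refine pow_le_pow_left₀ (by positivity) ?_ _
            linarith
        _ = 4 ^ (m + 1) * x ^ (m + 1) := mul_pow _ _ _
        _ ≤ _ := by
            gcongr
            · norm_num
            · norm_num
    have hlr : Real.log τ ≤ (Real.log τ ^ (((m + 3 : ℕ) : ℝ) - 2 + 1 / ((m + 3 : ℕ) : ℝ))) ^ 2 := by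
      have h2 : Real.log τ ≤ Real.log τ ^ (((m + 3 : ℕ) : ℝ) - 2 + 1 / ((m + 3 : ℕ) : ℝ)) :=
        Real.self_le_rpow_of_one_le hl (by
          have : (0 : ℝ) < 1 / ((m + 3 : ℕ) : ℝ) := by positivity
          linarith)
      nlinarith
    rw [div_pow]
    calc _ ≤ 4 ^ (m + 3) * x ^ (m + 1) * (Real.log τ / τ) :=
          mul_le_mul_of_nonneg_right (hsum.trans hpow) hlτ
      _ = 4 ^ (m + 3) * (Real.log τ / x ^ 2) := by
          rw [← hxd]
          field_simp
          ring
      _ ≤ _ := by gcongr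

end

/-! ### The empirical measure of a Markov process -/

section

variable {d : ℕ} {Ω : Type*} {mΩ : MeasurableSpace Ω} {Pr : Measure Ω} [IsProbabilityMeasure Pr]

/-- Markov's inequality for the tail above a level `R` that is a multiple of the `L ^ q` bound. -/
lemma lintegral_excess_le {E : Type*} [NormedAddCommGroup E] {f : Ω → E} {q : ℝ≥0∞} (hq : 1 < q)
    {M : ℝ} (hM : 0 < M) (hf : eLpNorm f q Pr ≤ ENNReal.ofReal M) {ρ : ℝ} (hρ : 0 < ρ) :
    ∫⁻ ω, ENNReal.ofReal (excess (M * ρ ^ (-(1 / q).toReal)) (f ω)) ∂Pr ≤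
      ENNReal.ofReal (M * ρ ^ (1 - (1 / q).toReal)) := by
  rcases eq_or_ne q ∞ with rfl | hq'
  · rw [eLpNorm_exponent_top] at hf
    have h0 : ∀ᵐ ω ∂Pr, ENNReal.ofReal (excess (M * ρ ^ (-(1 / (∞ : ℝ≥0∞)).toReal)) (f ω)) = 0 := by
      filter_upwards [ae_le_eLpNormEssSup (f := f) (μ := Pr)] with ω hω
      have h1 : ‖f ω‖ ≤ M := by
        rw [← ENNReal.ofReal_le_ofReal_iff hM.le, ofReal_norm]
        exact hω.trans hf
      simp only [one_div, ENNReal.inv_top, ENNReal.toReal_zero, neg_zero, Real.rpow_zero, mul_one]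
      rw [excess, max_eq_right (by linarith), ENNReal.ofReal_zero]
    rw [lintegral_congr_ae h0, lintegral_zero]
    exact zero_le
  have hq0 : q ≠ 0 := (zero_lt_one.trans hq).ne'
  set p := q.toReal with hp
  have hp1 : 1 < p := by
    rw [hp, ← ENNReal.toReal_one]
    exact (ENNReal.toReal_lt_toReal ENNReal.one_ne_top hq').2 hq
  have hp0 : 0 < p := by linarith
  have hinv : (1 / q).toReal = 1 / p := by rw [ENNReal.toReal_div, ENNReal.toReal_one]
  rw [hinv]
  set R := M * ρ ^ (-(1 / p)) with hR
  have hR0 : 0 < R := mul_pos hM (Real.rpow_pos_of_pos hρ _)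
  have hpt : ∀ ω, ENNReal.ofReal (excess R (f ω)) ≤ ENNReal.ofReal (R ^ (1 - p)) * ‖f ω‖ₑ ^ p := by
    intro ω
    rw [← ofReal_norm, ENNReal.ofReal_rpow_of_nonneg (norm_nonneg _) hp0.le,
      ← ENNReal.ofReal_mul (Real.rpow_nonneg hR0.le _)]
    refine ENNReal.ofReal_le_ofReal (max_le ?_ (by positivity))
    rcases le_or_gt ‖f ω‖ R with h | h
    · have : 0 ≤ R ^ (1 - p) * ‖f ω‖ ^ p := by positivity
      linarith
    · have hf0 : 0 < ‖f ω‖ := hR0.trans h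
      calc ‖f ω‖ - R ≤ ‖f ω‖ := by linarith
        _ = ‖f ω‖ ^ (1 - p) * ‖f ω‖ ^ p := by
            rw [← Real.rpow_add hf0, sub_add_cancel, Real.rpow_one]
        _ ≤ R ^ (1 - p) * ‖f ω‖ ^ p := by
            refine mul_le_mul_of_nonneg_right ?_ (by positivity)
            exact Real.rpow_le_rpow_of_nonpos hR0 h.le (by linarith)
  have hmom : ∫⁻ ω, ‖f ω‖ₑ ^ p ∂Pr ≤ ENNReal.ofReal (M ^ p) := by
    rw [eLpNorm_eq_lintegral_rpow_enorm_toReal hq0 hq', ← hp, one_div,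
      ENNReal.rpow_inv_le_iff hp0, ENNReal.ofReal_rpow_of_nonneg hM.le hp0.le] at hf
    exact hf
  calc _ ≤ ∫⁻ ω, ENNReal.ofReal (R ^ (1 - p)) * ‖f ω‖ₑ ^ p ∂Pr := lintegral_mono hpt
    _ = ENNReal.ofReal (R ^ (1 - p)) * ∫⁻ ω, ‖f ω‖ₑ ^ p ∂Pr :=
        lintegral_const_mul' _ _ ENNReal.ofReal_ne_top
    _ ≤ ENNReal.ofReal (R ^ (1 - p)) * ENNReal.ofReal (M ^ p) := by gcongr
    _ = _ := by
        rw [← ENNReal.ofReal_mul (Real.rpow_nonneg hR0.le _), hR,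
          Real.mul_rpow hM.le (Real.rpow_nonneg hρ.le _), ← Real.rpow_mul hρ.le]
        congr 1
        have e1 : M ^ (1 - p) * M ^ p = M := by
          rw [← Real.rpow_add hM, sub_add_cancel, Real.rpow_one]
        have e2 : -(1 / p) * (1 - p) = 1 - 1 / p := by
          field_simp
          ring
        rw [e2]
        linear_combination (ρ ^ (1 - 1 / p)) * e1

lemma norm_waveFreq_le {R : ℝ} (hR : 0 < R) {n : ℕ} {k : Fin d → ℤ} (hk : k ∈ freqBox d n) :
    ‖waveFreq R k‖ ≤ d * n / R := by
  refine (norm_le_sum_abs _).trans ?_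
  calc ∑ i, |waveFreq R k i| ≤ ∑ i : Fin d, (n / R : ℝ) := by
        refine Finset.sum_le_sum fun i _ => ?_
        have h1 : |(k i : ℝ)| ≤ 2 * n := by exact_mod_cast abs_le_of_mem_freqBox hk i
        rw [show waveFreq R k i = (k i : ℝ) / (2 * R) from rfl, abs_div,
          abs_of_pos (by positivity : 0 < 2 * R), div_le_div_iff₀ (by positivity) hR]
        nlinarith
    _ = d * n / R := by
        rw [Finset.sum_const, Finset.card_univ, Fintype.card_fin, nsmul_eq_mul, mul_div_assoc]

variable {ℱ : Filtration ℝ≥0 mΩ} {Y : ℝ≥0 → Ω → EuclideanSpace ℝ (Fin d)}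
  {P : ℝ≥0 → Kernel (EuclideanSpace ℝ (Fin d)) (EuclideanSpace ℝ (Fin d))} {D c M : ℝ}

lemma measurable_integral_weightedEmpirical (hY : Measurable (Function.uncurry Y))
    (w : WeightFamily) (t : ℝ≥0) {g : EuclideanSpace ℝ (Fin d) → ℂ} (hg : Continuous g) :
    Measurable fun ω => ∫ x, g x ∂(weightedEmpirical Y w t ω) := by
  simp_rw [integral_weightedEmpirical hY w t _ hg]
  exact ((hg.measurable.comp
    (measurable_path hY t)).stronglyMeasurable.integral_prod_right').measurable

lemma lintegral_lintegral_weightedEmpirical_le (hY : Measurable (Function.uncurry Y))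
    (w : WeightFamily) (t : ℝ≥0) {g : EuclideanSpace ℝ (Fin d) → ℝ≥0∞} (hg : Measurable g)
    {H : ℝ≥0∞} (hH : ∀ s, ∫⁻ ω, g (Y s ω) ∂Pr ≤ H) :
    ∫⁻ ω, ∫⁻ x, g x ∂(weightedEmpirical Y w t ω) ∂Pr ≤ H := by
  have e : ∀ ω, ∫⁻ x, g x ∂(weightedEmpirical Y w t ω) =
      ∫⁻ s, g (Y (t * unitInterval.toNNReal s) ω) ∂(w t : Measure unitInterval) := fun ω =>
    lintegral_map hg (measurable_path_right hY t ω)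
  simp_rw [e]
  have hm : Measurable (Function.uncurry fun ω (s : unitInterval) =>
      g (Y (t * unitInterval.toNNReal s) ω)) := hg.comp (measurable_path hY t)
  rw [lintegral_lintegral_swap hm.aemeasurable]
  calc _ ≤ ∫⁻ _, H ∂(w t : Measure unitInterval) := lintegral_mono fun s => hH _
    _ = H := by simp

lemma measurable_lintegral_weightedEmpirical (hY : Measurable (Function.uncurry Y))
    (w : WeightFamily) (t : ℝ≥0) {g : EuclideanSpace ℝ (Fin d) → ℝ≥0∞} (hg : Measurable g) :
    Measurable fun ω => ∫⁻ x, g x ∂(weightedEmpirical Y w t ω) := by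
  have e : ∀ ω, ∫⁻ x, g x ∂(weightedEmpirical Y w t ω) =
      ∫⁻ s, g (Y (t * unitInterval.toNNReal s) ω) ∂(w t : Measure unitInterval) := fun ω =>
    lintegral_map hg (measurable_path_right hY t ω)
  simp_rw [e]
  exact (hg.comp (measurable_path hY t)).lintegral_prod_right'

lemma ae_isP1_weightedEmpirical (hY : Measurable (Function.uncurry Y))
    (hYM : ∀ t, ∫⁻ ω, ‖Y t ω‖ₑ ∂Pr ≤ ENNReal.ofReal M) (w : WeightFamily) (t : ℝ≥0) :
    ∀ᵐ ω ∂Pr, IsP1 (weightedEmpirical Y w t ω) := by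
  have h := lintegral_lintegral_weightedEmpirical_le hY w t measurable_enorm hYM
  filter_upwards [ae_lt_top (measurable_lintegral_weightedEmpirical hY w t measurable_enorm)
    (h.trans_lt ENNReal.ofReal_lt_top).ne] with ω hω
  have : IsProbabilityMeasure (weightedEmpirical Y w t ω) :=
    Measure.isProbabilityMeasure_map (measurable_path_right hY t ω).aemeasurable
  exact isP1_iff_lintegral_enorm.2 hω

/-- The mean negative Sobolev discrepancy between the empirical and the invariant measure. -/
lemma lintegral_fourierDisc_weightedEmpirical_le (h : IsMarkovProcess Y P ℱ Pr)
    (hY : Measurable (Function.uncurry Y)) (hcontr : IsExpContractive P D c) (hc : 0 < c)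
    (hD : 0 ≤ D) (hM : 0 ≤ M) (hYM : ∀ t, ∫⁻ ω, ‖Y t ω‖ₑ ∂Pr ≤ ENNReal.ofReal M)
    {μ : Measure (EuclideanSpace ℝ (Fin d))} (hμ : IsInvariantP1 P μ)
    (hμM : ∫⁻ x, ‖x‖ₑ ∂μ ≤ ENNReal.ofReal M)
    {ε : ℝ} (hε : 0 < ε) (hε1 : ε ≤ 1) {w : WeightFamily} {t : ℝ≥0} (ht : 0 < t) {K : ℝ}
    (hK0 : 0 ≤ K)
    (hK : ∫⁻ s₁ : unitInterval, ∫⁻ s₂ : unitInterval,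
      min ((t : ℝ≥0∞) ^ ε) (ENNReal.ofReal |(s₁ : ℝ) - (s₂ : ℝ)| ^ (-ε))
        ∂(w t : Measure unitInterval) ∂(w t : Measure unitInterval) ≤ ENNReal.ofReal K)
    {R : ℝ} (hR : 0 < R) {n : ℕ} {ℓ : ℝ} (hℓ : 1 ≤ ℓ) (hA : d * n / R * D * M ≤ Real.exp ℓ) :
    ∫⁻ ω, ENNReal.ofReal (fourierDisc R n (weightedEmpirical Y w t ω) μ) ∂Pr ≤
      ENNReal.ofReal ((∑ k ∈ (freqBox d n).erase 0, (∑ i, (k i : ℝ) ^ 2)⁻¹) *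
        (4 * ((1 + 2 / c) * ℓ / (t : ℝ) ^ ε) * K)) := by
  have hw0 : ∀ k : Fin d → ℤ, 0 ≤ (∑ i, (k i : ℝ) ^ 2)⁻¹ := fun k =>
    inv_nonneg.2 (Finset.sum_nonneg fun i _ => sq_nonneg _)
  have e : ∀ ω, ENNReal.ofReal (fourierDisc R n (weightedEmpirical Y w t ω) μ) =
      ∑ k ∈ (freqBox d n).erase 0, ENNReal.ofReal (∑ i, (k i : ℝ) ^ 2)⁻¹ *
        ‖∫ x, waveChar (waveFreq R k) x ∂(weightedEmpirical Y w t ω) -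
          ∫ x, waveChar (waveFreq R k) x ∂μ‖ₑ ^ 2 := by
    intro ω
    rw [fourierDisc, ENNReal.ofReal_sum_of_nonneg fun k _ => mul_nonneg (hw0 k) (sq_nonneg _)]
    refine Finset.sum_congr rfl fun k _ => ?_
    rw [ENNReal.ofReal_mul (hw0 k), ENNReal.ofReal_pow (norm_nonneg _), ofReal_norm]
  have hwc : ∀ k : Fin d → ℤ, Continuous (waveChar (waveFreq R k)) := fun k =>
    (lipschitzWith_waveChar _).continuous
  simp_rw [e]
  rw [lintegral_finsetSum _ fun k _ => (((measurable_integral_weightedEmpirical hY w t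
    (hwc k)).sub_const _).enorm.pow_const 2).const_mul _]
  rw [Finset.sum_mul, ENNReal.ofReal_sum_of_nonneg fun k _ => mul_nonneg (hw0 k) (by positivity)]
  refine Finset.sum_le_sum fun k hk => ?_
  rw [lintegral_const_mul' _ _ ENNReal.ofReal_ne_top, ENNReal.ofReal_mul (hw0 k)]
  gcongr
  refine lintegral_enorm_sq_weightedEmpirical_le h hY hcontr hc hD hM hYM hμ hμM
    (lipschitzWith_waveChar _) (fun x => (norm_waveChar _ _).le) hε hε1 ht hK hℓ (le_trans ?_ hA)
  rw [coe_nnnorm]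
  have := norm_waveFreq_le hR (Finset.mem_of_mem_erase hk)
  gcongr

/-- The mean Wasserstein distance, before the choice of the level `R` and of the frequency `n`. -/
lemma lintegral_W1_weightedEmpirical_le (hd : 1 ≤ d)
    (hY : Measurable (Function.uncurry Y))
    (hYM : ∀ t, ∫⁻ ω, ‖Y t ω‖ₑ ∂Pr ≤ ENNReal.ofReal M)
    {μ : Measure (EuclideanSpace ℝ (Fin d))} (hμ : IsP1 μ)
    (w : WeightFamily) (t : ℝ≥0) {R H a : ℝ} (hR : 0 < R) (ha : 0 < a) (hH0 : 0 ≤ H)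
    (hHY : ∀ s, ∫⁻ ω, ENNReal.ofReal (excess R (Y s ω)) ∂Pr ≤ ENNReal.ofReal H)
    (hHμ : ∫ x, excess R x ∂μ ≤ H) {n : ℕ} (hn : 1 ≤ n)
    (hdisc : ∫⁻ ω, ENNReal.ofReal (fourierDisc R n (weightedEmpirical Y w t ω) μ) ∂Pr ≤
      ENNReal.ofReal (a ^ 2)) :
    ∫⁻ ω, W1 (weightedEmpirical Y w t ω) μ ∂Pr ≤
      ENNReal.ofReal (24 * d ^ 2 * (2 * H + R / n + R * a)) := by
  have hxm : Measurable fun x : EuclideanSpace ℝ (Fin d) => ENNReal.ofReal (excess R x) :=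
    (lipschitzWith_excess R).continuous.measurable.ennreal_ofReal
  have hC : (0 : ℝ) ≤ 24 * d ^ 2 := by positivity
  -- The square root is removed by `√x ≤ a / 2 + x / (2 a)`.
  have hpt : ∀ᵐ ω ∂Pr, W1 (weightedEmpirical Y w t ω) μ ≤ ENNReal.ofReal (24 * d ^ 2) *
      (∫⁻ x, ENNReal.ofReal (excess R x) ∂(weightedEmpirical Y w t ω) +
        (ENNReal.ofReal (H + R / n + R * (a / 2)) + ENNReal.ofReal (R / (2 * a)) *
          ENNReal.ofReal (fourierDisc R n (weightedEmpirical Y w t ω) μ))) := by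
    filter_upwards [ae_isP1_weightedEmpirical hY hYM w t] with ω hω
    refine (W1_le_fourierDisc hd hω hμ hR hn).trans ?_
    have hF := fourierDisc_nonneg R n (weightedEmpirical Y w t ω) μ
    set F := fourierDisc R n (weightedEmpirical Y w t ω) μ
    rw [ENNReal.ofReal_mul hC]
    gcongr
    rw [← ofReal_integral_eq_lintegral_ofReal (hω.integrable_lipschitz (lipschitzWith_excess R))
      (ae_of_all _ (excess_nonneg R)), ← ENNReal.ofReal_mul (by positivity),
      ← ENNReal.ofReal_add (by positivity) (by positivity),
      ← ENNReal.ofReal_add (integral_nonneg (excess_nonneg R)) (by positivity)]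
    refine ENNReal.ofReal_le_ofReal ?_
    have hs : Real.sqrt F ≤ a / 2 + F / (2 * a) := by
      have h1 := Real.sq_sqrt hF
      have h2 : a / 2 + F / (2 * a) = (a ^ 2 + Real.sqrt F ^ 2) / (2 * a) := by
        rw [h1]; field_simp
      rw [h2, le_div_iff₀ (by positivity)]
      nlinarith [sq_nonneg (a - Real.sqrt F)]
    have h3 := mul_le_mul_of_nonneg_left hs hR.le
    have h4 : R * (a / 2 + F / (2 * a)) = R * (a / 2) + R / (2 * a) * F := by ring
    linarith
  refine (lintegral_mono_ae hpt).trans ?_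
  rw [lintegral_const_mul' _ _ ENNReal.ofReal_ne_top,
    lintegral_add_left (measurable_lintegral_weightedEmpirical hY w t hxm),
    lintegral_add_left measurable_const, lintegral_const, measure_univ, mul_one,
    lintegral_const_mul' _ _ ENNReal.ofReal_ne_top, ENNReal.ofReal_mul hC]
  gcongr
  calc _ ≤ ENNReal.ofReal H + (ENNReal.ofReal (H + R / n + R * (a / 2)) +
        ENNReal.ofReal (R / (2 * a)) * ENNReal.ofReal (a ^ 2)) := by
        gcongr
        exact lintegral_lintegral_weightedEmpirical_le hY w t hxm hHY
    _ = _ := by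
        rw [← ENNReal.ofReal_mul (by positivity), ← ENNReal.ofReal_add (by positivity)
          (by positivity), ← ENNReal.ofReal_add hH0 (by positivity)]
        congr 1
        field_simp
        ring

end

section

variable {d : ℕ} {Ω : Type*} {mΩ : MeasurableSpace Ω} {Pr : Measure Ω} [IsProbabilityMeasure Pr]
  {ℱ : Filtration ℝ≥0 mΩ} {Y : ℝ≥0 → Ω → EuclideanSpace ℝ (Fin d)}
  {P : ℝ≥0 → Kernel (EuclideanSpace ℝ (Fin d)) (EuclideanSpace ℝ (Fin d))} {D c M : ℝ}

lemma lintegral_enorm_le_of_eLpNorm_le (hm : ∀ t, Measurable (Y t)) {q : ℝ≥0∞} (hq : 1 ≤ q)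
    (hYq : ∀ t, eLpNorm (Y t) q Pr ≤ ENNReal.ofReal M) (t : ℝ≥0) :
    ∫⁻ ω, ‖Y t ω‖ₑ ∂Pr ≤ ENNReal.ofReal M := by
  rw [← eLpNorm_one_eq_lintegral_enorm]
  exact (eLpNorm_le_eLpNorm_of_exponent_le hq (hm t).aestronglyMeasurable).trans (hYq t)

/-- The rate of convergence, with an explicit constant, at every time at which the weights satisfy
the bound `K`. -/
theorem lintegral_W1_weightedEmpirical_le_rate (hd : 1 ≤ d) (h : IsMarkovProcess Y P ℱ Pr)
    (hY : Measurable (Function.uncurry Y)) (hcontr : IsExpContractive P D c) (hc : 0 < c)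
    (hD : 1 ≤ D) (hM : 0 < M) {q : ℝ≥0∞} (hq : 1 < q)
    (hYq : ∀ t, eLpNorm (Y t) q Pr ≤ ENNReal.ofReal M)
    {μ : Measure (EuclideanSpace ℝ (Fin d))} (hμ : IsInvariantP1 P μ)
    (hμM : ∫⁻ x, ‖x‖ₑ ∂μ ≤ ENNReal.ofReal M)
    (hlim : Tendsto (fun n : ℕ => W1 (Pr.map (Y n)) μ) atTop (𝓝 0))
    {ε : ℝ} (hε : 0 < ε) (hε1 : ε ≤ 1) {w : WeightFamily} {t : ℝ≥0} {K : ℝ} (hK1 : 1 ≤ K)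
    (hK : ∫⁻ s₁ : unitInterval, ∫⁻ s₂ : unitInterval,
      min ((t : ℝ≥0∞) ^ ε) (ENNReal.ofReal |(s₁ : ℝ) - (s₂ : ℝ)| ^ (-ε))
        ∂(w t : Measure unitInterval) ∂(w t : Measure unitInterval) ≤ ENNReal.ofReal K)
    (hτ : Real.exp 1 ≤ (t : ℝ) ^ ε) (hrate : rate d ((t : ℝ) ^ ε) ≤ 1) :
    ∫⁻ ω, W1 (weightedEmpirical Y w t ω) μ ∂Pr ≤
      ENNReal.ofReal (24 * d ^ 2 * (3 + Real.sqrt (2 * d * 3 ^ (d - 1) * 4 ^ d *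
        (4 * (1 + 2 / c) * (1 + Real.log (2 * d * D)) * K))) *
          (M * rate d ((t : ℝ) ^ ε) ^ (1 - (1 / q).toReal))) := by
  have hd' : (1 : ℝ) ≤ d := by exact_mod_cast hd
  have hYM := lintegral_enorm_le_of_eLpNorm_le h.measurable hq.le hYq
  have ht : 0 < t := by
    rcases eq_or_ne t 0 with rfl | h0
    · rw [NNReal.coe_zero, Real.zero_rpow hε.ne'] at hτ
      linarith [Real.exp_pos 1]
    · exact pos_iff_ne_zero.2 h0
  set τ := (t : ℝ) ^ ε with hτdef
  have h1 : 1 ≤ τ := (Real.one_le_exp zero_le_one).trans hτ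
  have h0 : 0 < τ := one_pos.trans_le h1
  have hl : 1 ≤ Real.log τ := (Real.le_log_iff_exp_le h0).2 hτ
  set x := τ ^ (1 / (d : ℝ)) with hx
  have hx1 : 1 ≤ x := Real.one_le_rpow h1 (by positivity)
  have hxτ : x ≤ τ := by
    calc x ≤ τ ^ (1 : ℝ) :=
          Real.rpow_le_rpow_of_exponent_le h1 (div_le_one_of_le₀ hd' (by positivity))
      _ = τ := Real.rpow_one τ
  set n := ⌈x⌉₊ with hn
  have hnx : x ≤ n := Nat.le_ceil x
  have hn1 : 1 ≤ n := by exact_mod_cast hx1.trans hnx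
  have hn2 : (n : ℝ) ≤ 2 * x := by
    have := Nat.ceil_lt_add_one (zero_le_one.trans hx1)
    linarith
  set ρ := rate d τ with hρ
  have hxρ : x⁻¹ ≤ ρ := by
    have := rpow_neg_inv_le_rate hd hτ
    rwa [Real.rpow_neg h0.le] at this
  have hρ0 : 0 < ρ := (inv_pos.2 (one_pos.trans_le hx1)).trans_le hxρ
  set b := (1 / q).toReal with hb
  set H := M * ρ ^ (1 - b) with hH
  -- The level at which the tail and the bulk contribute equally: `R * ρ = M ^ q * R ^ (1 - q)`.
  set R := M * ρ ^ (-b) with hR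
  have hMR : M ≤ R := le_mul_of_one_le_right hM.le
    (Real.one_le_rpow_of_pos_of_le_one_of_nonpos hρ0 hrate (neg_nonpos.2 ENNReal.toReal_nonneg))
  have hR0 : 0 < R := hM.trans_le hMR
  have hRρ : R * ρ = H := by
    rw [hR, hH, mul_assoc, ← Real.rpow_add_one hρ0.ne']
    congr 2
    ring
  have hH0 : 0 ≤ H := by positivity
  have hHY : ∀ s, ∫⁻ ω, ENNReal.ofReal (excess R (Y s ω)) ∂Pr ≤ ENNReal.ofReal H := fun s =>
    lintegral_excess_le hq hM (hYq s) hρ0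
  have hexc : LipschitzWith 1 (excess R : EuclideanSpace ℝ (Fin d) → ℝ) := lipschitzWith_excess R
  have hP1 : ∀ s : ℝ≥0, IsP1 (Pr.map (Y s)) := fun s => by
    have := Measure.isProbabilityMeasure_map (μ := Pr) (h.measurable s).aemeasurable
    rw [isP1_iff_lintegral_enorm, lintegral_map measurable_enorm (h.measurable s)]
    exact (hYM s).trans_lt ENNReal.ofReal_lt_top
  have hHμ : ∫ x, excess R x ∂μ ≤ H := by
    refine integral_le_of_tendsto_W1 (fun k : ℕ => hP1 k) hμ.1 hlim hexc fun k => ?_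
    rw [← ENNReal.ofReal_le_ofReal_iff hH0, ofReal_integral_eq_lintegral_ofReal
      ((hP1 k).integrable_lipschitz hexc) (ae_of_all _ (excess_nonneg R)),
      lintegral_map hexc.continuous.measurable.ennreal_ofReal (h.measurable _)]
    exact hHY _
  set ℓ₀ := 1 + Real.log (2 * d * D) with hℓ₀
  have hdD : 1 ≤ 2 * d * D := by nlinarith
  have hℓ₀1 : 1 ≤ ℓ₀ := by
    have := Real.log_nonneg hdD
    linarith
  -- Since `M ≤ R`, the logarithm of the prefactor is of order `log τ`, uniformly in `M` and `q`.
  have hA : d * n / R * D * M ≤ Real.exp (ℓ₀ * Real.log τ) := by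
    have e1 : d * n / R * D * M ≤ 2 * d * D * τ := by
      have : M / R ≤ 1 := div_le_one_of_le₀ hMR hR0.le
      calc d * n / R * D * M = d * n * D * (M / R) := by ring
        _ ≤ d * n * D * 1 := by gcongr
        _ ≤ d * (2 * τ) * D * 1 := by
            gcongr
            linarith
        _ = 2 * d * D * τ := by ring
    refine e1.trans ?_
    rw [← Real.log_le_iff_le_exp (by positivity), Real.log_mul (by positivity) h0.ne', hℓ₀]
    nlinarith [Real.log_nonneg hdD]
  have hdisc := lintegral_fourierDisc_weightedEmpirical_le h hY hcontr hc (zero_le_one.trans hD)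
    hM.le hYM hμ hμM hε hε1 ht (zero_le_one.trans hK1) hK hR0
    (one_le_mul_of_one_le_of_one_le hℓ₀1 hl) hA
  set B := 2 * d * 3 ^ (d - 1) * 4 ^ d * (4 * (1 + 2 / c) * ℓ₀ * K) with hB
  have hB0 : 0 < B := by positivity
  have hS : (∑ k ∈ (freqBox d n).erase 0, (∑ i, (k i : ℝ) ^ 2)⁻¹) *
      (4 * ((1 + 2 / c) * (ℓ₀ * Real.log τ) / τ) * K) ≤ (Real.sqrt B * ρ) ^ 2 := by
    have e1 := mul_le_mul_of_nonneg_right (sum_inv_sq_freqBox_le (d := d) n)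
      (by positivity : 0 ≤ 4 * ((1 + 2 / c) * (ℓ₀ * Real.log τ) / τ) * K)
    have e2 := mul_le_mul_of_nonneg_left (sum_pow_div_sq_mul_log_le hd hτ hn1 hn2)
      (by positivity : 0 ≤ 2 * (d : ℝ) * 3 ^ (d - 1) * (4 * (1 + 2 / c) * ℓ₀ * K))
    rw [mul_pow, Real.sq_sqrt hB0.le]
    refine e1.trans ((le_of_eq ?_).trans (e2.trans (le_of_eq ?_)))
    · ring
    · rw [hB]; ring
  refine (lintegral_W1_weightedEmpirical_le hd hY hYM hμ.1 w t hR0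
    (mul_pos (Real.sqrt_pos.2 hB0) hρ0) hH0 hHY hHμ hn1
    (hdisc.trans (ENNReal.ofReal_le_ofReal hS))).trans (ENNReal.ofReal_le_ofReal ?_)
  have hRn : R / n ≤ H := by
    rw [← hRρ, div_eq_mul_inv]
    refine mul_le_mul_of_nonneg_left (le_trans ?_ hxρ) hR0.le
    exact inv_anti₀ (one_pos.trans_le hx1) hnx
  have hRB : R * (Real.sqrt B * ρ) = Real.sqrt B * H := by rw [← hRρ]; ring
  rw [hRB, mul_assoc (24 * (d : ℝ) ^ 2)]
  refine mul_le_mul_of_nonneg_left ?_ (by positivity)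
  rw [add_mul]
  linarith

end

end MarkovW1

theorem mainTheorem4 (d : ℕ) (hd : 1 ≤ d) (D c ε : ℝ) (hD : 1 ≤ D) (hc : 0 < c)
    (hε : 0 < ε) (hε1 : ε ≤ 1) (w : MarkovW1.WeightFamily) (hw : MarkovW1.IsPi2 ε w) :
    ∃ C : ℝ, 0 < C ∧ ∃ T : ℝ≥0, 0 < T ∧
      ∀ (Ω : Type*) (mΩ : MeasurableSpace Ω) (Pr : Measure Ω) (ℱ : Filtration ℝ≥0 mΩ)
        (Y : ℝ≥0 → Ω → EuclideanSpace ℝ (Fin d))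
        (P : ℝ≥0 → Kernel (EuclideanSpace ℝ (Fin d)) (EuclideanSpace ℝ (Fin d)))
        (q : ℝ≥0∞) (M : ℝ),
        IsProbabilityMeasure Pr →
        MarkovW1.IsMarkovProcess Y P ℱ Pr →
        MarkovW1.IsExpContractive P D c →
        MarkovW1.IsFiniteAtZero P →
        Measurable (Function.uncurry Y) →
        1 < q → 0 < M → (∀ t, eLpNorm (Y t) q Pr ≤ ENNReal.ofReal M) →
        ∃ μstar : Measure (EuclideanSpace ℝ (Fin d)),
          MarkovW1.IsInvariantP1 P μstar ∧
          (∀ ν, MarkovW1.IsInvariantP1 P ν → ν = μstar) ∧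
          ∀ t : ℝ≥0, T ≤ t →
            ∫⁻ ω, MarkovW1.W1 (MarkovW1.weightedEmpirical Y w t ω) μstar ∂Pr ≤
              ENNReal.ofReal
                (C * (M * MarkovW1.rate d ((t : ℝ) ^ ε) ^ (1 - (1 / q).toReal))) := by
  obtain ⟨K', hK'⟩ := ENNReal.lt_iff_exists_nnreal_btwn.1 hw.double
  have htend : Tendsto (fun t : ℝ≥0 => (t : ℝ) ^ ε) atTop atTop :=
    (tendsto_rpow_atTop hε).comp (NNReal.tendsto_coe_atTop.2 tendsto_id)
  have hev := (eventually_lt_of_limsup_lt hK'.1).and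
    ((htend.eventually_ge_atTop (Real.exp 1)).and
      (htend.eventually (MarkovW1.eventually_rate_le_one hd)))
  obtain ⟨T, hT⟩ := eventually_atTop.1 hev
  have hd' : (1 : ℝ) ≤ d := by exact_mod_cast hd
  refine ⟨24 * d ^ 2 * (3 + Real.sqrt (2 * d * 3 ^ (d - 1) * 4 ^ d *
    (4 * (1 + 2 / c) * (1 + Real.log (2 * d * D)) * (max K' 1 : ℝ≥0)))), by positivity, max T 1,
    lt_max_of_lt_right one_pos, ?_⟩
  intro Ω mΩ Pr ℱ Y P q M hPr h hcontr _ hY hq hM hYq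
  have hYM := MarkovW1.lintegral_enorm_le_of_eLpNorm_le h.measurable hq.le hYq
  obtain ⟨μ, hμ, hμM, hlim⟩ := MarkovW1.exists_invariant (ρ := fun t => Pr.map (Y t)) h.semigroup
    hcontr hM.le hc (zero_le_one.trans hD)
    (fun t => Measure.isProbabilityMeasure_map (h.measurable t).aemeasurable) h.map_add
    fun t => by rw [lintegral_map measurable_enorm (h.measurable t)]; exact hYM t
  refine ⟨μ, hμ, fun ν hν => MarkovW1.IsInvariantP1.eq hc hcontr hν hμ, fun t ht => ?_⟩
  obtain ⟨h1, h2, h3⟩ := hT t ((le_max_left _ _).trans ht)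
  refine MarkovW1.lintegral_W1_weightedEmpirical_le_rate hd h hY hcontr hc hD hM hq hYq hμ hμM hlim
    hε hε1 (by exact_mod_cast le_max_right K' 1) (h1.le.trans ?_) h2 h3
  rw [ENNReal.ofReal_coe_nnreal]
  exact_mod_cast le_max_left K' 1
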